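/- Notation. $\mathbb D=\{|z|<1\}$; for $p\ge 0$, $\mathbf C_p=\{|z|=e^{-p}\}$; for $p>0$, $\mathbf A_p=\{e^{-p}<|z|<1\}$ and $$\mathbf S_p(z)=\lim_{N\to\infty}\sum_{k=-N}^{N}\frac{e^{2kp}+z}{e^{2kp}-z}.$$ A doubly connected domain is a plane domain whose complement in the Riemann sphere has exactly two connected components; its boundary then has two components. If $D$ is doubly connected with boundary components $B_1,B_2$, a hull in $D$ on $B_1$ is a set $K\subset D$ such that $D\setminus K$ is a doubly connected domain that has $B_2$ as a boundary component. A family $(K_s)_{a\le s<b}$ is a Loewner chain in $D$ on $B_1$ if each $K_s$ is a hull in $D$ on $B_1$, $K_{s_1}\subsetneq K_{s_2}$ for $a\le s_1<s_2<b$, and for every $c\in(a,b)$ the extremal length of the family of (locally rectifiable, open or closed) curves in $D\setminus K_{s+u}$ that disconnect $K_{s+u}\setminus K_s$ from $B_2$ in $D\setminus K_s$ tends to $0$ as $u\to0^+$, uniformly in $s\in[a,c]$. A hull in $\mathbb D$ with respect to $0$ is a compact connected set $F\subset\mathbb D$ that properly contains $\{0\}$ and for which $\mathbb D\setminus F$ is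 connected (so $\mathbb D\setminus F$ is doubly connected with boundary components $\mathbf C_0$ and $\partial F$). A family $(F_t)_{-\infty<t<0}$ is a Loewner chain in $\mathbb D$ with respect to $0$ if each $F_t$ is a hull in $\mathbb D$ with respect to $0$, $F_s\subsetneq F_t$ for $s<t<0$, and for every $t_0<0$ the family $(F_t\setminus F_{t_0})_{t_0\le t<0}$ is a Loewner chain in $\mathbb D\setminus F_{t_0}$ on $\partial F_{t_0}$. Proposition 4.1. Let $\chi:(-\infty,0)\to\mathbf C_0$ be continuous. Then there are a Loewner chain $(F_t)_{-\infty<t<0}$ in $\mathbb D$ with respect to $0$ and maps $g_t$, $-\infty<t<0$, such that each $g_t$ maps $\mathbb D\setminus F_t$ conformally onto $\mathbf A_{|t|}$, extends continuously to $\mathbf C_0$ with $g_t(\mathbf C_0)=\mathbf C_{|t|}$, and $$\partial_t g_t(z)=g_t(z)\,\mathbf S_{|t|}\big(g_t(z)/\chi_t\big)\quad(t<0,\ z\in\mathbb D\setminus F_t),$$ $$\lim_{t\to-\infty}e^t/g_t(z)=z\quad(z\in\mathbb D\setminus\{0\}),$$ where every $z\in\mathbb D\setminus\{0\}$ lies outside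 $F_t$ for all $t$ sufficiently close to $-\infty$. Moreover, such $F_t$ and $g_t$ are uniquely determined by $\chi$. They are called the standard disc Loewner hulls and maps driven by $\chi$. -/

import Mathlib

open Set Filter Topology MeasureTheory
open scoped ENNReal

namespace DiscLoewner

noncomputable section

/-- The open unit disc. -/
def disc : Set ℂ := Metric.ball 0 1

/-- The circle `C_p = {|z| = e^{-p}}`. -/
def circ (p : ℝ) : Set ℂ := Metric.sphere 0 (Real.exp (-p))

/-- The standard annulus `A_p = {e^{-p} < |z| < 1}` of modulus `p`. -/
def annulus (p : ℝ) : Set ℂ := {z | Real.exp (-p) < ‖z‖ ∧ ‖z‖ < 1}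

/-- The Schwarz function `S_p(z) = lim_N ∑_{k=-N}^{N} (e^{2kp} + z) / (e^{2kp} - z)`.
The limit exists for all `p > 0` and `z ≠ 0` off the poles `e^{2kp}`, in particular on `A_p`. -/
def schwarzS (p : ℝ) (z : ℂ) : ℂ :=
  limUnder atTop fun N : ℕ =>
    ∑ k ∈ Finset.Icc (-(N : ℤ)) (N : ℤ),
      (Complex.exp (2 * k * p) + z) / (Complex.exp (2 * k * p) - z)

/-- The set of connected components of a plane set. -/
def components (S : Set ℂ) : Set (Set ℂ) := {C | ∃ x ∈ S, C = connectedComponentIn S x}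

/-- `D` is a bounded doubly connected plane domain and its two boundary components are
`B₁` and `B₂`. As `D` is bounded, the components of its complement in the Riemann sphere
correspond to those of its complement in `ℂ`, and its boundary is its frontier in `ℂ`. -/
structure IsDoublyConnected (D B₁ B₂ : Set ℂ) : Prop where
  isOpen : IsOpen D
  isConnected : IsConnected D
  isBounded : Bornology.IsBounded D
  ncard_components_compl : (components Dᶜ).ncard = 2
  ne : B₁ ≠ B₂
  components_frontier : components (frontier D) = {B₁, B₂}

/-- For a doubly connected domain `D` whose boundary components are `B₂` and another one, `B₁`:
`K` is a hull in `D` on `B₁`, that is, `D \ K` is a doubly connected domain that still has `B₂`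
as a boundary component. -/
def IsHullOn (D B₂ K : Set ℂ) : Prop :=
  K ⊆ D ∧ ∃ B, IsDoublyConnected (D \ K) B B₂

/-- The `ρ`-length `∫_γ ρ |dz|` of a locally Lipschitz curve. -/
def curveLength (ρ : ℂ → ℝ≥0∞) (γ : ℝ → ℂ) : ℝ≥0∞ :=
  ∫⁻ t, ρ (γ t) * ‖deriv γ t‖ₑ

/-- The extremal length `sup_ρ (inf_{γ ∈ Γ} ∫_γ ρ |dz|)² / ∫ ρ² dA` of a family of curves, the
supremum over all Borel `ρ ≥ 0` whose area `∫ ρ² dA` is neither `0` nor `∞`. -/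
def extremalLength (Γ : Set (ℝ → ℂ)) : ℝ≥0∞ :=
  ⨆ (ρ : ℂ → ℝ≥0∞) (_ : Measurable ρ) (_ : ∫⁻ z, ρ z ^ 2 ≠ 0) (_ : ∫⁻ z, ρ z ^ 2 ≠ ∞),
    (⨅ γ ∈ Γ, curveLength ρ γ) ^ 2 / ∫⁻ z, ρ z ^ 2

/-- For `K ⊆ L ⊆ D` and a boundary component `B` of `D`: the family of the curves in `D \ L`
that disconnect `L \ K` from `B` (inside `D \ K`).

Curves are the locally Lipschitz maps `ℝ → ℂ`. By passing to arc length, these represent all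
locally rectifiable curves: open arcs (such as crosscuts) through a parameter interval that is
stretched to `ℝ`, closed curves and compact arcs through an extension that is constant outside
a compact interval. -/
def disconnectingCurves (D B K L : Set ℂ) : Set (ℝ → ℂ) :=
  {γ | LocallyLipschitz γ ∧ range γ ⊆ D \ L ∧
    ∀ C : Set ℂ, IsPreconnected C → C ⊆ ((D \ K) ∪ B) \ range γ →
      (C ∩ (L \ K)).Nonempty → ¬ (C ∩ B).Nonempty}

/-- `(K_s, a ≤ s < b)` is a Loewner chain in the doubly connected domain `D`, with boundary
components `B₁` and `B₂`, on `B₁`. -/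
structure IsLoewnerChainOn (D B₁ B₂ : Set ℂ) (K : ℝ → Set ℂ) (a b : ℝ) : Prop where
  isDoublyConnected : IsDoublyConnected D B₁ B₂
  isHullOn : ∀ s ∈ Ico a b, IsHullOn D B₂ (K s)
  ssubset : ∀ s₁ s₂, a ≤ s₁ → s₁ < s₂ → s₂ < b → K s₁ ⊂ K s₂
  extremalLength_lt : ∀ c ∈ Ioo a b, ∀ ε : ℝ, 0 < ε → ∃ δ : ℝ, 0 < δ ∧
    ∀ u ∈ Ioo 0 δ, ∀ s ∈ Icc a c, s + u < b →
      extremalLength (disconnectingCurves D B₂ (K s) (K (s + u))) < ENNReal.ofReal ε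

/-- `F` is a hull in `Ω` with respect to `x`: a compact connected subset of `Ω` that properly
contains `{x}` and does not separate `Ω`. -/
structure IsHullAt (Ω : Set ℂ) (x : ℂ) (F : Set ℂ) : Prop where
  isCompact : IsCompact F
  subset : F ⊆ Ω
  ssubset : {x} ⊂ F
  isConnected : IsConnected F
  isConnected_diff : IsConnected (Ω \ F)

/-- `(F_t, -∞ < t < b)` is a Loewner chain in the bounded simply connected domain `Ω` with
respect to `x ∈ Ω`. The values `F t` for `t ≥ b` play no role. -/
structure IsLoewnerChainAt (Ω : Set ℂ) (x : ℂ) (F : ℝ → Set ℂ) (b : ℝ) : Prop where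
  isHullAt : ∀ t < b, IsHullAt Ω x (F t)
  ssubset : ∀ s t, s < t → t < b → F s ⊂ F t
  isLoewnerChainOn : ∀ t₀ < b,
    IsLoewnerChainOn (Ω \ F t₀) (frontier (F t₀)) (frontier Ω) (fun t => F t \ F t₀) t₀ b

/-- `f` maps `D` conformally onto `E`. -/
structure IsConformalOnto (f : ℂ → ℂ) (D E : Set ℂ) : Prop where
  differentiableOn : DifferentiableOn ℂ f D
  injOn : InjOn f D
  image_eq : f '' D = E

/-- `f`, defined on `D`, extends continuously to the part `B` of the boundary of `D`, and the
extension maps `B` onto `B'`. -/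
def MapsBoundaryOnto (f : ℂ → ℂ) (D B B' : Set ℂ) : Prop :=
  ∃ f' : ℂ → ℂ, ContinuousOn f' (D ∪ B) ∧ EqOn f' f D ∧ f' '' B = B'

/-- `F_t` and `g_t`, `-∞ < t < 0`, are standard disc Loewner hulls and maps driven by `χ`.
The values `F t`, `g t` for `t ≥ 0`, and `g t z` for `z ∉ 𝔻 \ F_t`, play no role: the time
derivative of `g_t(z)` is taken within the set of the times at which `g_t(z)` is defined. -/
structure IsStandardDiscLE (χ : ℝ → ℂ) (F : ℝ → Set ℂ) (g : ℝ → ℂ → ℂ) : Prop where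
  isLoewnerChainAt : IsLoewnerChainAt disc 0 F 0
  isConformalOnto : ∀ t < 0, IsConformalOnto (g t) (disc \ F t) (annulus |t|)
  mapsBoundaryOnto : ∀ t < 0, MapsBoundaryOnto (g t) (disc \ F t) (circ 0) (circ |t|)
  hasDeriv : ∀ t < 0, ∀ z ∈ disc \ F t,
    HasDerivWithinAt (fun s => g s z) (g t z * schwarzS |t| (g t z / χ t))
      {s | s < 0 ∧ z ∈ disc \ F s} t
  tendsto : ∀ z ∈ disc \ {0}, (∀ᶠ t in atBot, z ∉ F t) ∧
    Tendsto (fun t : ℝ => (Real.exp t : ℂ) / g t z) atBot (𝓝 z)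

end

end DiscLoewner

/-!
Put `σ = e^{t/4}`, so that `e^t = σ⁴`, and let `L = log (e^t / g_t)`. The Schwarz function is the
sum of a Lambert series, `S_p(w) = 1 + Λ(q, w) - Λ(q, q / w)` with `Λ(q, x) = ∑ₖ 2 qᵏ x / (1 - qᵏ
x)` and `q = e^{-2p}` (`schwarzS_eq`), so that the Loewner equation becomes `dL/dσ = field κ σ L`,
where `field` tends to `0` with `σ`. Hence the singular initial condition `e^t / g_t(z) → z` is the
regular initial condition `L(0) = log z`, and the whole proposition is about the flow of a
nonautonomous holomorphic vector field on the shrinking strips `|Re L| < -4 log σ`.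

*The flow.* Projecting onto slightly smaller strips makes the field globally Lipschitz; its
solutions which stay in these strips are the trajectories (`IsTraj`), and the starting points of
the trajectories on `[0, b]` form the open set `aliveSet κ b`. The flow is holomorphic with
nonvanishing derivative. The bounds `le_re_schwarz` and `re_schwarz_le` on `Re S_p` provide
barriers, with two consequences. Solved backwards, every solution comes from a starting point, so
the flow maps `aliveSet κ b` onto the whole strip (`exists_isTraj_eq`). Solved forwards, a point at
which `g / χ` is at distance at least `r` from the pole `1` survives for some further time `δ`,
uniformly in the point (`exists_forward_survival`). The field commutes with the reflection in the
imaginary axis, so that this axis, which corresponds to the unit circle, is invariant.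

*The hulls.* Exponentiating, `e^t / g_t` becomes a conformal map `discMap` of `aliveDomain` onto
`{σ⁴ < |w| < σ⁻⁴}`, and the hull is the complement of `aliveDomain` in the closed disc. Its
frontier is a decreasing intersection of closures of images of thin rings, so it is connected, and
then so is the hull (`isConnected_frontier_hull`, `isConnected_hull`). The hulls grow strictly
(`exists_alive_not_alive`): were the sets of alive points equal at two times, Cauchy's theorem for
the displacement of the flow between these times, on a period rectangle, would give its real part
the same mean on both vertical sides, whereas it vanishes on the imaginary axis and is positive
near the boundary of the strip.

*Extremal length.* In the coordinate `ξ = log (χ_t / g_t)`, the semicircles `|ξ| = ρ`, `Re ξ > 0`,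
with `r < ρ < R`, enclose every point that is swallowed soon after the time `t`, by forward
survival. They are the images under `exp` of the vertical segments of a rectangle of width `log (R
/ r)` and height `π`, and the length–area inequality bounds the extremal length by `π / log (R /
r)` (`extremalLength_le_of_rectangle`, `exists_extremalLength_lt`).

*Uniqueness.* For another solution, `e^t / g_t(z)` lifts to a trajectory
(`mem_aliveDomain_of_solution`), so its domain is contained in that of the standard one and the
maps agree there. As both maps have the same image and the standard one is injective, the domains
agree.
-/

namespace DiscLoewner

/-! ### Ordinary differential equations with a holomorphic right-hand side -/

/-- A holomorphic function bounded by `M` on a disc of radius `d` satisfies a second order Taylor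
estimate whose constant depends only on `M` and `d`. -/
lemma norm_sub_sub_deriv_mul_le {f : ℂ → ℂ} {x h : ℂ} {d M : ℝ} (hd : 0 < d)
    (hf : DifferentiableOn ℂ f (Metric.ball x d)) (hM : ∀ y ∈ Metric.ball x d, ‖f y‖ ≤ M)
    (hh : ‖h‖ < d / 4) :
    ‖f (x + h) - f x - deriv f x * h‖ ≤ (M / (d / 2) / (d / 4)) * ‖h‖ ^ 2 := by
  have hf' : DifferentiableOn ℂ (deriv f) (Metric.ball x d) := hf.deriv Metric.isOpen_ball
  have h1 : ∀ y ∈ Metric.ball x (d / 2), ‖deriv f y‖ ≤ M / (d / 2 / 1) := by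
    intro y hy
    rw [Metric.mem_ball] at hy
    have hsub : Metric.closedBall y (d / 2 / 1) ⊆ Metric.ball x d :=
      Metric.closedBall_subset_ball' (by linarith)
    refine Complex.norm_deriv_le_of_forall_mem_sphere_norm_le (by positivity) ?_ ?_
    · exact (hf.mono hsub).diffContOnCl_ball subset_rfl
    · exact fun z hz => hM z (hsub (Metric.sphere_subset_closedBall hz))
  have h2 : ∀ y ∈ Metric.ball x (d / 4), ‖deriv (deriv f) y‖ ≤ M / (d / 2) / (d / 4) := by
    intro y hy
    rw [Metric.mem_ball] at hy
    have hsub : Metric.closedBall y (d / 4) ⊆ Metric.ball x (d / 2) :=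
      Metric.closedBall_subset_ball' (by linarith)
    refine Complex.norm_deriv_le_of_forall_mem_sphere_norm_le (by positivity) ?_ ?_
    · exact ((hf'.mono (Metric.ball_subset_ball (by linarith))).mono hsub).diffContOnCl_ball
        subset_rfl
    · intro z hz
      simpa using h1 z (hsub (Metric.sphere_subset_closedBall hz))
  have hsub4 : Metric.ball x (d / 4) ⊆ Metric.ball x d := Metric.ball_subset_ball (by linarith)
  have hC : 0 ≤ M / (d / 2) / (d / 4) :=
    (norm_nonneg _).trans (h2 x (Metric.mem_ball_self (by positivity)))
  have hseg : ∀ y ∈ segment ℝ x (x + h), y ∈ Metric.ball x (d / 4) ∧ ‖y - x‖ ≤ ‖h‖ := by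
    intro y hy
    have := norm_sub_le_of_mem_segment hy
    simp only [add_sub_cancel_left] at this
    exact ⟨by rw [mem_ball_iff_norm]; linarith, this⟩
  have h3 : ∀ y ∈ segment ℝ x (x + h), ‖deriv f y - deriv f x‖ ≤ M / (d / 2) / (d / 4) * ‖h‖ := by
    intro y hy
    obtain ⟨hy1, hy2⟩ := hseg y hy
    refine ((convex_ball x (d / 4)).norm_image_sub_le_of_norm_deriv_le
      (fun z hz => hf'.differentiableAt (Metric.isOpen_ball.mem_nhds (hsub4 hz))) h2
      (Metric.mem_ball_self (by positivity)) hy1).trans ?_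
    gcongr
  have h4 := (convex_segment x (x + h)).norm_image_sub_le_of_norm_hasDerivWithin_le
    (f := fun y => f y - deriv f x * y) (f' := fun y => deriv f y - deriv f x)
    (C := M / (d / 2) / (d / 4) * ‖h‖) (x := x) (y := x + h) (fun y hy => by
      have := (hf.differentiableAt (Metric.isOpen_ball.mem_nhds
        (hsub4 (hseg y hy).1))).hasDerivAt.fun_sub ((hasDerivAt_id' y).const_mul (deriv f x))
      simpa using this.hasDerivWithinAt) h3 (left_mem_segment _ _ _) (right_mem_segment _ _ _)
  calc _ = ‖f (x + h) - deriv f x * (x + h) - (f x - deriv f x * x)‖ := by ring_nf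
    _ ≤ _ := h4
    _ = _ := by rw [add_sub_cancel_left]; ring

lemma norm_deriv_le_of_ball {f : ℂ → ℂ} {x : ℂ} {d M : ℝ} (hd : 0 < d)
    (hf : DifferentiableOn ℂ f (Metric.ball x d)) (hM : ∀ y ∈ Metric.ball x d, ‖f y‖ ≤ M) :
    ‖deriv f x‖ ≤ M / (d / 2) := by
  have hsub : Metric.closedBall x (d / 2) ⊆ Metric.ball x d :=
    Metric.closedBall_subset_ball (by linarith)
  exact Complex.norm_deriv_le_of_forall_mem_sphere_norm_le (by positivity)
    ((hf.mono hsub).diffContOnCl_ball subset_rfl)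
    fun z hz => hM z (hsub (Metric.sphere_subset_closedBall hz))

/-- Solutions of an ODE with a holomorphic right-hand side depend holomorphically on the initial
value: the derivative solves the linearised equation. -/
lemma exists_hasDerivAt_flow {f : ℝ → ℂ → ℂ} {b M d C : ℝ} (hb : 0 ≤ b) (hd : 0 < d)
    (hM0 : 0 < M) {γ : ℂ → ℝ → ℂ} {z₀ : ℂ}
    (hf : ∀ σ ∈ Icc 0 b, DifferentiableOn ℂ (f σ) (Metric.ball (γ z₀ σ) d))
    (hM : ∀ σ ∈ Icc 0 b, ∀ y ∈ Metric.ball (γ z₀ σ) d, ‖f σ y‖ ≤ M)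
    (hcont : ∀ h : ℂ, ‖h‖ < d → ContinuousOn (fun σ => f σ (γ z₀ σ + h)) (Icc 0 b))
    (hsol : ∀ᶠ z in 𝓝 z₀, γ z 0 = z ∧ ∀ σ ∈ Icc 0 b,
      HasDerivWithinAt (γ z) (f σ (γ z σ)) (Icc 0 b) σ ∧ ‖γ z σ - γ z₀ σ‖ ≤ C * ‖z - z₀‖) :
    ∃ J, HasDerivAt (fun z => γ z b) J z₀ := by
  set a : ℝ → ℂ := fun σ => deriv (f σ) (γ z₀ σ) with ha
  set C₂ := M / (d / 2) / (d / 4) with hC₂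
  have hC₂0 : 0 < C₂ := by positivity
  set A := M / (d / 2) with hA
  have hA0 : 0 < A := by positivity
  have hT : ∀ σ ∈ Icc 0 b, ∀ h : ℂ, ‖h‖ < d / 4 →
      ‖f σ (γ z₀ σ + h) - f σ (γ z₀ σ) - a σ * h‖ ≤ C₂ * ‖h‖ ^ 2 :=
    fun σ hσ h hh => norm_sub_sub_deriv_mul_le hd (hf σ hσ) (hM σ hσ) hh
  have haA : ∀ σ ∈ Icc 0 b, ‖a σ‖ ≤ A := fun σ hσ => norm_deriv_le_of_ball hd (hf σ hσ) (hM σ hσ)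
  -- the coefficient of the linearised equation is a uniform limit of difference quotients
  have hac : ContinuousOn a (Icc 0 b) := by
    let e : ℝ → ℝ → ℂ := fun h σ => (f σ (γ z₀ σ + h) - f σ (γ z₀ σ)) / h
    have hu : TendstoUniformlyOn e a (𝓝[>] 0) (Icc 0 b) := by
      rw [Metric.tendstoUniformlyOn_iff]
      intro η hη
      have h1 : ∀ᶠ h : ℝ in 𝓝[>] 0, h < d / 4 ∧ h < η / C₂ :=
        (eventually_nhdsWithin_of_eventually_nhds
          ((eventually_lt_nhds (by positivity)).and (eventually_lt_nhds (by positivity))))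
      filter_upwards [h1, self_mem_nhdsWithin] with h ⟨hh1, hh2⟩ hh0 σ hσ
      have hh0 : 0 < h := hh0
      have hhn : ‖(h : ℂ)‖ = h := by simp [abs_of_pos hh0]
      have := hT σ hσ h (by rw [hhn]; exact hh1)
      have hne : (h : ℂ) ≠ 0 := by exact_mod_cast hh0.ne'
      have hid : e h σ - a σ = (f σ (γ z₀ σ + h) - f σ (γ z₀ σ) - a σ * h) / h := by
        simp only [e]; field_simp
      rw [dist_comm, dist_eq_norm, hid, norm_div, hhn, div_lt_iff₀ hh0]
      refine this.trans_lt ?_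
      rw [hhn, sq, ← mul_assoc]
      gcongr
      rwa [lt_div_iff₀' hC₂0] at hh2
    refine hu.continuousOn (Eventually.frequently ?_)
    have h1 : ∀ᶠ h : ℝ in 𝓝[>] 0, h < d :=
      eventually_nhdsWithin_of_eventually_nhds (eventually_lt_nhds hd)
    filter_upwards [h1, self_mem_nhdsWithin] with h hh hh0
    have hh0 : 0 < h := hh0
    have hhn : ‖(h : ℂ)‖ = h := by simp [abs_of_pos hh0]
    have h0 := hcont 0 (by simpa using hd)
    simp only [add_zero] at h0
    exact ((hcont h (by rwa [hhn])).sub h0).div_const _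
  -- a continuous extension of the coefficient to the line
  set a' : ℝ → ℂ := IccExtend hb ((Icc 0 b).domRestrict a) with ha'
  have ha'c : Continuous a' := hac.domRestrict.Icc_extend'
  have ha'eq : ∀ σ ∈ Icc 0 b, a' σ = a σ := fun σ hσ => IccExtend_of_mem hb _ hσ
  set J : ℝ → ℂ := fun σ => Complex.exp (∫ s in (0 : ℝ)..σ, a' s) with hJ
  have hJd : ∀ σ, HasDerivAt J (a' σ * J σ) σ := by
    intro σ
    have := (intervalIntegral.integral_hasDerivAt_right (ha'c.intervalIntegrable 0 σ)
      (ha'c.stronglyMeasurableAtFilter _ _) ha'c.continuousAt).cexp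
    simpa [hJ, mul_comm] using this
  have hJ0 : J 0 = 1 := by simp [hJ]
  refine ⟨J b, ?_⟩
  have hb0 : (0 : ℝ) ∈ Icc 0 b := ⟨le_rfl, hb⟩
  obtain ⟨hz0, hs0⟩ := hsol.self_of_nhds
  set D := C₂ * C ^ 2 * (Real.exp (A * b) - 1) / A with hD
  have key : ∀ᶠ z in 𝓝 z₀, ‖γ z b - γ z₀ b - (z - z₀) * J b‖ ≤ D * ‖z - z₀‖ ^ 2 := by
    have hsmall : ∀ᶠ z in 𝓝 z₀, C * ‖z - z₀‖ < d / 4 := by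
      have : Tendsto (fun z => C * ‖z - z₀‖) (𝓝 z₀) (𝓝 (C * ‖z₀ - z₀‖)) :=
        Continuous.tendsto (by fun_prop) z₀
      simp only [sub_self, norm_zero, mul_zero] at this
      exact this.eventually (gt_mem_nhds (by positivity))
    filter_upwards [hsol, hsmall] with z ⟨hz1, hz2⟩ hz3
    have hder : ∀ σ ∈ Icc 0 b, HasDerivWithinAt (fun σ => γ z σ - γ z₀ σ - (z - z₀) * J σ)
        (f σ (γ z σ) - f σ (γ z₀ σ) - (z - z₀) * (a' σ * J σ)) (Icc 0 b) σ := fun σ hσ =>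
      ((hz2 σ hσ).1.sub (hs0 σ hσ).1).sub ((hJd σ).hasDerivWithinAt.const_mul _)
    have := norm_le_gronwallBound_of_norm_deriv_right_le (δ := 0) (K := A)
      (ε := C₂ * C ^ 2 * ‖z - z₀‖ ^ 2) (a := 0) (b := b)
      (f := fun σ => γ z σ - γ z₀ σ - (z - z₀) * J σ)
      (f' := fun σ => f σ (γ z σ) - f σ (γ z₀ σ) - (z - z₀) * (a' σ * J σ))
      (fun σ hσ => (hder σ hσ).continuousWithinAt)
      (fun σ hσ => (hder σ ⟨hσ.1, hσ.2.le⟩).mono_of_mem_nhdsWithin (Icc_mem_nhdsGE_of_mem hσ))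
      (by simp [hz1, hz0, hJ0]) ?_ b ⟨hb, le_rfl⟩
    · rw [gronwallBound_of_K_ne_0 hA0.ne'] at this
      refine this.trans (le_of_eq ?_)
      simp only [hD, sub_zero]
      ring
    · intro σ hσ
      have hσ' : σ ∈ Icc 0 b := ⟨hσ.1, hσ.2.le⟩
      rw [ha'eq σ hσ']
      have h1 := (hz2 σ hσ').2
      have h2 := hT σ hσ' (γ z σ - γ z₀ σ) (h1.trans_lt hz3)
      rw [add_sub_cancel] at h2
      calc _ = ‖(f σ (γ z σ) - f σ (γ z₀ σ) - a σ * (γ z σ - γ z₀ σ)) +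
            a σ * (γ z σ - γ z₀ σ - (z - z₀) * J σ)‖ := by ring_nf
        _ ≤ C₂ * ‖γ z σ - γ z₀ σ‖ ^ 2 + A * ‖γ z σ - γ z₀ σ - (z - z₀) * J σ‖ := by
            refine (norm_add_le _ _).trans (add_le_add h2 ?_)
            rw [norm_mul]
            gcongr
            exact haA σ hσ'
        _ ≤ C₂ * (C * ‖z - z₀‖) ^ 2 + A * ‖γ z σ - γ z₀ σ - (z - z₀) * J σ‖ := by gcongr
        _ = _ := by ring
  rw [hasDerivAt_iff_isLittleO]
  have h1 : (fun z => γ z b - γ z₀ b - (z - z₀) • J b) =O[𝓝 z₀] fun z => ‖z - z₀‖ ^ 2 := by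
    refine Asymptotics.IsBigO.of_bound D ?_
    filter_upwards [key] with z hz
    simpa using hz
  refine h1.trans_isLittleO ?_
  have h2 : (fun z => ‖z - z₀‖ ^ 2) =o[𝓝 z₀] fun z => ‖z - z₀‖ := by
    have : (fun z => ‖z - z₀‖) =o[𝓝 z₀] fun _ => (1 : ℝ) := by
      rw [Asymptotics.isLittleO_one_iff]
      have : Tendsto (fun z => ‖z - z₀‖) (𝓝 z₀) (𝓝 ‖z₀ - z₀‖) :=
        Continuous.tendsto (by fun_prop) z₀
      simpa using this
    simpa [sq] using this.mul_isBigO (Asymptotics.isBigO_refl (fun z => ‖z - z₀‖) (𝓝 z₀))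
  exact h2.of_norm_right

/-- The flow of a bounded, globally Lipschitz, time-continuous vector field on a compact time
interval exists, and depends on the value at the base time in a Lipschitz way. -/
lemma exists_flow {f : ℝ → ℂ → ℂ} {b K s : ℝ} (hs : s ∈ Icc 0 b) (hK : 0 ≤ K)
    (hlip : ∀ t ∈ Icc 0 b, ∀ x y, ‖f t x - f t y‖ ≤ K * ‖x - y‖)
    (hbd : ∀ t ∈ Icc 0 b, ∀ x, ‖f t x‖ ≤ K)
    (hcont : ∀ x, ContinuousOn (fun t => f t x) (Icc 0 b)) (x₀ : ℂ) :
    ∃ (α : ℂ → ℝ → ℂ) (C : ℝ), 0 ≤ C ∧ (∀ x ∈ Metric.closedBall x₀ 1, α x s = x ∧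
      ∀ t ∈ Icc 0 b, HasDerivWithinAt (α x) (f t (α x t)) (Icc 0 b) t) ∧
      ∀ x ∈ Metric.closedBall x₀ 1, ∀ y ∈ Metric.closedBall x₀ 1, ∀ t ∈ Icc 0 b,
        ‖α x t - α y t‖ ≤ C * ‖x - y‖ := by
  have hmax : 0 ≤ max (b - s) (s - 0) := le_max_of_le_left (sub_nonneg.2 hs.2)
  have hp : IsPicardLindelof f (⟨s, hs⟩ : Icc 0 b) x₀
      (⟨K * max (b - s) (s - 0) + 1, by positivity⟩) 1 ⟨K, hK⟩ ⟨K, hK⟩ :=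
    { lipschitzOnWith := fun t ht => (LipschitzWith.of_dist_le_mul fun x y => by
        rw [dist_eq_norm, dist_eq_norm]; exact hlip t ht x y).lipschitzOnWith
      continuousOn := fun x _ => hcont x
      norm_le := fun t ht x _ => hbd t ht x
      mul_max_le := by
        change K * max (b - s) (s - 0) ≤ K * max (b - s) (s - 0) + 1 - 1
        linarith }
  obtain ⟨α, h1, L', h2⟩ := hp.exists_forall_mem_closedBall_eq_hasDerivWithinAt_lipschitzOnWith
  refine ⟨α, L', L'.2, h1, fun x hx y hy t ht => ?_⟩
  simpa [dist_eq_norm] using (h2 t ht).dist_le_mul x hx y hy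

/-- Two solutions of an ODE on `[0, b]` which stay in a region where the right-hand side is
Lipschitz and agree at one time agree at all times. -/
lemma eqOn_of_ode {f : ℝ → ℂ → ℂ} {b K s : ℝ} (hs : s ∈ Icc 0 b) (hK : 0 ≤ K) {R : ℝ → Set ℂ}
    (hlip : ∀ t ∈ Icc 0 b, ∀ x ∈ R t, ∀ y ∈ R t, ‖f t x - f t y‖ ≤ K * ‖x - y‖)
    {α β : ℝ → ℂ} (hα : ∀ t ∈ Icc 0 b, HasDerivWithinAt α (f t (α t)) (Icc 0 b) t)
    (hαR : ∀ t ∈ Icc 0 b, α t ∈ R t)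
    (hβ : ∀ t ∈ Icc 0 b, HasDerivWithinAt β (f t (β t)) (Icc 0 b) t)
    (hβR : ∀ t ∈ Icc 0 b, β t ∈ R t) (h : α s = β s) : EqOn α β (Icc 0 b) := by
  have hlip' : ∀ t ∈ Icc 0 b, LipschitzOnWith ⟨K, hK⟩ (f t) (R t) := fun t ht =>
    LipschitzOnWith.of_dist_le_mul fun x hx y hy => by
      rw [dist_eq_norm, dist_eq_norm]; exact hlip t ht x hx y hy
  have hαc : ContinuousOn α (Icc 0 b) := fun t ht => (hα t ht).continuousWithinAt
  have hβc : ContinuousOn β (Icc 0 b) := fun t ht => (hβ t ht).continuousWithinAt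
  rw [← Icc_union_Icc_eq_Icc hs.1 hs.2]
  have i1 : Icc 0 s ⊆ Icc 0 b := Icc_subset_Icc_right hs.2
  have i2 : Icc s b ⊆ Icc 0 b := Icc_subset_Icc_left hs.1
  refine EqOn.union ?_ ?_
  · have aux : ∀ t ∈ Ioc 0 s, Icc 0 b ∈ 𝓝[≤] t := fun t ht =>
      mem_of_superset (Icc_mem_nhdsLE_of_mem ht) i1
    have j : Ioc 0 s ⊆ Icc 0 b := Ioc_subset_Icc_self.trans i1
    exact ODE_solution_unique_of_mem_Icc_left (fun t ht => hlip' t (j ht)) (hαc.mono i1)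
      (fun t ht => (hα t (j ht)).mono_of_mem_nhdsWithin (aux t ht)) (fun t ht => hαR t (j ht))
      (hβc.mono i1) (fun t ht => (hβ t (j ht)).mono_of_mem_nhdsWithin (aux t ht))
      (fun t ht => hβR t (j ht)) h
  · have aux : ∀ t ∈ Ico s b, Icc 0 b ∈ 𝓝[≥] t := fun t ht =>
      mem_of_superset (Icc_mem_nhdsGE_of_mem ht) i2
    have j : Ico s b ⊆ Icc 0 b := Ico_subset_Icc_self.trans i2
    exact ODE_solution_unique_of_mem_Icc_right (fun t ht => hlip' t (j ht)) (hαc.mono i2)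
      (fun t ht => (hα t (j ht)).mono_of_mem_nhdsWithin (aux t ht)) (fun t ht => hαR t (j ht))
      (hβc.mono i2) (fun t ht => (hβ t (j ht)).mono_of_mem_nhdsWithin (aux t ht))
      (fun t ht => hβR t (j ht)) h

/-! ### A Lambert series and the Schwarz function -/

/-- The Lambert series `∑ₖ 2 qᵏ x / (1 - qᵏ x)`. With `q = e^{-2p}`, the Schwarz function of the
annulus of modulus `p` is `1 + lambert q z - lambert q (q / z)`. -/
noncomputable def lambert (q : ℝ) (x : ℂ) : ℂ :=
  ∑' k : ℕ, 2 * ((q : ℂ) ^ k * x) / (1 - (q : ℂ) ^ k * x)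

lemma one_sub_norm_le_norm_one_sub {a : ℂ} {ρ : ℝ} (ha : ‖a‖ ≤ ρ) : 1 - ρ ≤ ‖1 - a‖ := by
  have := norm_sub_norm_le (1 : ℂ) a
  rw [norm_one] at this
  linarith

lemma one_sub_ne_zero_of_norm {a : ℂ} (ha : ‖a‖ < 1) : 1 - a ≠ 0 := by
  intro h
  rw [sub_eq_zero] at h
  simp [← h] at ha

lemma norm_lambert_term_sub_le {a b : ℂ} {ρ : ℝ} (hρ : ρ < 1) (ha : ‖a‖ ≤ ρ) (hb : ‖b‖ ≤ ρ) :
    ‖2 * a / (1 - a) - 2 * b / (1 - b)‖ ≤ 2 / (1 - ρ) ^ 2 * ‖a - b‖ := by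
  have ha' := one_sub_ne_zero_of_norm (ha.trans_lt hρ)
  have hb' := one_sub_ne_zero_of_norm (hb.trans_lt hρ)
  have : 2 * a / (1 - a) - 2 * b / (1 - b) = 2 * (a - b) / ((1 - a) * (1 - b)) := by
    field_simp; ring
  have h1 : 0 < 1 - ρ := by linarith
  rw [this, norm_div, norm_mul, norm_mul, div_mul_eq_mul_div, sq, Complex.norm_ofNat]
  have := one_sub_norm_le_norm_one_sub ha
  have := one_sub_norm_le_norm_one_sub hb
  gcongr

lemma norm_pow_mul_le {q ρ : ℝ} (hq0 : 0 ≤ q) (hq : q < 1) {x : ℂ} (hx : ‖x‖ ≤ ρ) (k : ℕ) :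
    ‖(q : ℂ) ^ k * x‖ ≤ ρ := by
  rw [norm_mul, norm_pow, Complex.norm_real, Real.norm_of_nonneg hq0]
  calc q ^ k * ‖x‖ ≤ 1 * ‖x‖ := by gcongr; exact pow_le_one₀ hq0 hq.le
    _ ≤ ρ := by linarith

lemma norm_lambert_term_le {q ρ : ℝ} (hq0 : 0 ≤ q) (hq : q < 1) (hρ : ρ < 1) {x : ℂ}
    (hx : ‖x‖ ≤ ρ) (k : ℕ) :
    ‖2 * ((q : ℂ) ^ k * x) / (1 - (q : ℂ) ^ k * x)‖ ≤ 2 / (1 - ρ) ^ 2 * ‖x‖ * q ^ k := by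
  have h := norm_lambert_term_sub_le hρ (norm_pow_mul_le hq0 hq hx k) (b := 0)
    (by simpa using (norm_nonneg x).trans hx)
  simp only [mul_zero, sub_zero, zero_div, norm_mul, norm_pow, Complex.norm_real,
    Real.norm_of_nonneg hq0] at h
  calc _ ≤ _ := h
    _ = _ := by ring

lemma summable_lambert {q : ℝ} (hq0 : 0 ≤ q) (hq : q < 1) {x : ℂ} (hx : ‖x‖ < 1) :
    Summable fun k : ℕ => 2 * ((q : ℂ) ^ k * x) / (1 - (q : ℂ) ^ k * x) :=
  Summable.of_norm_bounded ((summable_geometric_of_lt_one hq0 hq).mul_left _)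
    fun k => norm_lambert_term_le hq0 hq hx le_rfl k

@[simp] lemma lambert_zero (q : ℝ) : lambert q 0 = 0 := by simp [lambert]

lemma norm_lambert_sub_le {q ρ : ℝ} (hq0 : 0 ≤ q) (hq : q < 1) (hρ : ρ < 1) {x y : ℂ}
    (hx : ‖x‖ ≤ ρ) (hy : ‖y‖ ≤ ρ) :
    ‖lambert q x - lambert q y‖ ≤ 2 / ((1 - q) * (1 - ρ) ^ 2) * ‖x - y‖ := by
  rw [lambert, lambert, ← (summable_lambert hq0 hq (hx.trans_lt hρ)).tsum_sub
    (summable_lambert hq0 hq (hy.trans_lt hρ))]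
  have hs := (hasSum_geometric_of_lt_one hq0 hq).mul_left (2 / (1 - ρ) ^ 2 * ‖x - y‖)
  refine (tsum_of_norm_bounded hs fun k => ?_).trans (le_of_eq ?_)
  · refine (norm_lambert_term_sub_le hρ (norm_pow_mul_le hq0 hq hx k)
      (norm_pow_mul_le hq0 hq hy k)).trans (le_of_eq ?_)
    rw [← mul_sub, norm_mul, norm_pow, Complex.norm_real, Real.norm_of_nonneg hq0]
    ring
  · have : 1 - q ≠ 0 := by linarith
    have : 1 - ρ ≠ 0 := by linarith
    field_simp

lemma norm_lambert_le {q ρ : ℝ} (hq0 : 0 ≤ q) (hq : q < 1) (hρ : ρ < 1) {x : ℂ}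
    (hx : ‖x‖ ≤ ρ) : ‖lambert q x‖ ≤ 2 / ((1 - q) * (1 - ρ) ^ 2) * ‖x‖ := by
  simpa using norm_lambert_sub_le hq0 hq hρ hx (y := 0) (by simpa using (norm_nonneg x).trans hx)

lemma lambert_eq_add {q : ℝ} (hq0 : 0 ≤ q) (hq : q < 1) {x : ℂ} (hx : ‖x‖ < 1) :
    lambert q x = 2 * x / (1 - x) + lambert q (q * x) := by
  rw [lambert, (summable_lambert hq0 hq hx).tsum_eq_zero_add, lambert]
  simp only [pow_zero, one_mul, pow_succ, mul_assoc]

lemma lambert_conj (q : ℝ) (x : ℂ) :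
    lambert q ((starRingEnd ℂ) x) = (starRingEnd ℂ) (lambert q x) := by
  have h2 : (starRingEnd ℂ) 2 = 2 := map_ofNat _ 2
  rw [lambert, lambert, Complex.conj_tsum]
  simp [h2]

lemma continuousOn_lambert {q₀ ρ : ℝ} (hq₀ : q₀ < 1) (hρ : ρ < 1) :
    ContinuousOn (fun p : ℝ × ℂ => lambert p.1 p.2) (Icc 0 q₀ ×ˢ Metric.closedBall 0 ρ) := by
  rcases lt_or_ge q₀ 0 with h | h
  · simp [Icc_eq_empty (not_le.2 h)]
  refine continuousOn_tsum (u := fun k => 2 / (1 - ρ) ^ 2 * ρ * q₀ ^ k) ?_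
    ((summable_geometric_of_lt_one h hq₀).mul_left _) ?_
  · intro k
    refine ContinuousOn.div (by fun_prop) (by fun_prop) ?_
    rintro ⟨q, x⟩ ⟨hq, hx⟩
    rw [mem_closedBall_zero_iff] at hx
    exact one_sub_ne_zero_of_norm
      ((norm_pow_mul_le hq.1 (hq.2.trans_lt hq₀) hx k).trans_lt hρ)
  · rintro k ⟨q, x⟩ ⟨hq, hx⟩
    rw [mem_closedBall_zero_iff] at hx
    refine (norm_lambert_term_le hq.1 (hq.2.trans_lt hq₀) hρ hx k).trans ?_
    have := hq.1
    have : q ≤ q₀ := hq.2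
    dsimp only at hx
    have hρ0 : 0 ≤ ρ := (norm_nonneg x).trans hx
    gcongr

lemma differentiableOn_lambert {q : ℝ} (hq0 : 0 ≤ q) (hq : q < 1) :
    DifferentiableOn ℂ (lambert q) (Metric.ball 0 1) := by
  intro x hx
  rw [mem_ball_zero_iff] at hx
  obtain ⟨ρ, hxρ, hρ⟩ := exists_between hx
  have : DifferentiableOn ℂ (lambert q) (Metric.ball 0 ρ) := by
    refine Complex.differentiableOn_tsum_of_summable_norm
      (u := fun k => 2 / (1 - ρ) ^ 2 * ρ * q ^ k)
      ((summable_geometric_of_lt_one hq0 hq).mul_left _) ?_ Metric.isOpen_ball ?_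
    · intro k y hy
      rw [mem_ball_zero_iff] at hy
      refine DifferentiableWithinAt.div (by fun_prop) (by fun_prop) ?_
      exact one_sub_ne_zero_of_norm ((norm_pow_mul_le hq0 hq hy.le k).trans_lt hρ)
    · intro k y hy
      rw [mem_ball_zero_iff] at hy
      refine (norm_lambert_term_le hq0 hq hρ hy.le k).trans ?_
      gcongr
  exact (this.differentiableAt (Metric.isOpen_ball.mem_nhds
    (by simpa using hxρ))).differentiableWithinAt

lemma sum_schwarz_eq {p : ℝ} {w : ℂ} (hw0 : Real.exp (-2 * p) < ‖w‖) (hw1 : ‖w‖ < 1)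
    (hp : 0 < p) (N : ℕ) :
    ∑ k ∈ Finset.Icc (-(N : ℤ)) (N : ℤ),
      (Complex.exp (2 * k * p) + w) / (Complex.exp (2 * k * p) - w) =
    1 + ∑ k ∈ Finset.range (N + 1),
        2 * ((Real.exp (-2 * p) : ℂ) ^ k * w) / (1 - (Real.exp (-2 * p) : ℂ) ^ k * w) -
      ∑ k ∈ Finset.range N, 2 * ((Real.exp (-2 * p) : ℂ) ^ k * (Real.exp (-2 * p) / w)) /
        (1 - (Real.exp (-2 * p) : ℂ) ^ k * (Real.exp (-2 * p) / w)) := by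
  set q : ℝ := Real.exp (-2 * p) with hq
  have hq0 : 0 < q := Real.exp_pos _
  have hq1 : q < 1 := by rw [hq, Real.exp_lt_one_iff]; linarith
  have hqc : (q : ℂ) ≠ 0 := by exact_mod_cast hq0.ne'
  have hwne : w ≠ 0 := by rw [← norm_pos_iff]; linarith
  have hexp : ∀ k : ℕ, Complex.exp (2 * k * p) = ((q : ℂ) ^ k)⁻¹ := by
    intro k
    rw [hq, Complex.ofReal_exp, ← Complex.exp_nat_mul, ← Complex.exp_neg]
    congr 1; push_cast; ring
  have hexp' : ∀ k : ℕ, Complex.exp (-(2 * k * p)) = (q : ℂ) ^ k := by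
    intro k; rw [Complex.exp_neg, hexp, inv_inv]
  have hne1 : ∀ k : ℕ, 1 - (q : ℂ) ^ k * w ≠ 0 := fun k =>
    one_sub_ne_zero_of_norm ((norm_pow_mul_le hq0.le hq1 le_rfl k).trans_lt hw1)
  have hqw : ‖(q : ℂ) / w‖ < 1 := by
    rw [norm_div, Complex.norm_real, Real.norm_of_nonneg hq0.le, div_lt_one (by linarith)]
    exact hw0
  have hne2 : ∀ k : ℕ, 1 - (q : ℂ) ^ k * (q / w) ≠ 0 := fun k =>
    one_sub_ne_zero_of_norm ((norm_pow_mul_le hq0.le hq1 le_rfl k).trans_lt hqw)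
  have hpos : ∀ k : ℕ, (Complex.exp (2 * k * p) + w) / (Complex.exp (2 * k * p) - w) =
      1 + 2 * ((q : ℂ) ^ k * w) / (1 - (q : ℂ) ^ k * w) := by
    intro k
    have h1 := hne1 k
    have h2 : (q : ℂ) ^ k ≠ 0 := pow_ne_zero _ hqc
    rw [hexp]
    have h3 : ((q : ℂ) ^ k)⁻¹ - w = ((q : ℂ) ^ k)⁻¹ * (1 - (q : ℂ) ^ k * w) := by field_simp
    rw [h3]
    field_simp
    ring
  have hneg : ∀ k : ℕ, (Complex.exp (-(2 * (k + 1 : ℕ) * p)) + w) /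
      (Complex.exp (-(2 * (k + 1 : ℕ) * p)) - w) =
      -1 - 2 * ((q : ℂ) ^ k * (q / w)) / (1 - (q : ℂ) ^ k * (q / w)) := by
    intro k
    have h1 := hne2 k
    rw [hexp']
    have h3 : (q : ℂ) ^ (k + 1) - w = -w * (1 - (q : ℂ) ^ k * (q / w)) := by
      field_simp; ring
    have h4 : (q : ℂ) ^ k * (q / w) = q ^ (k + 1) / w := by rw [pow_succ]; ring
    rw [h3]
    rw [h4] at h1 ⊢
    generalize (q : ℂ) ^ (k + 1) = u at h1 ⊢
    have h5 : w - u ≠ 0 := by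
      intro h; rw [sub_eq_zero] at h; rw [← h, div_self hwne, sub_self] at h1; exact h1 rfl
    rw [show 1 - u / w = (w - u) / w by field_simp]
    field_simp
    ring
  induction N with
  | zero => simpa using hpos 0
  | succ n ih =>
    have hI : Finset.Icc (-((n + 1 : ℕ) : ℤ)) ((n + 1 : ℕ) : ℤ) =
        insert (-((n + 1 : ℕ) : ℤ)) (insert ((n + 1 : ℕ) : ℤ) (Finset.Icc (-(n : ℤ)) (n : ℤ))) := by
      ext k; simp only [Finset.mem_Icc, Finset.mem_insert]; push_cast; omega
    rw [hI, Finset.sum_insert, Finset.sum_insert, ih, Finset.sum_range_succ _ (n + 1),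
      Finset.sum_range_succ _ n]
    · have e1 := hpos (n + 1)
      have e2 := hneg n
      push_cast at e1 e2 ⊢
      rw [e1]
      have : (2 : ℂ) * (-1 + -(n : ℂ)) * p = -(2 * (n + 1) * p) := by ring
      rw [show (2 : ℂ) * (-((n : ℂ) + 1)) * p = -(2 * (n + 1) * p) by ring, e2,
        Finset.sum_range_succ _ n]
      ring
    · simp
    · simp only [Finset.mem_insert, Finset.mem_Icc]; push_cast; omega

lemma schwarzS_eq {p : ℝ} (hp : 0 < p) {w : ℂ} (hw0 : Real.exp (-2 * p) < ‖w‖) (hw1 : ‖w‖ < 1) :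
    schwarzS p w =
      1 + lambert (Real.exp (-2 * p)) w - lambert (Real.exp (-2 * p)) (Real.exp (-2 * p) / w) := by
  have hq0 : 0 < Real.exp (-2 * p) := Real.exp_pos _
  have hq1 : Real.exp (-2 * p) < 1 := by rw [Real.exp_lt_one_iff]; linarith
  have hqw : ‖(Real.exp (-2 * p) : ℂ) / w‖ < 1 := by
    rw [norm_div, Complex.norm_real, Real.norm_of_nonneg hq0.le, div_lt_one (by linarith)]
    exact hw0
  refine Tendsto.limUnder_eq ?_
  simp_rw [sum_schwarz_eq hw0 hw1 hp]
  have h1 := ((summable_lambert hq0.le hq1 hw1).hasSum.tendsto_sum_nat).comp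
    (tendsto_add_atTop_nat 1)
  have h2 := (summable_lambert hq0.le hq1 hqw).hasSum.tendsto_sum_nat
  exact (h1.const_add 1).sub h2

/-- Near the outer circle the real part of the Schwarz function is that of the Poisson kernel, up
to an error that vanishes linearly at the circle. -/
lemma abs_re_schwarz_sub_le {τ : ℝ} (hτ0 : 0 < τ) (hτ1 : τ < 1) {w : ℂ} (hw0 : τ ≤ ‖w‖)
    (hw1 : ‖w‖ < 1) :
    |(1 + lambert (τ ^ 2) w - lambert (τ ^ 2) ((τ : ℂ) ^ 2 / w)).re -
      (1 - ‖w‖ ^ 2) / ‖1 - w‖ ^ 2| ≤ 4 * τ / ((1 - τ ^ 2) * (1 - τ) ^ 2) * (1 - ‖w‖) := by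
  have hq0 : 0 ≤ τ ^ 2 := by positivity
  have hq1 : τ ^ 2 < 1 := by nlinarith
  have hwp : 0 < ‖w‖ := by linarith
  have hwne : w ≠ 0 := norm_pos_iff.1 hwp
  have hne := one_sub_ne_zero_of_norm hw1
  have hkernel : (1 + 2 * w / (1 - w)).re = (1 - ‖w‖ ^ 2) / ‖1 - w‖ ^ 2 := by
    have h1 : 1 + 2 * w / (1 - w) = (1 + w) / (1 - w) := by field_simp; ring
    rw [h1, Complex.div_re, ← Complex.normSq_eq_norm_sq, ← Complex.normSq_eq_norm_sq, ← add_div]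
    congr 1
    simp only [Complex.add_re, Complex.sub_re, Complex.one_re, Complex.add_im, Complex.sub_im,
      Complex.one_im, Complex.normSq_apply]
    ring
  have hcast : ((τ ^ 2 : ℝ) : ℂ) = (τ : ℂ) ^ 2 := by push_cast; rfl
  have hsplit : (1 + lambert (τ ^ 2) w - lambert (τ ^ 2) ((τ : ℂ) ^ 2 / w)).re -
      (1 - ‖w‖ ^ 2) / ‖1 - w‖ ^ 2 =
      (lambert (τ ^ 2) ((τ : ℂ) ^ 2 * (starRingEnd ℂ) w)
        - lambert (τ ^ 2) ((τ : ℂ) ^ 2 / w)).re := by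
    have hc : (τ : ℂ) ^ 2 * (starRingEnd ℂ) w = (starRingEnd ℂ) ((τ : ℂ) ^ 2 * w) := by simp
    rw [← hkernel, lambert_eq_add hq0 hq1 hw1, hc, lambert_conj, hcast]
    simp only [Complex.add_re, Complex.sub_re, Complex.conj_re]
    ring
  rw [hsplit]
  refine (Complex.abs_re_le_norm _).trans ?_
  have hb1 : ‖(τ : ℂ) ^ 2 * (starRingEnd ℂ) w‖ ≤ τ := by
    rw [norm_mul, norm_pow, Complex.norm_real, Real.norm_of_nonneg hτ0.le, RCLike.norm_conj]
    nlinarith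
  have hb2 : ‖(τ : ℂ) ^ 2 / w‖ ≤ τ := by
    rw [norm_div, norm_pow, Complex.norm_real, Real.norm_of_nonneg hτ0.le, div_le_iff₀ hwp]
    nlinarith
  refine (norm_lambert_sub_le hq0 hq1 hτ1 hb1 hb2).trans ?_
  have hdiff : ‖(τ : ℂ) ^ 2 * (starRingEnd ℂ) w - (τ : ℂ) ^ 2 / w‖ ≤ 2 * τ * (1 - ‖w‖) := by
    have h1 : (τ : ℂ) ^ 2 * (starRingEnd ℂ) w - (τ : ℂ) ^ 2 / w =
        -((τ ^ 2 * (1 - ‖w‖ ^ 2) : ℝ) : ℂ) / w := by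
      have : (starRingEnd ℂ) w * w = ((‖w‖ ^ 2 : ℝ) : ℂ) := by
        rw [Complex.conj_mul']; push_cast; rfl
      rw [eq_div_iff hwne, sub_mul, mul_assoc, this]
      push_cast
      field_simp
      ring
    have h2 : 0 ≤ 1 - ‖w‖ ^ 2 := by nlinarith
    rw [h1, norm_div, norm_neg, Complex.norm_real, Real.norm_of_nonneg (by positivity),
      div_le_iff₀ hwp]
    have h3 : τ * (τ * ((1 - ‖w‖) * (1 + ‖w‖))) ≤ τ * (‖w‖ * ((1 - ‖w‖) * 2)) := by
      have : 0 ≤ 1 - ‖w‖ := by linarith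
      gcongr
      linarith
    nlinarith
  have hden : 0 < (1 - τ ^ 2) * (1 - τ) ^ 2 := by
    have : 0 < 1 - τ ^ 2 := by linarith
    have : 0 < 1 - τ := by linarith
    positivity
  calc _ ≤ 2 / ((1 - τ ^ 2) * (1 - τ) ^ 2) * (2 * τ * (1 - ‖w‖)) := by gcongr
    _ = _ := by ring

/-- The lower bound for `Re S_p` which makes the equation solvable backwards: it holds up to the
inner boundary and needs no distance from the pole. -/
lemma le_re_schwarz {τ : ℝ} (hτ0 : 0 < τ) (hτ1 : τ < 1) {w : ℂ} (hw0 : τ ≤ ‖w‖) (hw1 : ‖w‖ < 1) :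
    (1 - ‖w‖) * (1 / 2 - 4 * τ / ((1 - τ ^ 2) * (1 - τ) ^ 2)) ≤
      (1 + lambert (τ ^ 2) w
        - lambert (τ ^ 2) ((τ : ℂ) ^ 2 / w)).re := by
  have h := (abs_le.1 (abs_re_schwarz_sub_le hτ0 hτ1 hw0 hw1)).1
  have hk : (1 - ‖w‖) * (1 / 2) ≤ (1 - ‖w‖ ^ 2) / ‖1 - w‖ ^ 2 := by
    have h1 : 0 < ‖1 - w‖ := norm_pos_iff.2 (one_sub_ne_zero_of_norm hw1)
    have h2 : ‖1 - w‖ ≤ 1 + ‖w‖ := by simpa using norm_sub_le (1 : ℂ) w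
    rw [le_div_iff₀ (by positivity)]
    have h3 : ‖1 - w‖ ^ 2 ≤ (1 + ‖w‖) * 2 := by nlinarith [norm_nonneg w]
    nlinarith
  linarith

/-- Away from the pole `1`, the real part of the Schwarz function is `O(1 - |w|)`, so that points
need some time to reach the circle. -/
lemma re_schwarz_le {τ r : ℝ} (hτ0 : 0 < τ) (hτ1 : τ < 1) (hr : 0 < r) {w : ℂ} (hw0 : τ ≤ ‖w‖)
    (hw1 : ‖w‖ < 1) (hwr : r ≤ ‖1 - w‖) :
    (1 + lambert (τ ^ 2) w - lambert (τ ^ 2) ((τ : ℂ) ^ 2 / w)).re ≤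
      (1 - ‖w‖) * (2 / r ^ 2 + 4 * τ / ((1 - τ ^ 2) * (1 - τ) ^ 2)) := by
  have h := (abs_le.1 (abs_re_schwarz_sub_le hτ0 hτ1 hw0 hw1)).2
  have hk : (1 - ‖w‖ ^ 2) / ‖1 - w‖ ^ 2 ≤ (1 - ‖w‖) * (2 / r ^ 2) := by
    rw [mul_div_assoc']
    have : 0 ≤ 1 - ‖w‖ := by linarith
    gcongr
    nlinarith
  linarith

/-! ### The Loewner field in logarithmic coordinates -/

/-- A continuous driving function with values in the unit circle, in the time variable
`σ = e^{t/4} ∈ (0, 1)`. -/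
structure IsDriving (κ : ℝ → ℂ) : Prop where
  continuousOn : ContinuousOn κ (Ioo 0 1)
  norm_eq : ∀ σ ∈ Ioo (0 : ℝ) 1, ‖κ σ‖ = 1

/-- The vector field of the Loewner equation for `L = log (e^t / g_t)` in the time variable
`σ = e^{t/4}`. With the fourth root, the field restricted to the regions `clipRegion ε σ` vanishes
as `σ → 0`, whatever the behaviour of the driving function there; at `σ = 0` it is
zero because of the division by `0`. -/
noncomputable def field (κ : ℝ → ℂ) (σ : ℝ) (L : ℂ) : ℂ :=
  4 / σ * (lambert (σ ^ 8) (σ ^ 4 * (Complex.exp L * κ σ)) -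
    lambert (σ ^ 8) (σ ^ 4 * (Complex.exp L * κ σ)⁻¹))

/-- The region `|Re L| ≤ -log (σ⁴ + ε σ²)`. These regions exhaust the domain `|Re L| < -4 log σ`
of the field at the time `σ` as `ε → 0`. -/
def clipRegion (ε σ : ℝ) : Set ℂ := {L | (σ ^ 4 + ε * σ ^ 2) * Real.exp |L.re| ≤ 1}

/-- The projection of the plane onto the strip `|Re L| ≤ m`. -/
noncomputable def clip (m : ℝ) (L : ℂ) : ℂ := ⟨max (-m) (min L.re m), L.im⟩

/-- The half-width of the strip `clipRegion ε σ`. -/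
noncomputable def clipHeight (ε σ : ℝ) : ℝ := -Real.log (σ ^ 4 + ε * σ ^ 2)

/-- The field extended from `clipRegion ε σ` to the plane by projecting onto that strip; it is
bounded and globally Lipschitz. -/
noncomputable def clipField (κ : ℝ → ℂ) (ε σ : ℝ) (L : ℂ) : ℂ :=
  field κ σ (clip (clipHeight ε σ) L)

/-- A bound and a Lipschitz constant of the field on `clipRegion ε σ` for `σ ≤ b`. -/
noncomputable def fieldConst (ε b : ℝ) : ℝ := 16 / (ε * ((1 - b ^ 8) * (1 - 1 / (1 + ε)) ^ 2))

variable {κ : ℝ → ℂ} {ε b σ : ℝ}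

@[simp] lemma field_zero_time (κ : ℝ → ℂ) (L : ℂ) : field κ 0 L = 0 := by simp [field]

lemma pow_add_mul_pow_pos (hε : 0 < ε) (hσ : 0 < σ) : 0 < σ ^ 4 + ε * σ ^ 2 := by positivity

lemma pow_add_mul_pow_le {ε ε' σ σ' : ℝ} (hε : 0 ≤ ε) (hεε : ε ≤ ε') (hσ : 0 ≤ σ) (h : σ ≤ σ') :
    σ ^ 4 + ε * σ ^ 2 ≤ σ' ^ 4 + ε' * σ' ^ 2 := by
  have : 0 ≤ ε' := hε.trans hεε
  gcongr

lemma clipRegion_anti {ε ε' : ℝ} (h : ε ≤ ε') : clipRegion ε' σ ⊆ clipRegion ε σ := by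
  intro L hL
  refine le_trans ?_ (show (σ ^ 4 + ε' * σ ^ 2) * Real.exp |L.re| ≤ 1 from hL)
  gcongr

lemma mem_clipRegion_iff (hε : 0 < ε) (hσ : 0 < σ) {L : ℂ} :
    L ∈ clipRegion ε σ ↔ |L.re| ≤ clipHeight ε σ := by
  have h := pow_add_mul_pow_pos hε hσ
  rw [clipRegion, mem_ofPred_eq, clipHeight, ← Real.log_inv, Real.le_log_iff_exp_le (inv_pos.2 h),
    ← one_div, le_div_iff₀ h, mul_comm]

lemma clipHeight_nonneg (hε : 0 < ε) (hσ : 0 < σ) (h : σ ^ 4 + ε * σ ^ 2 ≤ 1) :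
    0 ≤ clipHeight ε σ :=
  neg_nonneg.2 (Real.log_nonpos (pow_add_mul_pow_pos hε hσ).le h)

lemma abs_re_clip_le {m : ℝ} (hm : 0 ≤ m) (L : ℂ) : |(clip m L).re| ≤ m := by
  rw [clip, abs_le]
  exact ⟨le_max_left _ _, max_le (by linarith) (min_le_right _ _)⟩

lemma clip_eq_self {m : ℝ} {L : ℂ} (h : |L.re| ≤ m) : clip m L = L := by
  rw [abs_le] at h
  apply Complex.ext <;> simp [clip, h.1, h.2]

lemma norm_clip_sub_clip_le (m : ℝ) (L L' : ℂ) : ‖clip m L - clip m L'‖ ≤ ‖L - L'‖ := by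
  have h : |max (-m) (min L.re m) - max (-m) (min L'.re m)| ≤ |L.re - L'.re| := by
    refine (abs_max_sub_max_le_max _ _ _ _).trans ?_
    simp only [sub_self, abs_zero]
    refine max_le (abs_nonneg _) ((abs_min_sub_min_le_max _ _ _ _).trans ?_)
    simp
  have h2 := sq_le_sq.2 h
  rw [Complex.norm_def, Complex.norm_def]
  apply Real.sqrt_le_sqrt
  simp only [Complex.normSq_apply, clip, Complex.sub_re, Complex.sub_im]
  nlinarith

lemma clip_mem_clipRegion (hε : 0 < ε) (hσ : 0 ≤ σ) (h : σ ^ 4 + ε * σ ^ 2 ≤ 1) (L : ℂ) :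
    clip (clipHeight ε σ) L ∈ clipRegion ε σ := by
  rcases hσ.eq_or_lt with rfl | hσ
  · simp [clipRegion]
  exact (mem_clipRegion_iff hε hσ).2 (abs_re_clip_le (clipHeight_nonneg hε hσ h) L)

lemma clipField_eq_field (hε : 0 < ε) (hσ : 0 ≤ σ) {L : ℂ} (hL : L ∈ clipRegion ε σ) :
    clipField κ ε σ L = field κ σ L := by
  rcases hσ.eq_or_lt with rfl | hσ
  · simp [clipField]
  rw [clipField, clip_eq_self ((mem_clipRegion_iff hε hσ).1 hL)]

lemma norm_exp_sub_exp_le {L L' : ℂ} {M : ℝ} (h : Real.exp L.re ≤ M) (h' : Real.exp L'.re ≤ M) :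
    ‖Complex.exp L - Complex.exp L'‖ ≤ M * ‖L - L'‖ := by
  have hM : 0 < M := (Real.exp_pos _).trans_le h
  have hconv : Convex ℝ {z : ℂ | z.re ≤ Real.log M} := convex_halfSpace_re_le _
  refine hconv.norm_image_sub_le_of_norm_deriv_le (f := Complex.exp)
    (fun z _ => Complex.differentiableAt_exp) (fun z hz => ?_)
    ((Real.le_log_iff_exp_le hM).2 h') ((Real.le_log_iff_exp_le hM).2 h)
  rw [Complex.deriv_exp, Complex.norm_exp]
  exact (Real.le_log_iff_exp_le hM).1 hz

lemma exp_abs_re_le (hε : 0 < ε) (hσ : 0 < σ) {L : ℂ} (hL : L ∈ clipRegion ε σ) :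
    σ ^ 4 * Real.exp |L.re| ≤ σ ^ 2 / ε := by
  have h : (σ ^ 4 + ε * σ ^ 2) * Real.exp |L.re| ≤ 1 := hL
  have hE := Real.exp_pos |L.re|
  rw [le_div_iff₀ hε]
  have h1 : ε * σ ^ 2 * Real.exp |L.re| ≤ 1 := le_trans (by gcongr; nlinarith [pow_pos hσ 4]) h
  nlinarith [pow_pos hσ 2]

lemma exp_abs_re_le' (hε : 0 < ε) (hσ : 0 < σ) (hσ1 : σ ≤ 1) {L : ℂ} (hL : L ∈ clipRegion ε σ) :
    σ ^ 4 * Real.exp |L.re| ≤ 1 / (1 + ε) := by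
  have h : (σ ^ 4 + ε * σ ^ 2) * Real.exp |L.re| ≤ 1 := hL
  have hE := Real.exp_pos |L.re|
  rw [le_div_iff₀ (by positivity)]
  refine le_trans ?_ h
  have : σ ^ 4 ≤ σ ^ 2 := pow_le_pow_of_le_one hσ.le hσ1 (by norm_num)
  calc σ ^ 4 * Real.exp |L.re| * (1 + ε) = (σ ^ 4 + ε * σ ^ 4) * Real.exp |L.re| := by ring
    _ ≤ _ := by gcongr

lemma norm_outer (hκ : IsDriving κ) (hσ : σ ∈ Ioo (0 : ℝ) 1) (L : ℂ) :
    ‖(σ : ℂ) ^ 4 * (Complex.exp L * κ σ)‖ = σ ^ 4 * Real.exp L.re := by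
  rw [norm_mul, norm_mul, hκ.norm_eq σ hσ, norm_pow, Complex.norm_real,
    Real.norm_of_nonneg hσ.1.le, Complex.norm_exp, mul_one]

lemma norm_inner (hκ : IsDriving κ) (hσ : σ ∈ Ioo (0 : ℝ) 1) (L : ℂ) :
    ‖(σ : ℂ) ^ 4 * (Complex.exp L * κ σ)⁻¹‖ = σ ^ 4 * Real.exp (-L.re) := by
  rw [norm_mul, norm_inv, norm_mul, hκ.norm_eq σ hσ, norm_pow, Complex.norm_real,
    Real.norm_of_nonneg hσ.1.le, Complex.norm_exp, mul_one, Real.exp_neg]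

lemma norm_outer_le (hκ : IsDriving κ) (hσ : σ ∈ Ioo (0 : ℝ) 1) {L : ℂ} :
    ‖(σ : ℂ) ^ 4 * (Complex.exp L * κ σ)‖ ≤ σ ^ 4 * Real.exp |L.re| := by
  have := hσ.1
  rw [norm_outer hκ hσ]
  gcongr
  exact le_abs_self _

lemma norm_inner_le (hκ : IsDriving κ) (hσ : σ ∈ Ioo (0 : ℝ) 1) {L : ℂ} :
    ‖(σ : ℂ) ^ 4 * (Complex.exp L * κ σ)⁻¹‖ ≤ σ ^ 4 * Real.exp |L.re| := by
  have := hσ.1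
  rw [norm_inner hκ hσ]
  gcongr
  exact neg_le_abs _

lemma one_sub_inv_pos (hε : 0 < ε) : 0 < 1 - 1 / (1 + ε) := by
  rw [sub_pos, div_lt_one (by positivity)]; linarith

lemma one_sub_pow_pos (hb0 : 0 ≤ b) (hb : b < 1) {n : ℕ} (hn : n ≠ 0) : 0 < 1 - b ^ n :=
  sub_pos.2 (pow_lt_one₀ hb0 hb hn)

lemma fieldConst_pos (hε : 0 < ε) (hb0 : 0 ≤ b) (hb : b < 1) : 0 < fieldConst ε b := by
  have := one_sub_pow_pos hb0 hb (n := 8) (by norm_num)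
  have := one_sub_inv_pos hε
  unfold fieldConst; positivity

/-- On the regions `clipRegion ε σ` the field is of order `σ`. -/
lemma norm_field_le (hκ : IsDriving κ) (hε : 0 < ε) (hb : b < 1) (hσ : σ ∈ Icc 0 b) {L : ℂ}
    (hL : L ∈ clipRegion ε σ) : ‖field κ σ L‖ ≤ fieldConst ε b * σ := by
  rcases hσ.1.eq_or_lt with rfl | h0
  · simp
  have hσ1 : σ ∈ Ioo (0 : ℝ) 1 := ⟨h0, hσ.2.trans_lt hb⟩
  have hq1 : σ ^ 8 < 1 := pow_lt_one₀ h0.le hσ1.2 (by norm_num)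
  have hρ : 1 / (1 + ε) < 1 := by linarith [one_sub_inv_pos hε]
  have i1 := one_sub_pow_pos (hσ.1.trans hσ.2) hb (n := 8) (by norm_num)
  have i2 := one_sub_inv_pos hε
  have hx := norm_lambert_le (q := σ ^ 8) (by positivity) hq1 hρ
    ((norm_outer_le hκ hσ1 (L := L)).trans (exp_abs_re_le' hε h0 hσ1.2.le hL))
  have hw := norm_lambert_le (q := σ ^ 8) (by positivity) hq1 hρ
    ((norm_inner_le hκ hσ1 (L := L)).trans (exp_abs_re_le' hε h0 hσ1.2.le hL))
  have hE := exp_abs_re_le hε h0 hL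
  have hc : 2 / ((1 - σ ^ 8) * (1 - 1 / (1 + ε)) ^ 2) ≤
      2 / ((1 - b ^ 8) * (1 - 1 / (1 + ε)) ^ 2) := by
    have := hσ.2
    gcongr
  set c := 2 / ((1 - b ^ 8) * (1 - 1 / (1 + ε)) ^ 2) with hcdef
  have hc0 : 0 < c := by positivity
  have hx' : ‖lambert (σ ^ 8) (σ ^ 4 * (Complex.exp L * κ σ))‖ ≤ c * (σ ^ 2 / ε) :=
    hx.trans (mul_le_mul hc ((norm_outer_le hκ hσ1).trans hE) (norm_nonneg _) hc0.le)
  have hw' : ‖lambert (σ ^ 8) (σ ^ 4 * (Complex.exp L * κ σ)⁻¹)‖ ≤ c * (σ ^ 2 / ε) :=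
    hw.trans (mul_le_mul hc ((norm_inner_le hκ hσ1).trans hE) (norm_nonneg _) hc0.le)
  have h4 : ‖(4 : ℂ) / σ‖ = 4 / σ := by
    rw [norm_div, Complex.norm_real, Real.norm_of_nonneg h0.le, Complex.norm_ofNat]
  rw [field, norm_mul, h4]
  calc 4 / σ * _ ≤ 4 / σ * (c * (σ ^ 2 / ε) + c * (σ ^ 2 / ε)) := by
        gcongr; exact (norm_sub_le _ _).trans (add_le_add hx' hw')
    _ = fieldConst ε b * σ := by rw [hcdef, fieldConst]; field_simp; ring

lemma norm_field_sub_le (hκ : IsDriving κ) (hε : 0 < ε) (hb : b < 1) (hσ : σ ∈ Icc 0 b) {L L' : ℂ}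
    (hL : L ∈ clipRegion ε σ) (hL' : L' ∈ clipRegion ε σ) :
    ‖field κ σ L - field κ σ L'‖ ≤ fieldConst ε b * ‖L - L'‖ := by
  have hK := fieldConst_pos hε (hσ.1.trans hσ.2) hb
  rcases hσ.1.eq_or_lt with rfl | h0
  · simp only [field_zero_time, sub_self, norm_zero]; positivity
  have hσ1 : σ ∈ Ioo (0 : ℝ) 1 := ⟨h0, hσ.2.trans_lt hb⟩
  have hq1 : σ ^ 8 < 1 := pow_lt_one₀ h0.le hσ1.2 (by norm_num)
  have hρ : 1 / (1 + ε) < 1 := by linarith [one_sub_inv_pos hε]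
  have i1 := one_sub_pow_pos (hσ.1.trans hσ.2) hb (n := 8) (by norm_num)
  have i2 := one_sub_inv_pos hε
  have hκ1 := hκ.norm_eq σ hσ1
  have hx := norm_lambert_sub_le (q := σ ^ 8) (by positivity) hq1 hρ
    ((norm_outer_le hκ hσ1 (L := L)).trans (exp_abs_re_le' hε h0 hσ1.2.le hL))
    ((norm_outer_le hκ hσ1 (L := L')).trans (exp_abs_re_le' hε h0 hσ1.2.le hL'))
  have hw := norm_lambert_sub_le (q := σ ^ 8) (by positivity) hq1 hρ
    ((norm_inner_le hκ hσ1 (L := L)).trans (exp_abs_re_le' hε h0 hσ1.2.le hL))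
    ((norm_inner_le hκ hσ1 (L := L')).trans (exp_abs_re_le' hε h0 hσ1.2.le hL'))
  have hc : 2 / ((1 - σ ^ 8) * (1 - 1 / (1 + ε)) ^ 2) ≤
      2 / ((1 - b ^ 8) * (1 - 1 / (1 + ε)) ^ 2) := by
    have := hσ.2
    gcongr
  set c := 2 / ((1 - b ^ 8) * (1 - 1 / (1 + ε)) ^ 2) with hcdef
  have hc0 : 0 < c := by positivity
  set M := σ ^ 2 / ε / σ ^ 4 with hM
  have hE : Real.exp |L.re| ≤ M := by
    rw [hM, le_div_iff₀' (by positivity)]; exact exp_abs_re_le hε h0 hL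
  have hE' : Real.exp |L'.re| ≤ M := by
    rw [hM, le_div_iff₀' (by positivity)]; exact exp_abs_re_le hε h0 hL'
  have hMσ : σ ^ 4 * M = σ ^ 2 / ε := by rw [hM]; field_simp
  have d1 : ‖(σ : ℂ) ^ 4 * (Complex.exp L * κ σ) - σ ^ 4 * (Complex.exp L' * κ σ)‖ ≤
      σ ^ 2 / ε * ‖L - L'‖ := by
    rw [← mul_sub, ← sub_mul, norm_mul, norm_mul, hκ1, mul_one, norm_pow, Complex.norm_real,
      Real.norm_of_nonneg h0.le, ← hMσ, mul_assoc]
    gcongr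
    exact norm_exp_sub_exp_le ((Real.exp_le_exp.2 (le_abs_self _)).trans hE)
      ((Real.exp_le_exp.2 (le_abs_self _)).trans hE')
  have d2 : ‖(σ : ℂ) ^ 4 * (Complex.exp L * κ σ)⁻¹ - σ ^ 4 * (Complex.exp L' * κ σ)⁻¹‖ ≤
      σ ^ 2 / ε * ‖L - L'‖ := by
    rw [mul_inv, mul_inv, ← Complex.exp_neg, ← Complex.exp_neg, ← mul_sub, ← sub_mul, norm_mul,
      norm_mul, norm_inv, hκ1, inv_one, mul_one, norm_pow, Complex.norm_real,
      Real.norm_of_nonneg h0.le, ← hMσ, mul_assoc]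
    have := norm_exp_sub_exp_le (L := -L) (L' := -L') (M := M)
      ((Real.exp_le_exp.2 (by simpa using neg_le_abs L.re)).trans hE)
      ((Real.exp_le_exp.2 (by simpa using neg_le_abs L'.re)).trans hE')
    rw [show -L - -L' = -(L - L') by ring, norm_neg] at this
    gcongr
  have h4 : ‖(4 : ℂ) / σ‖ = 4 / σ := by
    rw [norm_div, Complex.norm_real, Real.norm_of_nonneg h0.le, Complex.norm_ofNat]
  have hx' := hx.trans (mul_le_mul hc d1 (norm_nonneg _) hc0.le)
  have hw' := hw.trans (mul_le_mul hc d2 (norm_nonneg _) hc0.le)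
  rw [field, field, ← mul_sub, norm_mul, h4, sub_sub_sub_comm]
  calc 4 / σ * _ ≤ 4 / σ * (c * (σ ^ 2 / ε * ‖L - L'‖) + c * (σ ^ 2 / ε * ‖L - L'‖)) := by
        gcongr; exact (norm_sub_le _ _).trans (add_le_add hx' hw')
    _ = fieldConst ε b * ‖L - L'‖ * σ := by rw [hcdef, fieldConst]; field_simp; ring
    _ ≤ fieldConst ε b * ‖L - L'‖ * 1 := by gcongr; exact hσ1.2.le
    _ = _ := mul_one _

lemma continuousOn_field (hκ : IsDriving κ) (hε : 0 < ε) (hb : b < 1) {η : ℝ → ℂ}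
    (hη : ContinuousOn (fun σ => Complex.exp (η σ)) (Ioc 0 b))
    (hmem : ∀ σ ∈ Ioc 0 b, η σ ∈ clipRegion ε σ) :
    ContinuousOn (fun σ => field κ σ (η σ)) (Icc 0 b) := by
  have hρ : 1 / (1 + ε) < 1 := by linarith [one_sub_inv_pos hε]
  have hpos : ContinuousOn (fun σ => field κ σ (η σ)) (Ioc 0 b) := by
    have hsub : Ioc 0 b ⊆ Ioo (0 : ℝ) 1 := fun σ hσ => ⟨hσ.1, hσ.2.trans_lt hb⟩
    have hκc : ContinuousOn κ (Ioc 0 b) := hκ.continuousOn.mono hsub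
    have hy : ContinuousOn (fun σ => Complex.exp (η σ) * κ σ) (Ioc 0 b) := hη.mul hκc
    have hyne : ∀ σ ∈ Ioc 0 b, Complex.exp (η σ) * κ σ ≠ 0 := fun σ hσ =>
      mul_ne_zero (Complex.exp_ne_zero _) (norm_ne_zero_iff.1 (by
        rw [hκ.norm_eq σ (hsub hσ)]; exact one_ne_zero))
    have hσ4 : ContinuousOn (fun σ : ℝ => (σ : ℂ) ^ 4) (Ioc 0 b) := by fun_prop
    have hlam : ContinuousOn (fun p : ℝ × ℂ => lambert p.1 p.2)
        (Icc 0 (max 0 b ^ 8) ×ˢ Metric.closedBall 0 (1 / (1 + ε))) :=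
      continuousOn_lambert (pow_lt_one₀ (le_max_left _ _) (max_lt one_pos hb) (by norm_num)) hρ
    have hq : ∀ σ ∈ Ioc 0 b, σ ^ 8 ∈ Icc 0 (max 0 b ^ 8) := fun σ hσ =>
      ⟨by have := hσ.1; positivity,
        pow_le_pow_left₀ hσ.1.le (hσ.2.trans (le_max_right _ _)) 8⟩
    unfold field
    refine ContinuousOn.mul ?_ (ContinuousOn.sub ?_ ?_)
    · refine ContinuousOn.div (by fun_prop) (by fun_prop) fun σ hσ => ?_
      exact_mod_cast hσ.1.ne'
    · refine hlam.comp (f := fun σ : ℝ => (σ ^ 8, (σ : ℂ) ^ 4 * (Complex.exp (η σ) * κ σ)))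
        (ContinuousOn.prodMk (by fun_prop) (hσ4.mul hy)) fun σ hσ => ⟨hq σ hσ, ?_⟩
      exact mem_closedBall_zero_iff.2 ((norm_outer_le hκ (hsub hσ)).trans
        (exp_abs_re_le' hε hσ.1 (hsub hσ).2.le (hmem σ hσ)))
    · refine hlam.comp (f := fun σ : ℝ => (σ ^ 8, (σ : ℂ) ^ 4 * (Complex.exp (η σ) * κ σ)⁻¹))
        (ContinuousOn.prodMk (by fun_prop) (hσ4.mul (hy.inv₀ hyne))) fun σ hσ => ⟨hq σ hσ, ?_⟩
      exact mem_closedBall_zero_iff.2 ((norm_inner_le hκ (hsub hσ)).trans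
        (exp_abs_re_le' hε hσ.1 (hsub hσ).2.le (hmem σ hσ)))
  intro σ hσ
  rcases hσ.1.eq_or_lt with rfl | h0
  · have h1 : Tendsto (fun σ => fieldConst ε b * σ) (𝓝[Icc 0 b] 0) (𝓝 0) := by
      have : Tendsto (fun σ => fieldConst ε b * σ) (𝓝 0) (𝓝 (fieldConst ε b * 0)) :=
        Continuous.tendsto (by fun_prop) 0
      rw [mul_zero] at this
      exact this.mono_left nhdsWithin_le_nhds
    rw [ContinuousWithinAt, field_zero_time]
    refine squeeze_zero_norm' ?_ h1
    filter_upwards [self_mem_nhdsWithin] with σ hσ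
    rcases hσ.1.eq_or_lt with rfl | h0
    · simp
    · exact norm_field_le hκ hε hb hσ (hmem σ ⟨h0, hσ.2⟩)
  · have h1 := hpos σ ⟨h0, hσ.2⟩
    refine h1.mono_of_mem_nhdsWithin ?_
    rw [mem_nhdsWithin]
    exact ⟨Ioi 0, isOpen_Ioi, h0, fun s hs => ⟨hs.1, hs.2.2⟩⟩

lemma pow_le_one_of_le (hε : 0 < ε) (hεb : b ^ 4 + ε * b ^ 2 ≤ 1) (hσ : σ ∈ Icc 0 b) :
    σ ^ 4 + ε * σ ^ 2 ≤ 1 :=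
  (pow_add_mul_pow_le hε.le le_rfl hσ.1 hσ.2).trans hεb

lemma norm_clipField_le (hκ : IsDriving κ) (hε : 0 < ε) (hb : b < 1) (hεb : b ^ 4 + ε * b ^ 2 ≤ 1)
    (hσ : σ ∈ Icc 0 b) (L : ℂ) : ‖clipField κ ε σ L‖ ≤ fieldConst ε b * σ :=
  norm_field_le hκ hε hb hσ (clip_mem_clipRegion hε hσ.1 (pow_le_one_of_le hε hεb hσ) L)

lemma norm_clipField_sub_le (hκ : IsDriving κ) (hε : 0 < ε) (hb : b < 1)
    (hεb : b ^ 4 + ε * b ^ 2 ≤ 1) (hσ : σ ∈ Icc 0 b) (L L' : ℂ) :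
    ‖clipField κ ε σ L - clipField κ ε σ L'‖ ≤ fieldConst ε b * ‖L - L'‖ := by
  have h := pow_le_one_of_le hε hεb hσ
  have hK := fieldConst_pos hε (hσ.1.trans hσ.2) hb
  refine (norm_field_sub_le hκ hε hb hσ (clip_mem_clipRegion hε hσ.1 h L)
    (clip_mem_clipRegion hε hσ.1 h L')).trans ?_
  gcongr
  exact norm_clip_sub_clip_le _ _ _

lemma continuousOn_clipField (hκ : IsDriving κ) (hε : 0 < ε) (hb : b < 1)
    (hεb : b ^ 4 + ε * b ^ 2 ≤ 1) (L : ℂ) :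
    ContinuousOn (fun σ => clipField κ ε σ L) (Icc 0 b) := by
  refine continuousOn_field hκ hε hb (η := fun σ => clip (clipHeight ε σ) L)
    (ContinuousOn.cexp ?_) ?_
  · have h1 : ContinuousOn (clipHeight ε) (Ioc 0 b) := by
      unfold clipHeight
      exact (ContinuousOn.log (by fun_prop)
        fun σ hσ => (pow_add_mul_pow_pos hε hσ.1).ne').neg
    have h2 : ContinuousOn (fun σ => max (-clipHeight ε σ) (min L.re (clipHeight ε σ))) (Ioc 0 b) :=
      h1.neg.sup (continuousOn_const.inf h1)
    have h3 : (fun σ => clip (clipHeight ε σ) L) = fun σ =>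
        ((max (-clipHeight ε σ) (min L.re (clipHeight ε σ)) : ℝ) : ℂ) + L.im * Complex.I := by
      funext σ
      apply Complex.ext <;> simp [clip]
    rw [h3]
    exact (Complex.continuous_ofReal.comp_continuousOn h2).add continuousOn_const
  · exact fun σ hσ => clip_mem_clipRegion hε hσ.1.le
      (pow_le_one_of_le hε hεb ⟨hσ.1.le, hσ.2⟩) L

/-- The field takes its values from the Schwarz function at the point `w = g / χ`. -/
lemma field_eq (hσ : σ ≠ 0) (L : ℂ) : field κ σ L = 4 / σ * (1 - (1 +
      lambert ((σ ^ 4) ^ 2) (σ ^ 4 * (Complex.exp L * κ σ)⁻¹) -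
      lambert ((σ ^ 4) ^ 2) (((σ ^ 4 : ℝ) : ℂ) ^ 2 / (σ ^ 4 * (Complex.exp L * κ σ)⁻¹)))) := by
  have h1 : (σ : ℂ) ≠ 0 := by exact_mod_cast hσ
  have h2 : ((σ ^ 4 : ℝ) : ℂ) ^ 2 / (σ ^ 4 * (Complex.exp L * κ σ)⁻¹) =
      σ ^ 4 * (Complex.exp L * κ σ) := by
    push_cast
    rw [div_mul_eq_div_div, div_inv_eq_mul]
    field_simp
  rw [h2, field, ← pow_mul]
  ring_nf

/-! ### Trajectories -/

lemma neg_conj_mem_clipRegion {L : ℂ} :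
    -(starRingEnd ℂ) L ∈ clipRegion ε σ ↔ L ∈ clipRegion ε σ := by
  simp [clipRegion]

/-- The field is symmetric with respect to the reflection in the imaginary axis, which corresponds
to the reflection in the unit circle. -/
lemma field_neg_conj (hκ : IsDriving κ) (hσ : σ ∈ Ico (0 : ℝ) 1) (L : ℂ) :
    field κ σ (-(starRingEnd ℂ) L) = -(starRingEnd ℂ) (field κ σ L) := by
  rcases hσ.1.eq_or_lt with rfl | h0
  · simp
  have hκ1 := hκ.norm_eq σ ⟨h0, hσ.2⟩
  have hinv : (κ σ)⁻¹ = (starRingEnd ℂ) (κ σ) := Complex.inv_eq_conj hκ1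
  have e1 : (σ : ℂ) ^ 4 * (Complex.exp (-(starRingEnd ℂ) L) * κ σ) =
      (starRingEnd ℂ) (σ ^ 4 * (Complex.exp L * κ σ)⁻¹) := by
    rw [mul_inv, hinv, ← Complex.exp_neg]
    simp [← Complex.exp_conj]
  have e2 : (σ : ℂ) ^ 4 * (Complex.exp (-(starRingEnd ℂ) L) * κ σ)⁻¹ =
      (starRingEnd ℂ) (σ ^ 4 * (Complex.exp L * κ σ)) := by
    rw [mul_inv, hinv, ← Complex.exp_neg]
    simp [← Complex.exp_conj]
  have h4 : (starRingEnd ℂ) 4 = 4 := map_ofNat _ 4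
  rw [field, e1, e2, lambert_conj, lambert_conj, field]
  simp only [map_mul, map_sub, map_div₀, Complex.conj_ofReal, h4]
  ring

lemma clip_neg_conj (m : ℝ) (hm : 0 ≤ m) (L : ℂ) :
    clip m (-(starRingEnd ℂ) L) = -(starRingEnd ℂ) (clip m L) := by
  apply Complex.ext
  · simp only [clip, Complex.neg_re, Complex.conj_re, max_def, min_def]
    split_ifs <;> linarith
  · simp [clip]

/-- Solutions on `[0, b]` of the Loewner equation in logarithmic coordinates which stay in the
regions `clipRegion ε σ`. Every solution that stays in the domain of the field up to time `b` is of
this form for some `ε > 0`. -/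
structure IsTraj (κ : ℝ → ℂ) (ε b : ℝ) (γ : ℝ → ℂ) : Prop where
  hasDeriv : ∀ σ ∈ Icc 0 b, HasDerivWithinAt γ (field κ σ (γ σ)) (Icc 0 b) σ
  mem : ∀ σ ∈ Icc 0 b, γ σ ∈ clipRegion ε σ

/-- Solutions on `[0, b]` of the equation with the projected field. -/
def IsClipSol (κ : ℝ → ℂ) (ε b : ℝ) (γ : ℝ → ℂ) : Prop :=
  ∀ σ ∈ Icc 0 b, HasDerivWithinAt γ (clipField κ ε σ (γ σ)) (Icc 0 b) σ

lemma IsClipSol.isTraj {γ : ℝ → ℂ} (h : IsClipSol κ ε b γ) (hε : 0 < ε)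
    (hm : ∀ σ ∈ Icc 0 b, γ σ ∈ clipRegion ε σ) : IsTraj κ ε b γ :=
  ⟨fun σ hσ => by rw [← clipField_eq_field hε hσ.1 (hm σ hσ)]; exact h σ hσ, hm⟩

lemma IsTraj.isClipSol {γ : ℝ → ℂ} (h : IsTraj κ ε b γ) (hε : 0 < ε) : IsClipSol κ ε b γ :=
  fun σ hσ => by rw [clipField_eq_field hε hσ.1 (h.mem σ hσ)]; exact h.hasDeriv σ hσ

lemma IsTraj.anti {γ : ℝ → ℂ} {ε' : ℝ} (h : IsTraj κ ε b γ) (hε : ε' ≤ ε) : IsTraj κ ε' b γ :=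
  ⟨h.hasDeriv, fun σ hσ => clipRegion_anti hε (h.mem σ hσ)⟩

lemma IsTraj.restrict {γ : ℝ → ℂ} {b' : ℝ} (h : IsTraj κ ε b γ) (hb : b' ≤ b) : IsTraj κ ε b' γ :=
  ⟨fun σ hσ => (h.hasDeriv σ ⟨hσ.1, hσ.2.trans hb⟩).mono (Icc_subset_Icc_right hb),
    fun σ hσ => h.mem σ ⟨hσ.1, hσ.2.trans hb⟩⟩

lemma IsClipSol.restrict {γ : ℝ → ℂ} {b' : ℝ} (h : IsClipSol κ ε b γ) (hb : b' ≤ b) :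
    IsClipSol κ ε b' γ :=
  fun σ hσ => (h σ ⟨hσ.1, hσ.2.trans hb⟩).mono (Icc_subset_Icc_right hb)

lemma IsClipSol.continuousOn {γ : ℝ → ℂ} (h : IsClipSol κ ε b γ) : ContinuousOn γ (Icc 0 b) :=
  fun σ hσ => (h σ hσ).continuousWithinAt

lemma IsTraj.continuousOn {γ : ℝ → ℂ} (h : IsTraj κ ε b γ) : ContinuousOn γ (Icc 0 b) :=
  fun σ hσ => (h.hasDeriv σ hσ).continuousWithinAt

lemma IsTraj.pow_le_one {γ : ℝ → ℂ} (h : IsTraj κ ε b γ) (hε : 0 < ε) (hb : 0 ≤ b) :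
    b ^ 4 + ε * b ^ 2 ≤ 1 := by
  have h1 : (b ^ 4 + ε * b ^ 2) * Real.exp |(γ b).re| ≤ 1 := h.mem b ⟨hb, le_rfl⟩
  refine le_trans ?_ h1
  exact le_mul_of_one_le_right (by positivity) (Real.one_le_exp (abs_nonneg _))

lemma IsClipSol.eqOn (hκ : IsDriving κ) (hε : 0 < ε) (hb : b < 1) (hεb : b ^ 4 + ε * b ^ 2 ≤ 1)
    {γ γ' : ℝ → ℂ} (h : IsClipSol κ ε b γ) (h' : IsClipSol κ ε b γ') {s : ℝ} (hs : s ∈ Icc 0 b)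
    (heq : γ s = γ' s) : EqOn γ γ' (Icc 0 b) :=
  eqOn_of_ode (R := fun _ => univ) hs (fieldConst_pos hε (hs.1.trans hs.2) hb).le
    (fun _ ht x _ y _ => norm_clipField_sub_le hκ hε hb hεb ht x y) h (fun _ _ => mem_univ _) h'
    (fun _ _ => mem_univ _) heq

lemma IsTraj.eqOn (hκ : IsDriving κ) {ε' : ℝ} (hε : 0 < ε) (hε' : 0 < ε') (hb : b < 1)
    {γ γ' : ℝ → ℂ} (h : IsTraj κ ε b γ) (h' : IsTraj κ ε' b γ') {s : ℝ} (hs : s ∈ Icc 0 b)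
    (heq : γ s = γ' s) : EqOn γ γ' (Icc 0 b) := by
  have hm := lt_min hε hε'
  have i := h.anti (min_le_left ε ε')
  exact (i.isClipSol hm).eqOn hκ hm hb (i.pow_le_one hm (hs.1.trans hs.2))
    ((h'.anti (min_le_right ε ε')).isClipSol hm) hs heq

lemma exists_clipFlow (hκ : IsDriving κ) (hε : 0 < ε) (hb : b < 1) (hεb : b ^ 4 + ε * b ^ 2 ≤ 1)
    {s : ℝ} (hs : s ∈ Icc 0 b) (x₀ : ℂ) :
    ∃ (α : ℂ → ℝ → ℂ) (C : ℝ), 0 ≤ C ∧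
      (∀ x ∈ Metric.closedBall x₀ 1, α x s = x ∧ IsClipSol κ ε b (α x)) ∧
      ∀ x ∈ Metric.closedBall x₀ 1, ∀ y ∈ Metric.closedBall x₀ 1, ∀ t ∈ Icc 0 b,
        ‖α x t - α y t‖ ≤ C * ‖x - y‖ := by
  have hK := fieldConst_pos hε (hs.1.trans hs.2) hb
  refine exists_flow hs hK.le (fun t ht => norm_clipField_sub_le hκ hε hb hεb ht) (fun t ht x => ?_)
    (continuousOn_clipField hκ hε hb hεb) x₀
  refine (norm_clipField_le hκ hε hb hεb ht x).trans ?_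
  have := ht.2
  nlinarith

lemma exists_isClipSol (hκ : IsDriving κ) (hε : 0 < ε) (hb : b < 1) (hεb : b ^ 4 + ε * b ^ 2 ≤ 1)
    {s : ℝ} (hs : s ∈ Icc 0 b) (x : ℂ) : ∃ γ, IsClipSol κ ε b γ ∧ γ s = x := by
  obtain ⟨α, C, -, h, -⟩ := exists_clipFlow hκ hε hb hεb hs x
  obtain ⟨h1, h2⟩ := h x (Metric.mem_closedBall_self zero_le_one)
  exact ⟨α x, h2, h1⟩

/-! ### Reflection and periodicity -/

lemma HasDerivWithinAt.neg_conj {γ : ℝ → ℂ} {γ' : ℂ} {s : Set ℝ}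
    (h : HasDerivWithinAt γ γ' s σ) :
    HasDerivWithinAt (fun σ => -(starRingEnd ℂ) (γ σ)) (-(starRingEnd ℂ) γ') s σ :=
  (Complex.conjCLE.toContinuousLinearMap.hasFDerivAt.comp_hasDerivWithinAt σ h).fun_neg

lemma IsClipSol.neg_conj (hκ : IsDriving κ) (hε : 0 < ε) (hb : b < 1) (hεb : b ^ 4 + ε * b ^ 2 ≤ 1)
    {γ : ℝ → ℂ} (h : IsClipSol κ ε b γ) :
    IsClipSol κ ε b (fun σ => -(starRingEnd ℂ) (γ σ)) := by
  intro σ hσ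
  have e : clipField κ ε σ (-(starRingEnd ℂ) (γ σ)) = -(starRingEnd ℂ) (clipField κ ε σ (γ σ)) := by
    rcases hσ.1.eq_or_lt with rfl | h0
    · simp [clipField]
    · rw [clipField, clip_neg_conj _ (clipHeight_nonneg hε h0 (pow_le_one_of_le hε hεb hσ)),
        field_neg_conj hκ ⟨hσ.1, hσ.2.trans_lt hb⟩, clipField]
  rw [e]
  exact HasDerivWithinAt.neg_conj (h σ hσ)

lemma IsTraj.neg_conj (hκ : IsDriving κ) (hb : b < 1) {γ : ℝ → ℂ} (h : IsTraj κ ε b γ) :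
    IsTraj κ ε b (fun σ => -(starRingEnd ℂ) (γ σ)) :=
  ⟨fun σ hσ => by
    rw [field_neg_conj hκ ⟨hσ.1, hσ.2.trans_lt hb⟩]
    exact HasDerivWithinAt.neg_conj (h.hasDeriv σ hσ),
    fun σ hσ => neg_conj_mem_clipRegion.2 (h.mem σ hσ)⟩

lemma neg_conj_eq_self_iff {z : ℂ} : -(starRingEnd ℂ) z = z ↔ z.re = 0 := by
  rw [Complex.ext_iff]
  simp only [Complex.neg_re, Complex.conj_re, Complex.neg_im, Complex.conj_im, neg_neg, and_true]
  constructor <;> intro h <;> linarith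

/-- The imaginary axis, which corresponds to the unit circle, is invariant. -/
lemma IsClipSol.re_eq_zero (hκ : IsDriving κ) (hε : 0 < ε) (hb : b < 1)
    (hεb : b ^ 4 + ε * b ^ 2 ≤ 1) {γ : ℝ → ℂ} (h : IsClipSol κ ε b γ) {s : ℝ} (hs : s ∈ Icc 0 b)
    (h0 : (γ s).re = 0) : ∀ σ ∈ Icc 0 b, (γ σ).re = 0 := fun _ hσ =>
  neg_conj_eq_self_iff.1 ((h.neg_conj hκ hε hb hεb).eqOn hκ hε hb hεb h hs
    (neg_conj_eq_self_iff.2 h0) hσ)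

lemma IsClipSol.re_neg (hκ : IsDriving κ) (hε : 0 < ε) (hb : b < 1)
    (hεb : b ^ 4 + ε * b ^ 2 ≤ 1) {γ : ℝ → ℂ} (h : IsClipSol κ ε b γ) {s : ℝ} (hs : s ∈ Icc 0 b)
    (h0 : (γ s).re < 0) : ∀ σ ∈ Icc 0 b, (γ σ).re < 0 := by
  by_contra! hcon
  obtain ⟨u, hu, hu0⟩ := hcon
  have hc : ContinuousOn (fun σ => (γ σ).re) (Icc 0 b) :=
    Complex.continuous_re.comp_continuousOn h.continuousOn
  obtain ⟨v, hv, hv0⟩ := isPreconnected_Icc.intermediate_value hs hu hc ⟨h0.le, hu0⟩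
  exact h0.ne (h.re_eq_zero hκ hε hb hεb hv hv0 s hs)

lemma IsClipSol.re_nonpos (hκ : IsDriving κ) (hε : 0 < ε) (hb : b < 1)
    (hεb : b ^ 4 + ε * b ^ 2 ≤ 1) {γ : ℝ → ℂ} (h : IsClipSol κ ε b γ) {s : ℝ} (hs : s ∈ Icc 0 b)
    (h0 : (γ s).re ≤ 0) : ∀ σ ∈ Icc 0 b, (γ σ).re ≤ 0 := by
  rcases h0.lt_or_eq with h0 | h0
  · exact fun σ hσ => (h.re_neg hκ hε hb hεb hs h0 σ hσ).le
  · exact fun σ hσ => (h.re_eq_zero hκ hε hb hεb hs h0 σ hσ).le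

lemma IsClipSol.isTraj_of_re_eq_zero (hκ : IsDriving κ) (hε : 0 < ε) (hb : b < 1)
    (hεb : b ^ 4 + ε * b ^ 2 ≤ 1) {γ : ℝ → ℂ} (h : IsClipSol κ ε b γ) {s : ℝ} (hs : s ∈ Icc 0 b)
    (h0 : (γ s).re = 0) : IsTraj κ ε b γ :=
  h.isTraj hε fun σ hσ => by
    simpa [clipRegion, h.re_eq_zero hκ hε hb hεb hs h0 σ hσ] using pow_le_one_of_le hε hεb hσ

lemma IsTraj.add_period {γ : ℝ → ℂ} (h : IsTraj κ ε b γ) (n : ℤ) :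
    IsTraj κ ε b (fun σ => γ σ + n * (2 * Real.pi * Complex.I)) := by
  refine ⟨fun σ hσ => ?_, fun σ hσ => ?_⟩
  · have : field κ σ (γ σ + n * (2 * Real.pi * Complex.I)) = field κ σ (γ σ) := by
      simp only [field, Complex.exp_add, Complex.exp_int_mul_two_pi_mul_I, mul_one]
    rw [this]
    exact (h.hasDeriv σ hσ).add_const _
  · have := h.mem σ hσ
    simpa [clipRegion] using this

/-! ### The flow -/

/-- The initial values, at `σ = 0`, of the trajectories that exist up to the time `b`. -/
def aliveSet (κ : ℝ → ℂ) (b : ℝ) : Set ℂ := {ζ | ∃ ε > 0, ∃ γ, IsTraj κ ε b γ ∧ γ 0 = ζ}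

/-- The position at the time `b` of the trajectory with the initial value `ζ ∈ aliveSet κ b`. -/
noncomputable def flow (κ : ℝ → ℂ) (b : ℝ) (ζ : ℂ) : ℂ :=
  Classical.epsilon fun w => ∃ ε > 0, ∃ γ, IsTraj κ ε b γ ∧ γ 0 = ζ ∧ γ b = w

lemma IsTraj.flow_eq (hκ : IsDriving κ) (hε : 0 < ε) (hb : b < 1) {γ : ℝ → ℂ}
    (h : IsTraj κ ε b γ) (hσ : σ ∈ Icc 0 b) : flow κ σ (γ 0) = γ σ := by
  have hσt := h.restrict hσ.2
  obtain ⟨ε', hε', γ', h', h0, h1⟩ := Classical.epsilon_spec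
    (p := fun w => ∃ ε > 0, ∃ γ', IsTraj κ ε σ γ' ∧ γ' 0 = γ 0 ∧ γ' σ = w)
    ⟨γ σ, ε, hε, γ, hσt, rfl, rfl⟩
  rw [flow, ← h1]
  exact h'.eqOn hκ hε' hε (hσ.2.trans_lt hb) hσt ⟨le_rfl, hσ.1⟩ h0 ⟨hσ.1, le_rfl⟩

lemma IsTraj.mem_aliveSet (hε : 0 < ε) {γ : ℝ → ℂ} (h : IsTraj κ ε b γ) (hσ : σ ≤ b) :
    γ 0 ∈ aliveSet κ σ := ⟨ε, hε, γ, h.restrict hσ, rfl⟩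

lemma aliveSet_anti {b' : ℝ} (h : b' ≤ b) : aliveSet κ b ⊆ aliveSet κ b' := by
  rintro ζ ⟨ε, hε, γ, hγ, rfl⟩
  exact hγ.mem_aliveSet hε h

lemma mem_clipRegion_half (hε : 0 < ε) (hσ : 0 ≤ σ) (hσ1 : σ ≤ 1) {L L' : ℂ}
    (hL : L ∈ clipRegion ε σ) (h : ‖L' - L‖ ≤ Real.log ((1 + ε) / (1 + ε / 2))) :
    L' ∈ clipRegion (ε / 2) σ := by
  have h1 : |L'.re| ≤ |L.re| + Real.log ((1 + ε) / (1 + ε / 2)) := by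
    have := (Complex.abs_re_le_norm (L' - L)).trans h
    rw [Complex.sub_re] at this
    have := abs_sub_abs_le_abs_sub L'.re L.re
    linarith
  have h2 : Real.exp |L'.re| ≤ Real.exp |L.re| * ((1 + ε) / (1 + ε / 2)) := by
    rw [← Real.exp_log (show 0 < (1 + ε) / (1 + ε / 2) by positivity), ← Real.exp_add]
    exact Real.exp_le_exp.2 h1
  refine le_trans ?_ (show (σ ^ 4 + ε * σ ^ 2) * Real.exp |L.re| ≤ 1 from hL)
  have h3 : σ ^ 4 ≤ σ ^ 2 := pow_le_pow_of_le_one hσ hσ1 (by norm_num)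
  calc _ ≤ (σ ^ 4 + ε / 2 * σ ^ 2) * (Real.exp |L.re| * ((1 + ε) / (1 + ε / 2))) := by gcongr
    _ = ((σ ^ 4 + ε / 2 * σ ^ 2) * ((1 + ε) / (1 + ε / 2))) * Real.exp |L.re| := by ring
    _ ≤ _ := by
      gcongr
      rw [mul_div_assoc', div_le_iff₀ (by positivity)]
      nlinarith

/-- Trajectories persist, up to the time `b`, under small changes of their value at the time `s`,
and depend on it in a Lipschitz way. -/
lemma IsTraj.exists_near (hκ : IsDriving κ) (hε : 0 < ε) (hb : b < 1) {γ : ℝ → ℂ}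
    (h : IsTraj κ ε b γ) {s : ℝ} (hs : s ∈ Icc 0 b) :
    ∃ (α : ℂ → ℝ → ℂ) (C r : ℝ), 0 ≤ C ∧ 0 < r ∧ ∀ x ∈ Metric.ball (γ s) r,
      α x s = x ∧ IsTraj κ (ε / 2) b (α x) ∧ ∀ σ ∈ Icc 0 b, ‖α x σ - γ σ‖ ≤ C * ‖x - γ s‖ := by
  have hε2 : 0 < ε / 2 := by positivity
  have h2 := h.anti (ε' := ε / 2) (by linarith)
  have hεb := h2.pow_le_one hε2 (hs.1.trans hs.2)
  obtain ⟨α, C, hC, hα, hlip⟩ := exists_clipFlow hκ hε2 hb hεb hs (γ s)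
  have hself := Metric.mem_closedBall_self (x := γ s) zero_le_one
  have hγα : EqOn (α (γ s)) γ (Icc 0 b) :=
    (hα _ hself).2.eqOn hκ hε2 hb hεb (h2.isClipSol hε2) hs (hα _ hself).1
  set d := Real.log ((1 + ε) / (1 + ε / 2)) with hd
  have hd0 : 0 < d := Real.log_pos (by rw [lt_div_iff₀ (by positivity)]; linarith)
  have hlip' : ∀ x ∈ Metric.closedBall (γ s) 1, ∀ σ ∈ Icc 0 b, ‖α x σ - γ σ‖ ≤ C * ‖x - γ s‖ :=
    fun x hx σ hσ => by rw [← hγα hσ]; exact hlip x hx _ hself σ hσ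
  refine ⟨α, C, min 1 (d / (C + 1)), hC, lt_min one_pos (by positivity), fun x hx => ?_⟩
  have hx1 : x ∈ Metric.closedBall (γ s) 1 :=
    Metric.ball_subset_closedBall (Metric.ball_subset_ball (min_le_left _ _) hx)
  have hx2 : ‖x - γ s‖ < d / (C + 1) := by
    rw [mem_ball_iff_norm] at hx
    exact hx.trans_le (min_le_right _ _)
  refine ⟨(hα x hx1).1, (hα x hx1).2.isTraj hε2 fun σ hσ => ?_, hlip' x hx1⟩
  refine mem_clipRegion_half hε hσ.1 (hσ.2.trans hb.le) (h.mem σ hσ) ((hlip' x hx1 σ hσ).trans ?_)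
  rw [lt_div_iff₀ (by positivity)] at hx2
  nlinarith [norm_nonneg (x - γ s)]

lemma isOpen_aliveSet (hκ : IsDriving κ) (hb0 : 0 ≤ b) (hb : b < 1) : IsOpen (aliveSet κ b) := by
  rw [Metric.isOpen_iff]
  rintro ζ ⟨ε, hε, γ, hγ, rfl⟩
  obtain ⟨α, C, r, -, hr, h⟩ := hγ.exists_near hκ hε hb ⟨le_rfl, hb0⟩
  exact ⟨r, hr, fun x hx => ⟨ε / 2, by positivity, α x, (h x hx).2.1, (h x hx).1⟩⟩


lemma differentiableOn_field (hκ : IsDriving κ) (hσ : σ ∈ Ico (0 : ℝ) 1) (hε : 0 < ε)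
    {x : ℂ} {d : ℝ}
    (h : Metric.ball x d ⊆ clipRegion ε σ) :
    DifferentiableOn ℂ (field κ σ) (Metric.ball x d) := by
  rcases hσ.1.eq_or_lt with rfl | h0
  · have : field κ 0 = fun _ => 0 := by funext; simp
    rw [this]; exact differentiableOn_const _
  have hσ1 : σ ∈ Ioo (0 : ℝ) 1 := ⟨h0, hσ.2⟩
  have hρ : 1 / (1 + ε) < 1 := by linarith [one_sub_inv_pos hε]
  have hlam := differentiableOn_lambert (q := σ ^ 8) (by positivity)
    (pow_lt_one₀ h0.le hσ.2 (by norm_num))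
  have hyne : ∀ L, Complex.exp L * κ σ ≠ 0 := fun L =>
    mul_ne_zero (Complex.exp_ne_zero _) (norm_ne_zero_iff.1 (by
      rw [hκ.norm_eq σ hσ1]; exact one_ne_zero))
  unfold field
  refine DifferentiableOn.const_mul (DifferentiableOn.sub ?_ ?_) _
  · refine hlam.comp (f := fun L => (σ : ℂ) ^ 4 * (Complex.exp L * κ σ)) (by fun_prop)
      fun L hL => ?_
    exact mem_ball_zero_iff.2 (((norm_outer_le hκ hσ1).trans
      (exp_abs_re_le' hε h0 hσ.2.le (h hL))).trans_lt hρ)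
  · refine hlam.comp (f := fun L => (σ : ℂ) ^ 4 * (Complex.exp L * κ σ)⁻¹) ?_ fun L hL => ?_
    · exact (DifferentiableOn.inv (by fun_prop) fun L _ => hyne L).const_mul _
    · exact mem_ball_zero_iff.2 (((norm_inner_le hκ hσ1).trans
        (exp_abs_re_le' hε h0 hσ.2.le (h hL))).trans_lt hρ)

/-- The flow is holomorphic in the initial value. -/
lemma exists_hasDerivAt_of_mem_aliveSet (hκ : IsDriving κ) (hb0 : 0 ≤ b) (hb : b < 1) {ζ : ℂ}
    (hζ : ζ ∈ aliveSet κ b) : ∃ J, HasDerivAt (flow κ b) J ζ := by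
  obtain ⟨ε, hε, γ, hγ, rfl⟩ := hζ
  have h0 : (0 : ℝ) ∈ Icc 0 b := ⟨le_rfl, hb0⟩
  have hε2 : 0 < ε / 2 := by positivity
  have hε4 : 0 < ε / 2 / 2 := by positivity
  obtain ⟨α, C, r, -, hr, h⟩ := hγ.exists_near hκ hε hb h0
  have hself := h _ (Metric.mem_ball_self (x := γ 0) hr)
  have heq : EqOn (α (γ 0)) γ (Icc 0 b) := hself.2.1.eqOn hκ hε2 hε hb hγ h0 hself.1
  set d := Real.log ((1 + ε) / (1 + ε / 2)) with hd
  have hd0 : 0 < d := Real.log_pos (by rw [lt_div_iff₀ (by positivity)]; linarith)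
  have hball : ∀ σ ∈ Icc 0 b, Metric.ball (α (γ 0) σ) d ⊆ clipRegion (ε / 2) σ := by
    intro σ hσ y hy
    rw [heq hσ, mem_ball_iff_norm] at hy
    exact mem_clipRegion_half hε hσ.1 (hσ.2.trans hb.le) (hγ.mem σ hσ) hy.le
  have hK := fieldConst_pos hε2 hb0 hb
  obtain ⟨J, hJ⟩ := exists_hasDerivAt_flow (f := field κ) (γ := α) (z₀ := γ 0) (C := C) hb0 hd0 hK
    (fun σ hσ => differentiableOn_field hκ ⟨hσ.1, hσ.2.trans_lt hb⟩ hε2 (hball σ hσ))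
    (fun σ hσ y hy => (norm_field_le hκ hε2 hb hσ (hball σ hσ hy)).trans (by
      have := hσ.2
      nlinarith))
    (fun u hu => continuousOn_field hκ hε2 hb
      ((hself.2.1.continuousOn.mono Ioc_subset_Icc_self).add continuousOn_const).cexp
      fun σ hσ => hball σ ⟨hσ.1.le, hσ.2⟩ (by simpa using hu))
    (by
      filter_upwards [Metric.ball_mem_nhds _ hr] with z hz
      refine ⟨(h z hz).1, fun σ hσ => ⟨(h z hz).2.1.hasDeriv σ hσ, ?_⟩⟩
      rw [heq hσ]
      exact (h z hz).2.2 σ hσ)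
  refine ⟨J, hJ.congr_of_eventuallyEq ?_⟩
  filter_upwards [Metric.ball_mem_nhds _ hr] with z hz
  have := (h z hz).2.1.flow_eq hκ hε2 hb ⟨hb0, le_rfl⟩
  rwa [(h z hz).1] at this

/-- Trajectories can be continued beyond their final time. -/
lemma IsTraj.exists_extension (hκ : IsDriving κ) (hε : 0 < ε) (hb0 : 0 ≤ b) (hb : b < 1) {γ : ℝ → ℂ}
    (h : IsTraj κ ε b γ) :
    ∃ b' ∈ Ioo b 1, ∃ ε' > 0, ∃ γ', IsTraj κ ε' b' γ' ∧ γ' 0 = γ 0 := by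
  set b₁ := (1 + b) / 2 with hb₁
  have hb₁1 : b₁ < 1 := by rw [hb₁]; linarith
  have hbb₁ : b < b₁ := by rw [hb₁]; linarith
  have hb₁0 : 0 ≤ b₁ := hb0.trans hbb₁.le
  set ε' := min (ε / 2) (1 - b₁ ^ 2) with hε'
  have hε'0 : 0 < ε' := lt_min (by positivity) (one_sub_pow_pos hb₁0 hb₁1 (by norm_num))
  have hε'ε : ε' < ε := (min_le_left _ _).trans_lt (by linarith)
  have hεb₁ : b₁ ^ 4 + ε' * b₁ ^ 2 ≤ 1 := by
    have : ε' ≤ 1 - b₁ ^ 2 := min_le_right _ _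
    nlinarith [sq_nonneg b₁]
  obtain ⟨γ', hγ', h0⟩ := exists_isClipSol hκ hε'0 hb₁1 hεb₁ ⟨le_rfl, hb₁0⟩ (γ 0)
  have hεb : b ^ 4 + ε' * b ^ 2 ≤ 1 := pow_le_one_of_le hε'0 hεb₁ ⟨hb0, hbb₁.le⟩
  have heq : EqOn γ' γ (Icc 0 b) := (hγ'.restrict hbb₁.le).eqOn hκ hε'0 hb hεb
    ((h.anti hε'ε.le).isClipSol hε'0) ⟨le_rfl, hb0⟩ h0
  have hc : ContinuousWithinAt (fun σ => (σ ^ 4 + ε' * σ ^ 2) * Real.exp |(γ' σ).re|)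
      (Icc 0 b₁) b := by
    have : ContinuousWithinAt γ' (Icc 0 b₁) b := hγ'.continuousOn b ⟨hb0, hbb₁.le⟩
    have h3 : ContinuousWithinAt (fun σ => Real.exp |(γ' σ).re|) (Icc 0 b₁) b :=
      (Real.continuous_exp.comp
        (continuous_abs.comp Complex.continuous_re)).continuousAt.comp_continuousWithinAt this
    exact ContinuousWithinAt.mul (by fun_prop) h3
  have hlt : (b ^ 4 + ε' * b ^ 2) * Real.exp |(γ' b).re| < 1 := by
    rw [heq ⟨hb0, le_rfl⟩]
    rcases hb0.eq_or_lt with rfl | hb0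
    · simp
    · refine lt_of_lt_of_le ?_ (show _ ≤ _ from h.mem b ⟨hb0.le, le_rfl⟩)
      gcongr
  have hev : ∀ᶠ σ in 𝓝[≥] b, (σ ^ 4 + ε' * σ ^ 2) * Real.exp |(γ' σ).re| < 1 :=
    (hc.mono_of_mem_nhdsWithin (mem_of_superset (Icc_mem_nhdsGE_of_mem ⟨le_rfl, hbb₁⟩)
      (Icc_subset_Icc_left hb0))).eventually (gt_mem_nhds hlt)
  obtain ⟨c, hc, hcsub⟩ := mem_nhdsGE_iff_exists_Icc_subset.1 hev
  have hbc : b < min c b₁ := lt_min hc hbb₁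
  refine ⟨min c b₁, ⟨hbc, (min_le_right _ _).trans_lt hb₁1⟩, ε', hε'0, γ', ?_, h0⟩
  refine (hγ'.restrict (min_le_right _ _)).isTraj hε'0 fun σ hσ => ?_
  rcases le_total σ b with h4 | h4
  · rw [heq ⟨hσ.1, h4⟩]
    exact clipRegion_anti hε'ε.le (h.mem σ ⟨hσ.1, h4⟩)
  · have : (σ ^ 4 + ε' * σ ^ 2) * Real.exp |(γ' σ).re| < 1 :=
      hcsub ⟨h4, hσ.2.trans (min_le_left _ _)⟩
    exact this.le

/-- Every initial value has a trajectory for a short time. -/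
lemma exists_isTraj (hκ : IsDriving κ) (ζ : ℂ) :
    ∃ b ∈ Ioo (0 : ℝ) 1, ∃ ε > 0, ∃ γ, IsTraj κ ε b γ ∧ γ 0 = ζ := by
  have h : IsTraj κ 1 0 (fun _ => ζ) := by
    constructor
    · intro σ hσ
      have : σ = 0 := le_antisymm hσ.2 hσ.1
      subst this
      rw [field_zero_time]
      exact hasDerivWithinAt_const _ _ _
    · intro σ hσ
      have : σ = 0 := le_antisymm hσ.2 hσ.1
      subst this
      simp [clipRegion]
  obtain ⟨b, hb, ε, hε, γ, hγ, h0⟩ := h.exists_extension hκ one_pos le_rfl one_pos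
  exact ⟨b, hb, ε, hε, γ, hγ, h0⟩

/-! ### Barriers -/

/-- A fencing estimate: `H` stays above an exponentially decaying barrier. -/
lemma mul_exp_le_of_fence {H H' : ℝ → ℝ} {a b B C : ℝ}
    (hd : ∀ σ ∈ Icc a b, HasDerivWithinAt H (H' σ) (Icc a b) σ) (hB : B ≤ H a)
    (hbound : ∀ σ ∈ Ico a b, H σ = B * Real.exp (-C * (σ - a)) → -C * H σ < H' σ) :
    ∀ σ ∈ Icc a b, B * Real.exp (-C * (σ - a)) ≤ H σ := by
  intro σ hσ
  have hBd : ∀ x, HasDerivAt (fun σ => -(B * Real.exp (-C * (σ - a))))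
      (C * (B * Real.exp (-C * (x - a)))) x := by
    intro x
    have h1 : HasDerivAt (fun σ => -C * (σ - a)) (-C * 1) x :=
      ((hasDerivAt_id' x).sub_const a).const_mul (-C)
    have := (h1.exp.const_mul B).fun_neg
    refine this.congr_deriv ?_
    ring
  have := image_le_of_deriv_right_lt_deriv_boundary (f := fun σ => -H σ) (f' := fun σ => -H' σ)
    (a := a) (b := b) (fun x hx => (hd x hx).continuousWithinAt.neg)
    (fun x hx => ((hd x ⟨hx.1, hx.2.le⟩).mono_of_mem_nhdsWithin
      (Icc_mem_nhdsGE_of_mem hx)).fun_neg) (by simpa using hB) hBd (fun x hx heq => by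
        have heq : H x = B * Real.exp (-C * (x - a)) := by linarith
        have := hbound x hx heq
        rw [← heq]; linarith) hσ
  linarith

/-- The fencing estimate `mul_exp_le_of_fence` after time reversal. -/
lemma mul_exp_le_of_fence_backward {H H' : ℝ → ℝ} {a b B C : ℝ}
    (hd : ∀ σ ∈ Icc a b, HasDerivWithinAt H (H' σ) (Icc a b) σ) (hB : B ≤ H b)
    (hbound : ∀ σ ∈ Ioc a b, H σ = B * Real.exp (-C * (b - σ)) → H' σ < C * H σ) :
    ∀ σ ∈ Icc a b, B * Real.exp (-C * (b - σ)) ≤ H σ := by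
  intro σ hσ
  have hmaps : MapsTo (fun s : ℝ => -s) (Icc (-b) (-a)) (Icc a b) := fun s hs =>
    ⟨by linarith [hs.2], by linarith [hs.1]⟩
  have := mul_exp_le_of_fence (H := fun s => H (-s)) (H' := fun s => -H' (-s)) (a := -b) (b := -a)
    (B := B) (C := C) (fun s hs => by
      have := (hd (-s) (hmaps hs)).comp s (hasDerivAt_neg s).hasDerivWithinAt hmaps
      simpa [Function.comp_def] using this) (by simpa using hB) (fun s hs heq => by
        have h1 : H (-s) = B * Real.exp (-C * (b - -s)) := by
          rw [heq]; ring_nf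
        have := hbound (-s) ⟨by linarith [hs.2], by linarith [hs.1]⟩ h1
        change -C * H (-s) < -H' (-s)
        linarith) (-σ) ⟨by linarith [hσ.2], by linarith [hσ.1]⟩
  rw [neg_neg] at this
  convert this using 3
  ring

/-- The quantity `e^{Re L} / σ² - σ²`, which measures the distance to the inner boundary
`Re L = 4 log σ` of the domain: `L` with `Re L ≤ 0` belongs to `clipRegion ε σ` if and only if it is
at least `ε`. -/
noncomputable def barrier (σ : ℝ) (L : ℂ) : ℝ := Real.exp L.re / σ ^ 2 - σ ^ 2

lemma mem_clipRegion_iff_le_barrier (hσ : 0 < σ) {L : ℂ} (hL : L.re ≤ 0) :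
    L ∈ clipRegion ε σ ↔ ε ≤ barrier σ L := by
  change (σ ^ 4 + ε * σ ^ 2) * Real.exp |L.re| ≤ 1 ↔ _
  rw [abs_of_nonpos hL, Real.exp_neg, ← div_eq_mul_inv, div_le_one (Real.exp_pos _), barrier,
    le_sub_iff_add_le, le_div_iff₀ (by positivity)]
  constructor <;> intro h <;> nlinarith

lemma hasDerivWithinAt_barrier {γ : ℝ → ℂ} {γ' : ℂ} {s : Set ℝ} (hσ : σ ≠ 0)
    (h : HasDerivWithinAt γ γ' s σ) :
    HasDerivWithinAt (fun σ => barrier σ (γ σ))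
      (Real.exp (γ σ).re * γ'.re / σ ^ 2 - 2 * Real.exp (γ σ).re / σ ^ 3 - 2 * σ) s σ := by
  have h1 : HasDerivWithinAt (fun σ => (γ σ).re) γ'.re s σ :=
    Complex.reCLM.hasFDerivAt.comp_hasDerivWithinAt σ h
  have h2 : HasDerivWithinAt (fun σ : ℝ => σ ^ 2) (2 * σ) s σ := by
    simpa using (hasDerivAt_pow 2 σ).hasDerivWithinAt (s := s)
  have := (h1.exp.fun_div h2 (pow_ne_zero 2 hσ)).fun_sub h2
  unfold barrier
  refine this.congr_deriv ?_
  field_simp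

/-- The derivative of the barrier quantity along a trajectory, in terms of the Schwarz function at
`w = g / χ`. -/
lemma barrier_deriv_eq (hκ : IsDriving κ) (hσ : σ ∈ Ioo (0 : ℝ) 1) (L : ℂ) {w : ℂ}
    (hw : w = σ ^ 4 * (Complex.exp L * κ σ)⁻¹) :
    Real.exp L.re * (field κ σ L).re / σ ^ 2 - 2 * Real.exp L.re / σ ^ 3 - 2 * σ =
      4 / σ * (Real.exp L.re / σ ^ 2) * ((1 - ‖w‖) / 2 - (1 +
      lambert ((σ ^ 4) ^ 2) w - lambert ((σ ^ 4) ^ 2) (((σ ^ 4 : ℝ) : ℂ) ^ 2 / w)).re) := by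
  have h0 := hσ.1
  have hwn : ‖w‖ = σ ^ 4 * Real.exp (-L.re) := by rw [hw, norm_inner hκ hσ]
  rw [field_eq h0.ne', ← hw, hwn, Real.exp_neg]
  set S := 1 + lambert ((σ ^ 4) ^ 2) w - lambert ((σ ^ 4) ^ 2) (((σ ^ 4 : ℝ) : ℂ) ^ 2 / w) with hS
  have h4 : (4 / (σ : ℂ)) = ((4 / σ : ℝ) : ℂ) := by push_cast; rfl
  have : (4 / (σ : ℂ) * (1 - S)).re = 4 / σ * (1 - S.re) := by
    rw [h4, Complex.re_ofReal_mul]; simp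
  rw [this]
  have := (Real.exp_pos L.re).ne'
  field_simp
  ring

lemma barrier_eq (hκ : IsDriving κ) (hσ : σ ∈ Ioo (0 : ℝ) 1) (L : ℂ) :
    barrier σ L = Real.exp L.re / σ ^ 2 * (1 - ‖(σ : ℂ) ^ 4 * (Complex.exp L * κ σ)⁻¹‖) := by
  have h0 := hσ.1
  rw [norm_inner hκ hσ, barrier, Real.exp_neg]
  have := (Real.exp_pos L.re).ne'
  field_simp

lemma norm_inner_mem (hκ : IsDriving κ) (hσ : σ ∈ Ioo (0 : ℝ) 1) {L : ℂ} (hL : L.re ≤ 0)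
    (hH : 0 < barrier σ L) : σ ^ 4 ≤ ‖(σ : ℂ) ^ 4 * (Complex.exp L * κ σ)⁻¹‖ ∧
      ‖(σ : ℂ) ^ 4 * (Complex.exp L * κ σ)⁻¹‖ < 1 := by
  have h0 := hσ.1
  constructor
  · rw [norm_inner hκ hσ]
    exact le_mul_of_one_le_right (by positivity) (Real.one_le_exp (by linarith))
  · rw [barrier_eq hκ hσ] at hH
    have : 0 < Real.exp L.re / σ ^ 2 := by positivity
    linarith [pos_of_mul_pos_right hH this.le]

/-- The error term of `le_re_schwarz` and `re_schwarz_le` at `τ = σ⁴`. -/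
lemma schwarz_error_le (hσ : σ ∈ Ioo (0 : ℝ) 1) (hσb : σ ≤ b) (hb : b < 1) :
    4 * σ ^ 4 / ((1 - (σ ^ 4) ^ 2) * (1 - σ ^ 4) ^ 2) ≤
      4 * σ / ((1 - b ^ 8) * (1 - b ^ 4) ^ 2) := by
  have h0 := hσ.1
  have hb0 : 0 ≤ b := h0.le.trans hσb
  have := one_sub_pow_pos hb0 hb (n := 8) (by norm_num)
  have := one_sub_pow_pos hb0 hb (n := 4) (by norm_num)
  have h4 : σ ^ 4 ≤ σ := by simpa using pow_le_pow_of_le_one h0.le hσ.2.le (show 1 ≤ 4 by norm_num)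
  have : 0 < 1 - σ ^ 8 := one_sub_pow_pos h0.le hσ.2 (by norm_num)
  rw [← pow_mul]
  norm_num
  gcongr

/-- Along a trajectory the barrier quantity grows at most exponentially, so that backwards in time
it cannot reach zero. -/
lemma barrier_deriv_le (hκ : IsDriving κ) (hσ : σ ∈ Ioo (0 : ℝ) 1) (hσb : σ ≤ b) (hb : b < 1)
    {L : ℂ} (hL : L.re ≤ 0) (hH : 0 < barrier σ L) :
    Real.exp L.re * (field κ σ L).re / σ ^ 2 - 2 * Real.exp L.re / σ ^ 3 - 2 * σ ≤
      16 / ((1 - b ^ 8) * (1 - b ^ 4) ^ 2) * barrier σ L := by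
  have h0 := hσ.1
  obtain ⟨hw0, hw1⟩ := norm_inner_mem hκ hσ hL hH
  rw [barrier_deriv_eq hκ hσ L rfl, barrier_eq hκ hσ]
  set w := (σ : ℂ) ^ 4 * (Complex.exp L * κ σ)⁻¹ with hw
  have hS := le_re_schwarz (τ := σ ^ 4) (by positivity)
    (pow_lt_one₀ h0.le hσ.2 (by norm_num)) hw0 hw1
  have hC := schwarz_error_le hσ hσb hb
  set C := 4 * σ ^ 4 / ((1 - (σ ^ 4) ^ 2) * (1 - σ ^ 4) ^ 2) with hCdef
  set D := (1 - b ^ 8) * (1 - b ^ 4) ^ 2 with hD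
  have h1 : (1 - ‖w‖) / 2 - (1 + lambert ((σ ^ 4) ^ 2) w -
      lambert ((σ ^ 4) ^ 2) (((σ ^ 4 : ℝ) : ℂ) ^ 2 / w)).re ≤ (1 - ‖w‖) * (4 * σ / D) := by
    have : (1 - ‖w‖) * C ≤ (1 - ‖w‖) * (4 * σ / D) := by
      have : 0 ≤ 1 - ‖w‖ := by linarith
      gcongr
    nlinarith
  calc _ ≤ 4 / σ * (Real.exp L.re / σ ^ 2) * ((1 - ‖w‖) * (4 * σ / D)) := by gcongr
    _ = _ := by field_simp; ring

/-- Away from the pole the barrier quantity decays at most exponentially along a trajectory, so that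
it stays positive. -/
lemma le_barrier_deriv (hκ : IsDriving κ) {a r : ℝ} (ha : 0 < a) (hr : 0 < r) (haσ : a ≤ σ)
    (hσb : σ ≤ b) (hb : b < 1) {L : ℂ} (hL : L.re ≤ 0) (hH : 0 < barrier σ L)
    (hwr : r ≤ ‖1 - (σ : ℂ) ^ 4 * (Complex.exp L * κ σ)⁻¹‖) :
    -(4 / a * (2 / r ^ 2 + 4 / ((1 - b ^ 8) * (1 - b ^ 4) ^ 2))) * barrier σ L ≤
    Real.exp L.re * (field κ σ L).re / σ ^ 2 - 2 * Real.exp L.re / σ ^ 3 - 2 * σ := by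
  have hσ : σ ∈ Ioo (0 : ℝ) 1 := ⟨ha.trans_le haσ, hσb.trans_lt hb⟩
  have h0 := hσ.1
  have hb0 : 0 ≤ b := h0.le.trans hσb
  obtain ⟨hw0, hw1⟩ := norm_inner_mem hκ hσ hL hH
  rw [barrier_deriv_eq hκ hσ L rfl, barrier_eq hκ hσ]
  set w := (σ : ℂ) ^ 4 * (Complex.exp L * κ σ)⁻¹ with hw
  have hS := re_schwarz_le (τ := σ ^ 4) (by positivity) (pow_lt_one₀ h0.le hσ.2 (by norm_num)) hr
    hw0 hw1 hwr
  have hC := schwarz_error_le hσ hσb hb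
  set C := 4 * σ ^ 4 / ((1 - (σ ^ 4) ^ 2) * (1 - σ ^ 4) ^ 2) with hCdef
  have hD0 : 0 < (1 - b ^ 8) * (1 - b ^ 4) ^ 2 := by
    have := one_sub_pow_pos hb0 hb (n := 8) (by norm_num)
    have := one_sub_pow_pos hb0 hb (n := 4) (by norm_num)
    positivity
  set D := (1 - b ^ 8) * (1 - b ^ 4) ^ 2 with hD
  have hCD : C ≤ 4 / D := hC.trans (by gcongr; linarith [hσ.2])
  have hw1' : 0 ≤ 1 - ‖w‖ := by linarith
  have h1 : -((1 - ‖w‖) * (2 / r ^ 2 + 4 / D)) ≤ (1 - ‖w‖) / 2 - (1 + lambert ((σ ^ 4) ^ 2) w -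
      lambert ((σ ^ 4) ^ 2) (((σ ^ 4 : ℝ) : ℂ) ^ 2 / w)).re := by
    have : (1 - ‖w‖) * C ≤ (1 - ‖w‖) * (4 / D) := by gcongr
    nlinarith
  have h2 : 4 / σ ≤ 4 / a := by gcongr
  calc _ = 4 / a * (Real.exp L.re / σ ^ 2) * -((1 - ‖w‖) * (2 / r ^ 2 + 4 / D)) := by ring
    _ ≤ 4 / σ * (Real.exp L.re / σ ^ 2) * -((1 - ‖w‖) * (2 / r ^ 2 + 4 / D)) := by
        have h3 : 0 ≤ Real.exp L.re / σ ^ 2 * ((1 - ‖w‖) * (2 / r ^ 2 + 4 / D)) := by positivity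
        nlinarith
    _ ≤ _ := by gcongr

/-! ### Backward and forward continuation -/

lemma exists_isTraj_of_re_nonpos (hκ : IsDriving κ) (hb0 : 0 < b) (hb : b < 1) {L : ℂ}
    (hL : L.re ≤ 0) (hLb : b ^ 4 < Real.exp L.re) : ∃ ε > 0, ∃ γ, IsTraj κ ε b γ ∧ γ b = L := by
  have hH : 0 < barrier b L := by
    rw [barrier, sub_pos, lt_div_iff₀ (by positivity)]
    calc b ^ 2 * b ^ 2 = b ^ 4 := by ring
      _ < _ := hLb
  set C := 16 / ((1 - b ^ 8) * (1 - b ^ 4) ^ 2) + 1 with hC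
  have hC0 : 0 < C := by
    have := one_sub_pow_pos hb0.le hb (n := 8) (by norm_num)
    have := one_sub_pow_pos hb0.le hb (n := 4) (by norm_num)
    positivity
  set ε := min (1 - b ^ 2) (barrier b L * Real.exp (-C)) with hε
  have hε0 : 0 < ε := lt_min (one_sub_pow_pos hb0.le hb (by norm_num)) (by positivity)
  have hεb : b ^ 4 + ε * b ^ 2 ≤ 1 := by
    have : ε ≤ 1 - b ^ 2 := min_le_left _ _
    nlinarith [sq_nonneg b]
  have hbb : b ∈ Icc 0 b := ⟨hb0.le, le_rfl⟩
  obtain ⟨γ, hγ, hγb⟩ := exists_isClipSol hκ hε0 hb hεb hbb L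
  have hre := hγ.re_nonpos hκ hε0 hb hεb hbb (by rwa [hγb])
  -- the barrier stays above the level `ε` of the projection
  have hlevel : ∀ σ ∈ Icc 0 b, ε ≤ barrier b L * Real.exp (-C * (b - σ)) := fun σ hσ => by
    refine (min_le_right _ _).trans ?_
    gcongr
    nlinarith [hσ.1, hσ.2]
  refine ⟨ε, hε0, γ, hγ.isTraj hε0 fun s hs => ?_, hγb⟩
  rcases hs.1.eq_or_lt with rfl | hs0
  · simp [clipRegion]
  rw [mem_clipRegion_iff_le_barrier hs0 (hre s hs)]
  refine (hlevel s hs).trans ?_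
  refine mul_exp_le_of_fence_backward (H := fun σ => barrier σ (γ σ)) (a := s)
    (fun σ hσ => (hasDerivWithinAt_barrier (hs0.trans_le hσ.1).ne'
      (hγ σ ⟨hs.1.trans hσ.1, hσ.2⟩)).mono (Icc_subset_Icc_left hs.1)) (by rw [hγb]) ?_ s
    ⟨le_rfl, hs.2⟩
  intro σ hσ heq
  have hσ0 := hs0.trans hσ.1
  have hσb : σ ∈ Icc 0 b := ⟨hσ0.le, hσ.2⟩
  have hεH : ε ≤ barrier σ (γ σ) := (hlevel σ hσb).trans heq.symm.le
  have hmem := (mem_clipRegion_iff_le_barrier hσ0 (hre σ hσb)).2 hεH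
  rw [clipField_eq_field hε0 hσ0.le hmem]
  refine (barrier_deriv_le hκ ⟨hσ0, hσ.2.trans_lt hb⟩ hσ.2 hb (hre σ hσb)
    (hε0.trans_le hεH)).trans_lt ?_
  have : 0 < barrier σ (γ σ) := hε0.trans_le hεH
  rw [hC]
  linarith

/-- Backward solvability: every point of the domain of the field at the time `b` is reached by a
trajectory. -/
lemma exists_isTraj_eq (hκ : IsDriving κ) (hb0 : 0 < b) (hb : b < 1) {L : ℂ}
    (hL : b ^ 4 * Real.exp |L.re| < 1) : ∃ ε > 0, ∃ γ, IsTraj κ ε b γ ∧ γ b = L := by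
  have hL' : b ^ 4 < Real.exp (-|L.re|) := by
    rw [Real.exp_neg, ← one_div, lt_div_iff₀ (Real.exp_pos _)]; exact hL
  rcases le_total L.re 0 with h | h
  · refine exists_isTraj_of_re_nonpos hκ hb0 hb h ?_
    rwa [abs_of_nonpos h, neg_neg] at hL'
  · obtain ⟨ε, hε, γ, hγ, hγb⟩ := exists_isTraj_of_re_nonpos hκ hb0 hb
      (L := -(starRingEnd ℂ) L) (by simpa using h) (by rwa [abs_of_nonneg h] at hL')
    exact ⟨ε, hε, _, hγ.neg_conj hκ hb, by simp [hγb]⟩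

lemma norm_clip_sub_self_le {m m' : ℝ} (hm0 : 0 ≤ m) (hm : m ≤ m') {L : ℂ} (hL : |L.re| ≤ m') :
    ‖clip m L - L‖ ≤ m' - m := by
  have h1 : clip m L - L = ((max (-m) (min L.re m) - L.re : ℝ) : ℂ) := by
    apply Complex.ext <;> simp [clip]
  rw [h1, Complex.norm_real, Real.norm_eq_abs, abs_le]
  rw [abs_le] at hL
  simp only [max_def, min_def]
  constructor <;> split_ifs <;> linarith

/-- Away from its pole the field is bounded on `Re L ≤ 0`. -/
lemma norm_field_le_of_away (hκ : IsDriving κ) {a r : ℝ} (ha : 0 < a) (hr : 0 < r) (haσ : a ≤ σ)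
    (hσb : σ ≤ b) (hb : b < 1) {L : ℂ} (hL : L.re ≤ 0) (hε : 0 < ε) (hmem : L ∈ clipRegion ε σ)
    (hwr : r ≤ ‖1 - (σ : ℂ) ^ 4 * (Complex.exp L * κ σ)⁻¹‖) :
    ‖field κ σ L‖ ≤ 4 / a * (2 / r + 4 / ((1 - b ^ 8) * (1 - b ^ 4) ^ 2)) := by
  have hσ : σ ∈ Ioo (0 : ℝ) 1 := ⟨ha.trans_le haσ, hσb.trans_lt hb⟩
  have h0 := hσ.1
  have hb0 : 0 ≤ b := h0.le.trans hσb
  have hq1 : σ ^ 8 < 1 := pow_lt_one₀ h0.le hσ.2 (by norm_num)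
  have i8 := one_sub_pow_pos hb0 hb (n := 8) (by norm_num)
  have i4 := one_sub_pow_pos hb0 hb (n := 4) (by norm_num)
  have hb4 : b ^ 4 < 1 := by linarith
  have hH := (mem_clipRegion_iff_le_barrier h0 hL).1 hmem
  obtain ⟨-, hw1⟩ := norm_inner_mem hκ hσ hL (hε.trans_le hH)
  set w := (σ : ℂ) ^ 4 * (Complex.exp L * κ σ)⁻¹ with hw
  have hlam : ∀ x : ℂ, ‖x‖ ≤ b ^ 4 →
      ‖lambert (σ ^ 8) x‖ ≤ 2 / ((1 - b ^ 8) * (1 - b ^ 4) ^ 2) := by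
    intro x hx
    refine (norm_lambert_le (by positivity) hq1 hb4 hx).trans ?_
    have : 2 / ((1 - σ ^ 8) * (1 - b ^ 4) ^ 2) ≤ 2 / ((1 - b ^ 8) * (1 - b ^ 4) ^ 2) := by gcongr
    calc _ ≤ 2 / ((1 - b ^ 8) * (1 - b ^ 4) ^ 2) * 1 :=
          mul_le_mul this (hx.trans hb4.le) (norm_nonneg _) (by positivity)
      _ = _ := mul_one _
  have hx : ‖(σ : ℂ) ^ 4 * (Complex.exp L * κ σ)‖ ≤ b ^ 4 := by
    rw [norm_outer hκ hσ]
    calc σ ^ 4 * Real.exp L.re ≤ b ^ 4 * 1 := by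
          gcongr; exact Real.exp_le_one_iff.2 hL
      _ = _ := mul_one _
  have hqw : ‖((σ ^ 8 : ℝ) : ℂ) * w‖ ≤ b ^ 4 := by
    rw [norm_mul, Complex.norm_real, Real.norm_of_nonneg (by positivity)]
    calc σ ^ 8 * ‖w‖ ≤ b ^ 8 * 1 := by gcongr
      _ ≤ b ^ 4 := by rw [mul_one]; exact pow_le_pow_of_le_one hb0 hb.le (by norm_num)
  have hmain : ‖2 * w / (1 - w)‖ ≤ 2 / r := by
    rw [norm_div, norm_mul, Complex.norm_ofNat]
    gcongr
    linarith
  have h4 : ‖(4 : ℂ) / σ‖ ≤ 4 / a := by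
    rw [norm_div, Complex.norm_real, Real.norm_of_nonneg h0.le, Complex.norm_ofNat]
    gcongr
  have hlw : ‖lambert (σ ^ 8) w‖ ≤ 2 / r + 2 / ((1 - b ^ 8) * (1 - b ^ 4) ^ 2) := by
    rw [lambert_eq_add (by positivity) hq1 hw1]
    exact (norm_add_le _ _).trans (add_le_add hmain (hlam _ hqw))
  rw [field, norm_mul]
  refine mul_le_mul h4 ((norm_sub_le _ _).trans ?_) (norm_nonneg _) (by positivity)
  have := hlam _ hx
  calc _ ≤ 2 / ((1 - b ^ 8) * (1 - b ^ 4) ^ 2) +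
        (2 / r + 2 / ((1 - b ^ 8) * (1 - b ^ 4) ^ 2)) := add_le_add this hlw
    _ = _ := by ring

/-- Forward continuation: a trajectory which at some time has `w = g / χ` at distance at least `r`
from the pole `1` of the field survives for a further time that only depends on `r`. -/
lemma exists_forward_survival (hκ : IsDriving κ) {a r : ℝ} (ha : 0 < a) (hb : b < 1)
    (hr : 0 < r) : ∃ δ > 0, ∀ s ∈ Icc a b, ∀ s' ∈ Icc s b, s' - s ≤ δ → ∀ ζ ∈ aliveSet κ s,
      ζ.re ≤ 0 → r ≤ ‖1 - (s : ℂ) ^ 4 * (Complex.exp (flow κ s ζ) * κ s)⁻¹‖ →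
      ζ ∈ aliveSet κ s' := by
  rcases lt_or_ge b a with hba | hab
  · exact ⟨1, one_pos, fun s hs => absurd (hs.1.trans hs.2) (not_le.2 hba)⟩
  have hb0 : 0 < b := ha.trans_le hab
  have i8 := one_sub_pow_pos hb0.le hb (n := 8) (by norm_num)
  have i4 := one_sub_pow_pos hb0.le hb (n := 4) (by norm_num)
  set C := 4 / a * (2 / (r / 2) + 4 / ((1 - b ^ 8) * (1 - b ^ 4) ^ 2)) + 1 with hC
  have hC0 : 0 < C := by positivity
  set D := 4 / a * (2 / (r / 2) ^ 2 + 4 / ((1 - b ^ 8) * (1 - b ^ 4) ^ 2)) + 1 with hD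
  have hD0 : 0 < D := by positivity
  have hunif : UniformContinuousOn κ (Icc a b) :=
    isCompact_Icc.uniformContinuousOn_of_continuous
      (hκ.continuousOn.mono fun s hs => ⟨ha.trans_le hs.1, hs.2.trans_lt hb⟩)
  obtain ⟨δ₁, hδ₁, hδκ⟩ := Metric.uniformContinuousOn_iff.1 hunif (r / 4) (by positivity)
  set δ := min (δ₁ / 2) (min 1 (r / 8) / (C + 8 / a)) with hδ
  have hCa : 0 < C + 8 / a := by positivity
  refine ⟨δ, lt_min (by positivity) (div_pos (lt_min one_pos (by positivity)) hCa), ?_⟩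
  intro s hs s' hs' hss' ζ hζ hζre hwr
  obtain ⟨ε₀, hε₀, γ₀, hγ₀, rfl⟩ := hζ
  have hs0 : 0 < s := ha.trans_le hs.1
  have hs1 : s < 1 := hs.2.trans_lt hb
  have hss : s ∈ Icc 0 s := ⟨hs0.le, le_rfl⟩
  rw [hγ₀.flow_eq hκ hε₀ hs1 hss] at hwr
  set L₀ := γ₀ s with hL₀
  have hre₀ : L₀.re ≤ 0 := (hγ₀.isClipSol hε₀).re_nonpos hκ hε₀ hs1
    (hγ₀.pow_le_one hε₀ hs0.le) ⟨le_rfl, hs0.le⟩ hζre s hss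
  have hH₀ : 0 < barrier s L₀ :=
    hε₀.trans_le ((mem_clipRegion_iff_le_barrier hs0 hre₀).1 (hγ₀.mem s hss))
  set ε := min ε₀ (min (1 - b ^ 2) (barrier s L₀ * Real.exp (-D))) with hε
  have hε0 : 0 < ε :=
    lt_min hε₀ (lt_min (one_sub_pow_pos hb0.le hb (by norm_num)) (by positivity))
  have hεb : b ^ 4 + ε * b ^ 2 ≤ 1 := by
    have : ε ≤ 1 - b ^ 2 := (min_le_right _ _).trans (min_le_left _ _)
    nlinarith [sq_nonneg b]
  obtain ⟨γ, hγ, hγ0⟩ := exists_isClipSol hκ hε0 hb hεb ⟨le_rfl, hb0.le⟩ (γ₀ 0)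
  have hεs : s ^ 4 + ε * s ^ 2 ≤ 1 := pow_le_one_of_le hε0 hεb ⟨hs0.le, hs.2⟩
  have heq : EqOn γ γ₀ (Icc 0 s) := (hγ.restrict hs.2).eqOn hκ hε0 hs1 hεs
    ((hγ₀.anti (min_le_left _ _)).isClipSol hε0) ⟨le_rfl, hs0.le⟩ hγ0
  have hγs : γ s = L₀ := heq hss
  have hre := hγ.re_nonpos hκ hε0 hb hεb ⟨le_rfl, hb0.le⟩ (by rwa [hγ0])
  have hmem₀ : L₀ ∈ clipRegion ε s := clipRegion_anti (min_le_left _ _) (hγ₀.mem s hss)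
  have hw₀ : ‖(s : ℂ) ^ 4 * (Complex.exp L₀ * κ s)⁻¹‖ ≤ 1 :=
    (norm_inner_mem hκ ⟨hs0, hs1⟩ hre₀ hH₀).2.le
  have hδ1 : δ ≤ δ₁ / 2 := min_le_left _ _
  have hδ2 : (C + 8 / a) * δ ≤ min 1 (r / 8) := by
    rw [mul_comm, ← le_div_iff₀ hCa]; exact min_le_right _ _
  -- near `L₀` the projected point stays away from the pole
  have haway : ∀ σ ∈ Icc s s', ∀ L : ℂ, ‖L - L₀‖ ≤ C * (σ - s) →
      r / 2 ≤ ‖1 - (σ : ℂ) ^ 4 * (Complex.exp (clip (clipHeight ε σ) L) * κ σ)⁻¹‖ := by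
    intro σ hσ L hL
    have hσ0 : 0 < σ := hs0.trans_le hσ.1
    have hσb : σ ≤ b := hσ.2.trans hs'.2
    have hσs : σ - s ≤ δ := by linarith [hσ.2]
    have hσs0 : 0 ≤ σ - s := by linarith [hσ.1]
    set L' := clip (clipHeight ε σ) L with hL'
    have hratio : Real.log (σ / s) ≤ δ / a := by
      have h1 : σ / s - 1 = (σ - s) / s := by field_simp
      have h2 : Real.log (σ / s) ≤ σ / s - 1 := Real.log_le_sub_one_of_pos (by positivity)
      have hδ0 : 0 ≤ δ := hσs0.trans hσs
      have h3 : (σ - s) / s ≤ δ / a := div_le_div₀ hδ0 hσs ha hs.1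
      linarith
    have hratio0 : 0 ≤ Real.log (σ / s) :=
      Real.log_nonneg (by rw [le_div_iff₀ hs0]; linarith [hσ.1])
    have hheight : clipHeight ε s - clipHeight ε σ ≤ 4 * Real.log (σ / s) := by
      have p1 := pow_add_mul_pow_pos hε0 hs0
      have p2 := pow_add_mul_pow_pos hε0 hσ0
      have h4 : (4 : ℝ) * Real.log (σ / s) = Real.log ((σ / s) ^ 4) := by
        rw [Real.log_pow]; norm_num
      rw [clipHeight, clipHeight, neg_sub_neg, ← Real.log_div p2.ne' p1.ne', h4]
      refine Real.log_le_log (by positivity) ?_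
      rw [div_pow, div_le_div_iff₀ p1 (by positivity)]
      have : s ^ 2 ≤ σ ^ 2 := pow_le_pow_left₀ hs0.le hσ.1 2
      have : ε * (s ^ 2 * σ ^ 2) * s ^ 2 ≤ ε * (s ^ 2 * σ ^ 2) * σ ^ 2 := by gcongr
      nlinarith
    have hheight' : clipHeight ε σ ≤ clipHeight ε s :=
      neg_le_neg (Real.log_le_log (pow_add_mul_pow_pos hε0 hs0)
        (pow_add_mul_pow_le hε0.le le_rfl hs0.le hσ.1))
    have hheight0 : 0 ≤ clipHeight ε σ :=
      clipHeight_nonneg hε0 hσ0 (pow_le_one_of_le hε0 hεb ⟨hσ0.le, hσb⟩)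
    have hLL : ‖L' - L₀‖ ≤ C * δ + 4 * (δ / a) := by
      have h1 := norm_clip_sub_clip_le (clipHeight ε σ) L L₀
      have h2 := norm_clip_sub_self_le hheight0 hheight' ((mem_clipRegion_iff hε0 hs0).1 hmem₀)
      have h3 := norm_sub_le_norm_sub_add_norm_sub L' (clip (clipHeight ε σ) L₀) L₀
      have h4 : C * (σ - s) ≤ C * δ := by gcongr
      linarith
    set θ : ℂ := ((4 * Real.log (σ / s) : ℝ) : ℂ) - (L' - L₀) with hθ
    have hθn : ‖θ‖ ≤ (C + 8 / a) * δ := by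
      refine (norm_sub_le _ _).trans ?_
      rw [Complex.norm_real, Real.norm_of_nonneg (by positivity)]
      calc _ ≤ 4 * (δ / a) + (C * δ + 4 * (δ / a)) := by linarith
        _ = _ := by ring
    have hθ1 : ‖θ‖ ≤ 1 := hθn.trans (hδ2.trans (min_le_left _ _))
    have hθr : ‖θ‖ ≤ r / 8 := hθn.trans (hδ2.trans (min_le_right _ _))
    have hκs : ‖κ s‖ = 1 := hκ.norm_eq s ⟨hs0, hs1⟩
    have hκσ : ‖κ σ‖ = 1 := hκ.norm_eq σ ⟨hσ0, hσb.trans_lt hb⟩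
    have hκs0 : κ s ≠ 0 := norm_ne_zero_iff.1 (by rw [hκs]; exact one_ne_zero)
    have hκσ0 : κ σ ≠ 0 := norm_ne_zero_iff.1 (by rw [hκσ]; exact one_ne_zero)
    have hk1 : ‖κ s / κ σ‖ = 1 := by rw [norm_div, hκs, hκσ, div_one]
    have hk2 : ‖κ s / κ σ - 1‖ ≤ r / 4 := by
      rw [div_sub_one hκσ0, norm_div, hκσ, div_one, ← dist_eq_norm]
      refine (hδκ s hs σ ⟨hs.1.trans hσ.1, hσb⟩ ?_).le
      rw [dist_comm, Real.dist_eq, abs_of_nonneg hσs0]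
      linarith
    have hexpθ : Complex.exp θ = (σ / s) ^ 4 * (Complex.exp L₀ / Complex.exp L') := by
      rw [hθ, Complex.exp_sub, Complex.exp_sub, ← Complex.ofReal_exp, mul_comm (4 : ℝ),
        Real.exp_mul, Real.exp_log (by positivity)]
      rw [div_div_eq_mul_div, mul_div_assoc]
      norm_cast
    have hww : (σ : ℂ) ^ 4 * (Complex.exp L' * κ σ)⁻¹ =
        s ^ 4 * (Complex.exp L₀ * κ s)⁻¹ * (Complex.exp θ * (κ s / κ σ)) := by
      have hsc : (s : ℂ) ≠ 0 := by exact_mod_cast hs0.ne'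
      have := Complex.exp_ne_zero L₀
      have := Complex.exp_ne_zero L'
      rw [hexpθ]
      field_simp
    have hdiff : ‖(σ : ℂ) ^ 4 * (Complex.exp L' * κ σ)⁻¹ -
        s ^ 4 * (Complex.exp L₀ * κ s)⁻¹‖ ≤ r / 2 := by
      have h1 : Complex.exp θ * (κ s / κ σ) - 1 =
          (Complex.exp θ - 1) * (κ s / κ σ) + (κ s / κ σ - 1) := by ring
      have h2 := Complex.norm_exp_sub_one_le hθ1
      rw [hww, ← mul_sub_one, norm_mul]
      calc _ ≤ 1 * (r / 2) := by
            refine mul_le_mul hw₀ ?_ (norm_nonneg _) zero_le_one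
            rw [h1]
            refine (norm_add_le _ _).trans ?_
            rw [norm_mul, hk1, mul_one]
            linarith
        _ = _ := one_mul _
    have := norm_sub_le_norm_sub_add_norm_sub (1 : ℂ)
      ((σ : ℂ) ^ 4 * (Complex.exp L' * κ σ)⁻¹) (s ^ 4 * (Complex.exp L₀ * κ s)⁻¹)
    linarith
  -- hence the solution cannot move fast
  have hspeed : ∀ σ ∈ Icc s s', ‖γ σ - L₀‖ ≤ C * (σ - s) := by
    have hsub : Icc s s' ⊆ Icc 0 b := fun σ hσ => ⟨hs0.le.trans hσ.1, hσ.2.trans hs'.2⟩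
    intro σ hσ
    refine image_norm_le_of_norm_deriv_right_lt_deriv_boundary (f := fun σ => γ σ - L₀)
      (f' := fun σ => clipField κ ε σ (γ σ)) (B := fun σ => C * (σ - s)) (B' := fun _ => C)
      ((hγ.continuousOn.mono hsub).sub continuousOn_const) (fun x hx => ?_) (by simp [hγs])
      (fun x => by simpa using ((hasDerivAt_id' x).sub_const s).const_mul C)
      (fun x hx heq => ?_) hσ
    · exact ((hγ x (hsub ⟨hx.1, hx.2.le⟩)).mono_of_mem_nhdsWithin (mem_of_superset
        (Icc_mem_nhdsGE_of_mem hx) hsub)).sub_const L₀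
    · have hx' : x ∈ Icc s s' := ⟨hx.1, hx.2.le⟩
      have hxb := hsub hx'
      have hpow := pow_le_one_of_le hε0 hεb hxb
      have hx0 : 0 < x := hs0.trans_le hx.1
      have hcre : (clip (clipHeight ε x) (γ x)).re ≤ 0 :=
        max_le (neg_nonpos.2 (clipHeight_nonneg hε0 hx0 hpow)) ((min_le_left _ _).trans (hre x hxb))
      have := norm_field_le_of_away hκ ha (by positivity) (hs.1.trans hx.1) hxb.2 hb hcre hε0
        (clip_mem_clipRegion hε0 hx0.le hpow (γ x)) (haway x hx' (γ x) heq.le)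
      rw [clipField]
      change _ < C
      rw [hC]
      linarith
  -- and the barrier keeps it in the region where the projection is trivial
  refine ⟨ε, hε0, γ, ?_, hγ0⟩
  refine (hγ.restrict hs'.2).isTraj hε0 fun σ hσ => ?_
  rcases le_total σ s with hσs | hσs
  · rw [heq ⟨hσ.1, hσs⟩]
    exact clipRegion_anti (min_le_left _ _) (hγ₀.mem σ ⟨hσ.1, hσs⟩)
  have hsub : Icc s s' ⊆ Icc 0 b := fun σ hσ => ⟨hs0.le.trans hσ.1, hσ.2.trans hs'.2⟩
  have hlevel : ∀ σ ∈ Icc s s', ε ≤ barrier s L₀ * Real.exp (-D * (σ - s)) := fun σ hσ => by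
    refine (min_le_right _ _).trans ((min_le_right _ _).trans ?_)
    gcongr
    have : σ - s ≤ 1 := by linarith [(hsub hσ).2]
    nlinarith
  have hσ' : σ ∈ Icc s s' := ⟨hσs, hσ.2⟩
  rw [mem_clipRegion_iff_le_barrier (hs0.trans_le hσs) (hre σ (hsub hσ'))]
  refine (hlevel σ hσ').trans (mul_exp_le_of_fence (H := fun σ => barrier σ (γ σ)) (b := s')
    (fun x hx => (hasDerivWithinAt_barrier (hs0.trans_le hx.1).ne' (hγ x (hsub hx))).mono hsub)
    (by rw [hγs]) ?_ σ hσ')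
  intro x hx hxeq
  have hx' : x ∈ Icc s s' := ⟨hx.1, hx.2.le⟩
  have hx0 : 0 < x := hs0.trans_le hx.1
  have hεH : ε ≤ barrier x (γ x) := (hlevel x hx').trans hxeq.symm.le
  have hmem := (mem_clipRegion_iff_le_barrier hx0 (hre x (hsub hx'))).2 hεH
  have hclip := clip_eq_self ((mem_clipRegion_iff hε0 hx0).1 hmem)
  have haw := haway x hx' (γ x) (hspeed x hx')
  rw [hclip] at haw
  rw [clipField_eq_field hε0 hx0.le hmem]
  refine lt_of_lt_of_le ?_ (le_barrier_deriv hκ ha (by positivity) (hs.1.trans hx.1) (hsub hx').2 hb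
    (hre x (hsub hx')) (hε0.trans_le hεH) haw)
  have : 0 < barrier x (γ x) := hε0.trans_le hεH
  rw [hD]
  linarith

/-! ### The flow as a conformal bijection -/

/-- A right inverse of an injective holomorphic function with nonvanishing derivative is
holomorphic. -/
lemma hasDerivAt_of_rightInverse {f g : ℂ → ℂ} {U : Set ℂ} (hU : IsOpen U)
    (hf : DifferentiableOn ℂ f U) (hinj : InjOn f U)
    (hg : ∀ w ∈ f '' U, g w ∈ U ∧ f (g w) = w) {z : ℂ} (hz : z ∈ U) (hJ : deriv f z ≠ 0) :
    HasDerivAt g (deriv f z)⁻¹ (f z) := by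
  have hst : HasStrictDerivAt f (deriv f z) z :=
    (hf.analyticAt (hU.mem_nhds hz)).hasStrictDerivAt
  refine (hst.to_localInverse hJ).hasDerivAt.congr_of_eventuallyEq ?_
  have hcont : ContinuousAt (hst.localInverse f (deriv f z) z hJ) (f z) :=
    (hst.to_localInverse hJ).hasDerivAt.continuousAt
  have hfz : hst.localInverse f (deriv f z) z hJ (f z) = z :=
    (hst.hasStrictFDerivAt_equiv hJ).localInverse_apply_image
  have hev : ∀ᶠ w in 𝓝 (f z), hst.localInverse f (deriv f z) z hJ w ∈ U :=
    hcont.eventually_mem (by rw [hfz]; exact hU.mem_nhds hz)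
  have hri : ∀ᶠ w in 𝓝 (f z), f (hst.localInverse f (deriv f z) z hJ w) = w :=
    (hst.hasStrictFDerivAt_equiv hJ).eventually_right_inverse
  filter_upwards [hev, hri] with w h1 h2
  obtain ⟨h3, h4⟩ := hg w ⟨_, h1, h2⟩
  exact hinj h3 h1 (h4.trans h2.symm)

/-- The domain `|Re L| < -4 log σ` of the field at the time `σ`. -/
def flowStrip (σ : ℝ) : Set ℂ := {L | σ ^ 4 * Real.exp |L.re| < 1}

lemma mem_flowStrip_iff (hσ : 0 < σ) {L : ℂ} : L ∈ flowStrip σ ↔ |L.re| < -4 * Real.log σ := by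
  have h : -4 * Real.log σ = Real.log (σ ^ 4)⁻¹ := by
    rw [Real.log_inv, Real.log_pow]; push_cast; ring
  rw [flowStrip, mem_ofPred_eq, h, Real.lt_log_iff_exp_lt (by positivity), ← one_div,
    lt_div_iff₀ (by positivity), mul_comm]

lemma clipRegion_subset_flowStrip (hε : 0 < ε) (hσ : 0 < σ) : clipRegion ε σ ⊆ flowStrip σ := by
  intro L hL
  refine lt_of_lt_of_le ?_ (show (σ ^ 4 + ε * σ ^ 2) * Real.exp |L.re| ≤ 1 from hL)
  have : 0 < ε * σ ^ 2 := by positivity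
  gcongr
  linarith

lemma flow_mem_flowStrip (hκ : IsDriving κ) (hb0 : 0 < b) (hb : b < 1) {ζ : ℂ}
    (hζ : ζ ∈ aliveSet κ b) : flow κ b ζ ∈ flowStrip b := by
  obtain ⟨ε, hε, γ, hγ, rfl⟩ := hζ
  rw [hγ.flow_eq hκ hε hb ⟨hb0.le, le_rfl⟩]
  exact clipRegion_subset_flowStrip hε hb0 (hγ.mem b ⟨hb0.le, le_rfl⟩)

lemma exists_flow_eq (hκ : IsDriving κ) (hb0 : 0 < b) (hb : b < 1) {L : ℂ}
    (hL : L ∈ flowStrip b) : ∃ ζ ∈ aliveSet κ b, flow κ b ζ = L := by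
  obtain ⟨ε, hε, γ, hγ, hγb⟩ := exists_isTraj_eq hκ hb0 hb hL
  exact ⟨γ 0, hγ.mem_aliveSet hε le_rfl, by rw [hγ.flow_eq hκ hε hb ⟨hb0.le, le_rfl⟩, hγb]⟩

lemma injOn_flow (hκ : IsDriving κ) (hb0 : 0 < b) (hb : b < 1) :
    InjOn (flow κ b) (aliveSet κ b) := by
  rintro _ ⟨ε, hε, γ, hγ, rfl⟩ _ ⟨ε', hε', γ', hγ', rfl⟩ h
  have hbb : b ∈ Icc 0 b := ⟨hb0.le, le_rfl⟩
  rw [hγ.flow_eq hκ hε hb hbb, hγ'.flow_eq hκ hε' hb hbb] at h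
  exact hγ.eqOn hκ hε hε' hb hγ' hbb h ⟨le_rfl, hb0.le⟩

lemma image_flow (hκ : IsDriving κ) (hb0 : 0 < b) (hb : b < 1) :
    flow κ b '' aliveSet κ b = flowStrip b := by
  ext L
  constructor
  · rintro ⟨ζ, hζ, rfl⟩; exact flow_mem_flowStrip hκ hb0 hb hζ
  · exact fun hL => exists_flow_eq hκ hb0 hb hL

lemma differentiableOn_flow (hκ : IsDriving κ) (hb0 : 0 ≤ b) (hb : b < 1) :
    DifferentiableOn ℂ (flow κ b) (aliveSet κ b) := fun _ hζ =>
  (exists_hasDerivAt_of_mem_aliveSet hκ hb0 hb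
    hζ).choose_spec.differentiableAt.differentiableWithinAt

/-- The derivative does not vanish because the inverse of the flow is locally Lipschitz. -/
lemma deriv_flow_ne_zero (hκ : IsDriving κ) (hb0 : 0 < b) (hb : b < 1) {ζ : ℂ}
    (hζ : ζ ∈ aliveSet κ b) : deriv (flow κ b) ζ ≠ 0 := by
  intro hJ0
  have hd : HasDerivAt (flow κ b) 0 ζ := by
    obtain ⟨J, hJ⟩ := exists_hasDerivAt_of_mem_aliveSet hκ hb0.le hb hζ
    rwa [hJ.deriv.symm.trans hJ0] at hJ
  have hopen := (isOpen_aliveSet (κ := κ) hκ hb0.le hb).mem_nhds hζ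
  obtain ⟨ε, hε, γ, hγ, rfl⟩ := hζ
  have hbb : b ∈ Icc 0 b := ⟨hb0.le, le_rfl⟩
  have h00 : (0 : ℝ) ∈ Icc 0 b := ⟨le_rfl, hb0.le⟩
  -- the inverse of the flow is Lipschitz near `γ b`
  obtain ⟨α, C, r, hC, hr, hα⟩ := hγ.exists_near hκ hε hb hbb
  have hfl : flow κ b (γ 0) = γ b := hγ.flow_eq hκ hε hb hbb
  have hball : ∀ᶠ x in 𝓝 (γ 0), flow κ b x ∈ Metric.ball (γ b) r :=
    hd.continuousAt.eventually_mem (by rw [hfl]; exact Metric.ball_mem_nhds _ hr)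
  have hlip : ∀ᶠ x in 𝓝 (γ 0), ‖x - γ 0‖ ≤ C * ‖flow κ b x - flow κ b (γ 0)‖ := by
    filter_upwards [hball, hopen] with x hx hxa
    obtain ⟨h1, h2, h3⟩ := hα _ hx
    have hx0 : α (flow κ b x) 0 = x := by
      refine injOn_flow hκ hb0 hb (h2.mem_aliveSet (by positivity) le_rfl) hxa ?_
      rw [h2.flow_eq hκ (by positivity) hb hbb, h1]
    have := h3 0 h00
    rwa [hx0, ← hfl] at this
  rw [hasDerivAt_iff_isLittleO] at hd
  simp only [smul_zero, sub_zero] at hd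
  have h1 := hd.def (c := 1 / (2 * (C + 1))) (by positivity)
  have hself : ∀ᶠ x in 𝓝[≠] γ 0, False := by
    filter_upwards [hlip.filter_mono nhdsWithin_le_nhds, h1.filter_mono nhdsWithin_le_nhds,
      self_mem_nhdsWithin] with x h2 h3 hne
    have hpos : 0 < ‖x - γ 0‖ := norm_pos_iff.2 (sub_ne_zero.2 hne)
    rw [one_div, inv_mul_eq_div, le_div_iff₀ (by positivity)] at h3
    nlinarith [norm_nonneg (flow κ b x - flow κ b (γ 0))]
  exact hself.exists.elim fun _ h => h

lemma zero_re_mem_aliveSet (hκ : IsDriving κ) (hb0 : 0 ≤ b) (hb : b < 1) {ζ : ℂ} (hζ : ζ.re = 0) :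
    ζ ∈ aliveSet κ b := by
  have hε : 0 < 1 - b ^ 2 := one_sub_pow_pos hb0 hb (by norm_num)
  have hεb : b ^ 4 + (1 - b ^ 2) * b ^ 2 ≤ 1 := by nlinarith
  have h0 : (0 : ℝ) ∈ Icc 0 b := ⟨le_rfl, hb0⟩
  obtain ⟨γ, hγ, hγ0⟩ := exists_isClipSol hκ hε hb hεb h0 ζ
  exact ⟨_, hε, γ, hγ.isTraj_of_re_eq_zero hκ hε hb hεb h0 (by rwa [hγ0]), hγ0⟩

lemma flow_re_eq_zero (hκ : IsDriving κ) (hb0 : 0 ≤ b) (hb : b < 1) {ζ : ℂ}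
    (hζ : ζ ∈ aliveSet κ b) (h : ζ.re = 0) : (flow κ b ζ).re = 0 := by
  obtain ⟨ε, hε, γ, hγ, rfl⟩ := hζ
  rw [hγ.flow_eq hκ hε hb ⟨hb0, le_rfl⟩]
  exact (hγ.isClipSol hε).re_eq_zero hκ hε hb (hγ.pow_le_one hε hb0) ⟨le_rfl, hb0⟩ h _ ⟨hb0, le_rfl⟩

lemma flow_re_neg (hκ : IsDriving κ) (hb0 : 0 ≤ b) (hb : b < 1) {ζ : ℂ}
    (hζ : ζ ∈ aliveSet κ b) (h : ζ.re < 0) : (flow κ b ζ).re < 0 := by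
  obtain ⟨ε, hε, γ, hγ, rfl⟩ := hζ
  rw [hγ.flow_eq hκ hε hb ⟨hb0, le_rfl⟩]
  exact (hγ.isClipSol hε).re_neg hκ hε hb (hγ.pow_le_one hε hb0) ⟨le_rfl, hb0⟩ h _ ⟨hb0, le_rfl⟩

lemma neg_conj_mem_aliveSet (hκ : IsDriving κ) (hb : b < 1) {ζ : ℂ} (hζ : ζ ∈ aliveSet κ b) :
    -(starRingEnd ℂ) ζ ∈ aliveSet κ b := by
  obtain ⟨ε, hε, γ, hγ, rfl⟩ := hζ
  exact ⟨ε, hε, _, hγ.neg_conj hκ hb, rfl⟩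

lemma flow_neg_conj (hκ : IsDriving κ) (hb0 : 0 ≤ b) (hb : b < 1) {ζ : ℂ} (hζ : ζ ∈ aliveSet κ b) :
    flow κ b (-(starRingEnd ℂ) ζ) = -(starRingEnd ℂ) (flow κ b ζ) := by
  obtain ⟨ε, hε, γ, hγ, rfl⟩ := hζ
  rw [hγ.flow_eq hκ hε hb ⟨hb0, le_rfl⟩]
  exact (hγ.neg_conj hκ hb).flow_eq hκ hε hb ⟨hb0, le_rfl⟩

lemma flow_re_pos (hκ : IsDriving κ) (hb0 : 0 ≤ b) (hb : b < 1) {ζ : ℂ}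
    (hζ : ζ ∈ aliveSet κ b) (h : 0 < ζ.re) : 0 < (flow κ b ζ).re := by
  have := flow_re_neg hκ hb0 hb (neg_conj_mem_aliveSet hκ hb hζ) (by simpa using h)
  rw [flow_neg_conj hκ hb0 hb hζ] at this
  simpa using this

lemma add_period_mem_aliveSet {ζ : ℂ} (hζ : ζ ∈ aliveSet κ b) (n : ℤ) :
    ζ + n * (2 * Real.pi * Complex.I) ∈ aliveSet κ b := by
  obtain ⟨ε, hε, γ, hγ, rfl⟩ := hζ
  exact ⟨ε, hε, _, hγ.add_period n, rfl⟩

lemma flow_add_period (hκ : IsDriving κ) (hb0 : 0 ≤ b) (hb : b < 1) {ζ : ℂ}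
    (hζ : ζ ∈ aliveSet κ b) (n : ℤ) :
    flow κ b (ζ + n * (2 * Real.pi * Complex.I)) = flow κ b ζ + n * (2 * Real.pi * Complex.I) := by
  obtain ⟨ε, hε, γ, hγ, rfl⟩ := hζ
  rw [hγ.flow_eq hκ hε hb ⟨hb0, le_rfl⟩]
  exact (hγ.add_period n).flow_eq hκ hε hb ⟨hb0, le_rfl⟩

/-- For every `x`, a function which is holomorphic and `2πi`-periodic in a strip has the same mean
over the vertical segments of length `2π`. -/
lemma integral_vertical_eq {h : ℂ → ℂ} {S : Set ℂ} {x₀ : ℝ} (hd : DifferentiableOn ℂ h S)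
    (hper : ∀ L ∈ S, h (L + 2 * Real.pi * Complex.I) = h L)
    (hS : ∀ x ∈ Icc (-x₀) 0, ∀ y : ℝ, (x : ℂ) + y * Complex.I ∈ S) (hx₀ : 0 ≤ x₀) :
    ∫ y in (0 : ℝ)..(2 * Real.pi), h (((-x₀ : ℝ) : ℂ) + y * Complex.I) =
      ∫ y in (0 : ℝ)..(2 * Real.pi), h (((0 : ℝ) : ℂ) + y * Complex.I) := by
  have hrect := Complex.integral_boundary_rect_eq_zero_of_differentiableOn h
    ((-x₀ : ℝ) : ℂ) (2 * Real.pi * Complex.I) (hd.mono fun L hL => by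
      rw [Complex.mem_reProdIm] at hL
      have h1 := hL.1
      simp only [Complex.ofReal_re, Complex.mul_re, Complex.re_ofNat, Complex.im_ofNat,
        Complex.I_re, mul_zero, Complex.ofReal_im, Complex.mul_im, Complex.I_im, mul_one,
        zero_mul, sub_zero, add_zero, sub_self] at h1
      rw [uIcc_of_le (by linarith)] at h1
      have := hS L.re h1 L.im
      rwa [Complex.re_add_im] at this)
  have e1 : ((-x₀ : ℝ) : ℂ).re = -x₀ := Complex.ofReal_re _
  have e2 : ((-x₀ : ℝ) : ℂ).im = 0 := Complex.ofReal_im _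
  have e3 : (2 * Real.pi * Complex.I : ℂ).re = 0 := by simp
  have e4 : (2 * Real.pi * Complex.I : ℂ).im = 2 * Real.pi := by simp
  rw [e1, e2, e3, e4] at hrect
  have hh : ∫ x in (-x₀)..0, h ((x : ℂ) + ((2 * Real.pi : ℝ) : ℂ) * Complex.I) =
      ∫ x in (-x₀)..0, h ((x : ℂ) + ((0 : ℝ) : ℂ) * Complex.I) := by
    refine intervalIntegral.integral_congr fun x hx => ?_
    rw [uIcc_of_le (by linarith)] at hx
    have h1 := hper _ (hS x hx 0)
    simp only [Complex.ofReal_zero, zero_mul, add_zero] at h1 ⊢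
    rw [← h1]
    push_cast
    rfl
  rw [hh, sub_self, zero_add, ← smul_sub, smul_eq_zero, sub_eq_zero] at hrect
  exact (hrect.resolve_left Complex.I_ne_zero).symm

/-- The hulls grow strictly: between two times some point of the disc dies. Otherwise the
transition map, in logarithmic coordinates, would be a holomorphic map `L ↦ L + h L` from the strip
at the first time into the smaller strip at the second one; but the mean of `Re h` over vertical
segments is constant, equal to zero on the imaginary axis and positive near the boundary. -/
lemma exists_alive_not_alive (hκ : IsDriving κ) {s t : ℝ} (hs : 0 < s) (hst : s < t) (ht : t < 1) :
    ∃ ζ : ℂ, ζ.re < 0 ∧ ζ ∈ aliveSet κ s ∧ ζ ∉ aliveSet κ t := by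
  by_contra! hcon
  have ht0 := hs.trans hst
  have hs1 := hst.trans ht
  have hall : ∀ ζ ∈ aliveSet κ s, ζ ∈ aliveSet κ t := by
    intro ζ hζ
    rcases lt_trichotomy ζ.re 0 with h | h | h
    · exact hcon ζ h hζ
    · exact zero_re_mem_aliveSet hκ ht0.le ht h
    · have := neg_conj_mem_aliveSet hκ ht (hcon _ (by simpa using h)
        (neg_conj_mem_aliveSet hκ hs1 hζ))
      simpa using this
  choose! g hg using fun L (hL : L ∈ flowStrip s) => exists_flow_eq hκ hs hs1 hL
  have hgd : DifferentiableOn ℂ g (flowStrip s) := by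
    intro L hL
    obtain ⟨h1, h2⟩ := hg L hL
    have := hasDerivAt_of_rightInverse (g := g) (isOpen_aliveSet hκ hs.le hs1)
      (differentiableOn_flow hκ hs.le hs1) (injOn_flow hκ hs hs1)
      (by rw [image_flow hκ hs hs1]; exact hg) h1 (deriv_flow_ne_zero hκ hs hs1 h1)
    rw [h2] at this
    exact this.differentiableAt.differentiableWithinAt
  have hgper : ∀ L ∈ flowStrip s, g (L + 2 * Real.pi * Complex.I) =
      g L + 2 * Real.pi * Complex.I := by
    intro L hL
    have hL' : L + 2 * Real.pi * Complex.I ∈ flowStrip s := by simpa [flowStrip] using hL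
    obtain ⟨h1, h2⟩ := hg L hL
    obtain ⟨h3, h4⟩ := hg _ hL'
    have h5 := flow_add_period hκ hs.le hs1 h1 1
    have h6 := add_period_mem_aliveSet h1 1
    rw [Int.cast_one, one_mul] at h5 h6
    exact injOn_flow hκ hs hs1 h3 h6 (by rw [h4, h5, h2])
  set h : ℂ → ℂ := fun L => flow κ t (g L) - L with hh
  have hhd : DifferentiableOn ℂ h (flowStrip s) :=
    ((differentiableOn_flow hκ ht0.le ht).comp hgd fun L hL => hall _ (hg L hL).1).sub
      differentiableOn_id
  have hhper : ∀ L ∈ flowStrip s, h (L + 2 * Real.pi * Complex.I) = h L := by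
    intro L hL
    have h5 := flow_add_period hκ ht0.le ht (hall _ (hg L hL).1) 1
    rw [Int.cast_one, one_mul] at h5
    simp only [hh]
    rw [hgper L hL, h5]
    ring
  have hlog : -4 * Real.log t < -4 * Real.log s := by linarith [Real.log_lt_log hs hst]
  obtain ⟨x₀, hx1, hx2⟩ := exists_between hlog
  have hx₀ : 0 ≤ x₀ := by linarith [Real.log_neg ht0 ht]
  have hS : ∀ x ∈ Icc (-x₀) 0, ∀ y : ℝ, (x : ℂ) + y * Complex.I ∈ flowStrip s := by
    intro x hx y
    rw [mem_flowStrip_iff hs]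
    simp only [Complex.add_re, Complex.ofReal_re, Complex.re_ofReal_mul, Complex.I_re, mul_zero,
      add_zero]
    rw [abs_of_nonpos hx.2]
    linarith [hx.1]
  have hcont : ∀ x ∈ Icc (-x₀) 0, Continuous fun y : ℝ => h ((x : ℂ) + y * Complex.I) := by
    intro x hx
    exact hhd.continuousOn.comp_continuous (by fun_prop) fun y => hS x hx y
  have hmean := congrArg Complex.re (integral_vertical_eq hhd hhper hS hx₀)
  have hre : ∀ x ∈ Icc (-x₀) 0, (∫ y in (0 : ℝ)..(2 * Real.pi), h ((x : ℂ) + y * Complex.I)).re =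
      ∫ y in (0 : ℝ)..(2 * Real.pi), (h ((x : ℂ) + y * Complex.I)).re := fun x hx =>
    (Complex.reCLM.intervalIntegral_comp_comm ((hcont x hx).intervalIntegrable _ _)).symm
  rw [hre (-x₀) ⟨le_rfl, by linarith⟩, hre 0 ⟨by linarith, le_rfl⟩] at hmean
  have hzero : ∀ y : ℝ, (h (((0 : ℝ) : ℂ) + y * Complex.I)).re = 0 := by
    intro y
    obtain ⟨h1, h2⟩ := hg _ (hS 0 ⟨by linarith, le_rfl⟩ y)
    set L : ℂ := ((0 : ℝ) : ℂ) + y * Complex.I with hL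
    have hLre : L.re = 0 := by simp [hL]
    have hgre : (g L).re = 0 := by
      rcases lt_trichotomy (g L).re 0 with h | h | h
      · have := flow_re_neg hκ hs.le hs1 h1 h
        rw [h2, hLre] at this; exact absurd this (lt_irrefl _)
      · exact h
      · have := flow_re_pos hκ hs.le hs1 h1 h
        rw [h2, hLre] at this; exact absurd this (lt_irrefl _)
    have := flow_re_eq_zero hκ ht0.le ht (hall _ h1) hgre
    simp only [hh, Complex.sub_re, this, hLre, sub_zero]
  have hpos : ∀ y : ℝ, 0 < (h (((-x₀ : ℝ) : ℂ) + y * Complex.I)).re := by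
    intro y
    obtain ⟨h1, h2⟩ := hg _ (hS (-x₀) ⟨le_rfl, by linarith⟩ y)
    have h3 := (mem_flowStrip_iff ht0).1 (flow_mem_flowStrip hκ ht0 ht (hall _ h1))
    have h4 := neg_abs_le (flow κ t (g (((-x₀ : ℝ) : ℂ) + y * Complex.I))).re
    simp only [hh, Complex.sub_re, Complex.add_re, Complex.ofReal_re, Complex.re_ofReal_mul,
      Complex.I_re, mul_zero, add_zero]
    linarith
  have hint : 0 < ∫ y in (0 : ℝ)..(2 * Real.pi), (h (((-x₀ : ℝ) : ℂ) + y * Complex.I)).re :=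
    intervalIntegral.intervalIntegral_pos_of_pos
      ((Complex.continuous_re.comp (hcont (-x₀) ⟨le_rfl, by linarith⟩)).intervalIntegrable _ _)
      hpos (by positivity)
  rw [hmean] at hint
  simp only [hzero, intervalIntegral.integral_zero, lt_irrefl] at hint

/-! ### The conformal maps in the disc -/

/-- The nonzero points which are not swallowed up to the time `b`; the reflection in the unit
circle preserves this set, and `aliveDomain κ b ∩ disc` is the complement of the hull. -/
def aliveDomain (κ : ℝ → ℂ) (b : ℝ) : Set ℂ := Complex.exp '' aliveSet κ b

/-- The conformal map `e^t / g_t` at the time `b = e^{t/4}`. -/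
noncomputable def discMap (κ : ℝ → ℂ) (b : ℝ) (z : ℂ) : ℂ :=
  Complex.exp (flow κ b (Complex.log z))

/-- The annulus `{b⁴ < |w| < b⁻⁴}`. -/
def doubleAnnulus (b : ℝ) : Set ℂ := {w | b ^ 4 < ‖w‖ ∧ b ^ 4 * ‖w‖ < 1}

lemma exp_mem_aliveDomain_iff {ζ : ℂ} : Complex.exp ζ ∈ aliveDomain κ b ↔ ζ ∈ aliveSet κ b := by
  constructor
  · rintro ⟨ζ', h, h'⟩
    obtain ⟨n, rfl⟩ := Complex.exp_eq_exp_iff_exists_int.1 h'.symm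
    exact add_period_mem_aliveSet h n
  · exact fun h => ⟨ζ, h, rfl⟩

lemma ne_zero_of_mem_aliveDomain {z : ℂ} (hz : z ∈ aliveDomain κ b) : z ≠ 0 := by
  obtain ⟨ζ, -, rfl⟩ := hz
  exact Complex.exp_ne_zero ζ

lemma discMap_exp (hκ : IsDriving κ) (hb0 : 0 ≤ b) (hb : b < 1) {ζ : ℂ} (hζ : ζ ∈ aliveSet κ b) :
    discMap κ b (Complex.exp ζ) = Complex.exp (flow κ b ζ) := by
  obtain ⟨n, hn⟩ := Complex.exp_eq_exp_iff_exists_int.1 (Complex.exp_log (Complex.exp_ne_zero ζ))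
  rw [discMap, hn, flow_add_period hκ hb0 hb hζ, Complex.exp_add, Complex.exp_int_mul_two_pi_mul_I,
    mul_one]

lemma aliveDomain_anti {b' : ℝ} (h : b' ≤ b) : aliveDomain κ b ⊆ aliveDomain κ b' :=
  image_mono (aliveSet_anti h)

lemma isOpen_aliveDomain (hκ : IsDriving κ) (hb0 : 0 ≤ b) (hb : b < 1) : IsOpen (aliveDomain κ b) :=
  Complex.isOpenMap_exp _ (isOpen_aliveSet hκ hb0 hb)

lemma discMap_ne_zero (κ : ℝ → ℂ) (b : ℝ) (z : ℂ) : discMap κ b z ≠ 0 := Complex.exp_ne_zero _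

lemma exists_hasDerivAt_discMap (hκ : IsDriving κ) (hb0 : 0 < b) (hb : b < 1) {z : ℂ}
    (hz : z ∈ aliveDomain κ b) : ∃ J ≠ 0, HasDerivAt (discMap κ b) J z := by
  obtain ⟨ζ, hζ, rfl⟩ := hz
  have hne := Complex.exp_ne_zero ζ
  -- a branch of the logarithm near `exp ζ`
  have hℓ : HasDerivAt (fun w => Complex.log (w / Complex.exp ζ) + ζ) (Complex.exp ζ)⁻¹
      (Complex.exp ζ) := by
    have h1 : HasDerivAt (fun w => w / Complex.exp ζ) (1 / Complex.exp ζ) (Complex.exp ζ) :=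
      (hasDerivAt_id' _).div_const _
    have := (h1.clog (by simp [hne])).add_const ζ
    simpa [hne] using this
  have hℓζ : Complex.log (Complex.exp ζ / Complex.exp ζ) + ζ = ζ := by simp [hne]
  obtain ⟨J, hJ⟩ := exists_hasDerivAt_of_mem_aliveSet hκ hb0.le hb hζ
  have hJ0 : J ≠ 0 := by rw [← hJ.deriv]; exact deriv_flow_ne_zero hκ hb0 hb hζ
  rw [← hℓζ] at hJ
  have hcomp := (hJ.comp (Complex.exp ζ) hℓ).cexp
  refine ⟨_, ?_, hcomp.congr_of_eventuallyEq ?_⟩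
  · exact mul_ne_zero (Complex.exp_ne_zero _) (mul_ne_zero hJ0 (inv_ne_zero hne))
  · have h1 : ∀ᶠ w in 𝓝 (Complex.exp ζ), Complex.log (w / Complex.exp ζ) + ζ ∈ aliveSet κ b :=
      hℓ.continuousAt.eventually_mem
        (by rw [hℓζ]; exact (isOpen_aliveSet hκ hb0.le hb).mem_nhds hζ)
    filter_upwards [h1, isOpen_ne.mem_nhds hne] with w hw hw0
    have : Complex.exp (Complex.log (w / Complex.exp ζ) + ζ) = w := by
      rw [Complex.exp_add, Complex.exp_log (div_ne_zero hw0 hne), div_mul_cancel₀ _ hne]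
    conv_lhs => rw [← this]
    exact discMap_exp hκ hb0.le hb hw

lemma differentiableOn_discMap (hκ : IsDriving κ) (hb0 : 0 < b) (hb : b < 1) :
    DifferentiableOn ℂ (discMap κ b) (aliveDomain κ b) := fun _ hz =>
  (exists_hasDerivAt_discMap hκ hb0 hb hz).choose_spec.2.differentiableAt.differentiableWithinAt

lemma injOn_discMap (hκ : IsDriving κ) (hb0 : 0 < b) (hb : b < 1) :
    InjOn (discMap κ b) (aliveDomain κ b) := by
  rintro _ ⟨ζ, hζ, rfl⟩ _ ⟨ζ', hζ', rfl⟩ h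
  rw [discMap_exp hκ hb0.le hb hζ, discMap_exp hκ hb0.le hb hζ'] at h
  obtain ⟨n, hn⟩ := Complex.exp_eq_exp_iff_exists_int.1 h
  rw [← flow_add_period hκ hb0.le hb hζ'] at hn
  have := injOn_flow hκ hb0 hb hζ (add_period_mem_aliveSet hζ' n) hn
  rw [this, Complex.exp_add, Complex.exp_int_mul_two_pi_mul_I, mul_one]

lemma exp_mem_doubleAnnulus_iff (hb0 : 0 < b) {L : ℂ} :
    Complex.exp L ∈ doubleAnnulus b ↔ L ∈ flowStrip b := by
  rw [doubleAnnulus, mem_ofPred_eq, Complex.norm_exp, flowStrip, mem_ofPred_eq]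
  have h1 : b ^ 4 < Real.exp L.re ↔ b ^ 4 * Real.exp (-L.re) < 1 := by
    rw [Real.exp_neg, ← div_eq_mul_inv, div_lt_one (Real.exp_pos _)]
  rw [h1]
  rcases le_total L.re 0 with h | h
  · rw [abs_of_nonpos h, and_iff_left_iff_imp]
    refine fun h2 => lt_of_le_of_lt ?_ h2
    gcongr; linarith
  · rw [abs_of_nonneg h, and_iff_right_iff_imp]
    refine fun h2 => lt_of_le_of_lt ?_ h2
    gcongr; linarith

lemma discMap_mem (hκ : IsDriving κ) (hb0 : 0 < b) (hb : b < 1) {z : ℂ}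
    (hz : z ∈ aliveDomain κ b) : discMap κ b z ∈ doubleAnnulus b := by
  obtain ⟨ζ, hζ, rfl⟩ := hz
  rw [discMap_exp hκ hb0.le hb hζ, exp_mem_doubleAnnulus_iff hb0]
  exact flow_mem_flowStrip hκ hb0 hb hζ

lemma exists_discMap_eq (hκ : IsDriving κ) (hb0 : 0 < b) (hb : b < 1) {w : ℂ}
    (hw : w ∈ doubleAnnulus b) : ∃ z ∈ aliveDomain κ b, discMap κ b z = w := by
  have hw0 : w ≠ 0 := by
    rw [← norm_pos_iff]; exact (pow_pos hb0 4).trans hw.1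
  rw [← Complex.exp_log hw0, exp_mem_doubleAnnulus_iff hb0] at hw
  obtain ⟨ζ, hζ, h⟩ := exists_flow_eq hκ hb0 hb hw
  exact ⟨_, ⟨ζ, hζ, rfl⟩, by rw [discMap_exp hκ hb0.le hb hζ, h, Complex.exp_log hw0]⟩

lemma norm_discMap_lt_one_iff (hκ : IsDriving κ) (hb0 : 0 < b) (hb : b < 1) {z : ℂ}
    (hz : z ∈ aliveDomain κ b) : ‖discMap κ b z‖ < 1 ↔ ‖z‖ < 1 := by
  obtain ⟨ζ, hζ, rfl⟩ := hz
  rw [discMap_exp hκ hb0.le hb hζ, Complex.norm_exp, Complex.norm_exp, Real.exp_lt_one_iff,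
    Real.exp_lt_one_iff]
  refine ⟨fun h => ?_, flow_re_neg hκ hb0.le hb hζ⟩
  by_contra! hcon
  rcases hcon.eq_or_lt with h1 | h1
  · exact h.ne (flow_re_eq_zero hκ hb0.le hb hζ h1.symm)
  · exact h.not_gt (flow_re_pos hκ hb0.le hb hζ h1)

lemma norm_discMap_eq_one_iff (hκ : IsDriving κ) (hb0 : 0 < b) (hb : b < 1) {z : ℂ}
    (hz : z ∈ aliveDomain κ b) : ‖discMap κ b z‖ = 1 ↔ ‖z‖ = 1 := by
  obtain ⟨ζ, hζ, rfl⟩ := hz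
  rw [discMap_exp hκ hb0.le hb hζ, Complex.norm_exp, Complex.norm_exp, Real.exp_eq_one_iff,
    Real.exp_eq_one_iff]
  refine ⟨fun h => ?_, flow_re_eq_zero hκ hb0.le hb hζ⟩
  rcases lt_trichotomy ζ.re 0 with h1 | h1 | h1
  · exact absurd h (flow_re_neg hκ hb0.le hb hζ h1).ne
  · exact h1
  · exact absurd h (flow_re_pos hκ hb0.le hb hζ h1).ne'

lemma sphere_subset_aliveDomain (hκ : IsDriving κ) (hb0 : 0 ≤ b) (hb : b < 1) {z : ℂ}
    (hz : ‖z‖ = 1) : z ∈ aliveDomain κ b := by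
  have hz0 : z ≠ 0 := by rw [← norm_pos_iff, hz]; exact one_pos
  rw [← Complex.exp_log hz0, exp_mem_aliveDomain_iff]
  exact zero_re_mem_aliveSet hκ hb0 hb (by rw [Complex.log_re, hz, Real.log_one])

/-- The inverse of `discMap κ b`. -/
noncomputable def discInv (κ : ℝ → ℂ) (b : ℝ) : ℂ → ℂ :=
  Function.invFunOn (discMap κ b) (aliveDomain κ b)

lemma discInv_mem (hκ : IsDriving κ) (hb0 : 0 < b) (hb : b < 1) {w : ℂ}
    (hw : w ∈ doubleAnnulus b) : discInv κ b w ∈ aliveDomain κ b :=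
  Function.invFunOn_mem (exists_discMap_eq hκ hb0 hb hw)

lemma discMap_discInv (hκ : IsDriving κ) (hb0 : 0 < b) (hb : b < 1) {w : ℂ}
    (hw : w ∈ doubleAnnulus b) : discMap κ b (discInv κ b w) = w :=
  Function.invFunOn_eq (exists_discMap_eq hκ hb0 hb hw)

lemma discInv_discMap (hκ : IsDriving κ) (hb0 : 0 < b) (hb : b < 1) {z : ℂ}
    (hz : z ∈ aliveDomain κ b) : discInv κ b (discMap κ b z) = z :=
  injOn_discMap hκ hb0 hb (discInv_mem hκ hb0 hb (discMap_mem hκ hb0 hb hz)) hz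
    (discMap_discInv hκ hb0 hb (discMap_mem hκ hb0 hb hz))

lemma differentiableOn_discInv (hκ : IsDriving κ) (hb0 : 0 < b) (hb : b < 1) :
    DifferentiableOn ℂ (discInv κ b) (doubleAnnulus b) := by
  intro w hw
  have h1 := discInv_mem hκ hb0 hb hw
  obtain ⟨J, hJ0, hJ⟩ := exists_hasDerivAt_discMap hκ hb0 hb h1
  have := hasDerivAt_of_rightInverse (g := discInv κ b) (isOpen_aliveDomain hκ hb0.le hb)
    (differentiableOn_discMap hκ hb0 hb) (injOn_discMap hκ hb0 hb)
    (by
      rintro _ ⟨z, hz, rfl⟩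
      have := discMap_mem hκ hb0 hb hz
      exact ⟨discInv_mem hκ hb0 hb this, discMap_discInv hκ hb0 hb this⟩) h1 (by rwa [hJ.deriv])
  rw [discMap_discInv hκ hb0 hb hw] at this
  exact this.differentiableAt.differentiableWithinAt

/-! ### Topology of the hulls -/

/-- The intersection of a directed family of compact connected sets is connected. -/
lemma isConnected_iInter_of_directed {ι : Type*} [Nonempty ι] {Z : ι → Set ℂ}
    (hZ : Directed (· ⊇ ·) Z) (hc : ∀ i, IsCompact (Z i)) (hconn : ∀ i, IsConnected (Z i)) :
    IsConnected (⋂ i, Z i) := by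
  refine ⟨IsCompact.nonempty_iInter_of_directed_nonempty_isCompact_isClosed Z hZ
    (fun i => (hconn i).nonempty) hc fun i => (hc i).isClosed, ?_⟩
  rw [isPreconnected_closed_iff]
  intro t t' ht ht' hsub h1 h2
  by_contra hcon
  have hcomp : IsCompact (⋂ i, Z i) :=
    (hc (Classical.arbitrary ι)).of_isClosed_subset (isClosed_iInter fun i => (hc i).isClosed)
      (iInter_subset _ _)
  have hdisj : Disjoint ((⋂ i, Z i) ∩ t) ((⋂ i, Z i) ∩ t') := by
    rw [disjoint_iff_inter_eq_empty, ← inter_inter_distrib_left]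
    exact not_nonempty_iff_eq_empty.1 hcon
  obtain ⟨U, V, hU, hV, hAU, hBV, hUV⟩ :=
    SeparatedNhds.of_isCompact_isCompact (hcomp.inter_right ht) (hcomp.inter_right ht') hdisj
  obtain ⟨i, hi⟩ := exists_subset_nhds_of_isCompact hZ hc (U := U ∪ V) fun x hx => by
    refine (hU.union hV).mem_nhds ?_
    rcases hsub hx with h | h
    · exact Or.inl (hAU ⟨hx, h⟩)
    · exact Or.inr (hBV ⟨hx, h⟩)
  obtain ⟨x, hx⟩ := h1
  obtain ⟨y, hy⟩ := h2
  obtain ⟨z, -, hz⟩ := (hconn i).isPreconnected U V hU hV hi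
    ⟨x, mem_iInter.1 hx.1 i, hAU hx⟩ ⟨y, mem_iInter.1 hy.1 i, hBV hy⟩
  exact disjoint_left.1 hUV hz.1 hz.2

/-- A compact plane set with connected frontier is connected, because each piece of a separation
would have a nonempty frontier. -/
lemma isConnected_of_frontier {F : Set ℂ} (hF : IsCompact F) (h : IsConnected (frontier F)) :
    IsConnected F := by
  have hfF : frontier F ⊆ F := hF.isClosed.frontier_subset
  refine ⟨h.nonempty.mono hfF, ?_⟩
  -- a relatively clopen piece contains a point of the frontier
  have key : ∀ U V : Set ℂ, IsOpen U → IsOpen V → F ⊆ U ∪ V → F ∩ (U ∩ V) = ∅ → (F ∩ U).Nonempty →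
      (frontier F ∩ U).Nonempty := by
    intro U V hU hV hsub hdisj hne
    have hAeq : F ∩ U = F \ V := by
      ext x
      constructor
      · exact fun hx => ⟨hx.1, fun hxV => (hdisj ▸ ⟨hx.1, hx.2, hxV⟩ : x ∈ (∅ : Set ℂ))⟩
      · exact fun hx => ⟨hx.1, (hsub hx.1).resolve_right hx.2⟩
    have hA : IsCompact (F ∩ U) := hAeq ▸ hF.diff hV
    have hAu : F ∩ U ≠ univ := fun h => noncompact_univ ℂ (h ▸ hA)
    obtain ⟨x, hx⟩ := nonempty_frontier_iff.2 ⟨hne, hAu⟩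
    have hxA := hA.isClosed.frontier_subset hx
    refine ⟨x, ⟨subset_closure hxA.1, fun hint => ?_⟩, hxA.2⟩
    refine hx.2 ?_
    rw [interior_inter]
    exact ⟨hint, by rw [hU.interior_eq]; exact hxA.2⟩
  intro U V hU hV hsub hU' hV'
  by_contra hcon
  rw [not_nonempty_iff_eq_empty] at hcon
  obtain ⟨x, hx, hxUV⟩ := h.isPreconnected U V hU hV (hfF.trans hsub) (key U V hU hV hsub hcon hU')
    (key V U hV hU (by rwa [union_comm]) (by rwa [inter_comm V U]) hV')
  exact (hcon ▸ ⟨hfF hx, hxUV⟩ : x ∈ (∅ : Set ℂ))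

lemma connectedComponentIn_union_eq {A B : Set ℂ} (hA : IsConnected A) (hAc : IsClosed A)
    (hBc : IsClosed B) (hAB : Disjoint A B) {x : ℂ} (hx : x ∈ A) :
    connectedComponentIn (A ∪ B) x = A := by
  have hxAB : x ∈ A ∪ B := Or.inl hx
  refine Subset.antisymm ?_ (hA.isPreconnected.subset_connectedComponentIn hx subset_union_left)
  have hpre := isPreconnected_connectedComponentIn (F := A ∪ B) (x := x)
  have hxc := mem_connectedComponentIn hxAB
  have hsub := connectedComponentIn_subset (A ∪ B) x
  intro y hy
  by_contra hyA
  obtain ⟨z, -, hz⟩ := isPreconnected_closed_iff.1 hpre A B hAc hBc hsub ⟨x, hxc, hx⟩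
    ⟨y, hy, (hsub hy).resolve_left hyA⟩
  exact disjoint_left.1 hAB hz.1 hz.2

lemma components_union {A B : Set ℂ} (hA : IsConnected A) (hB : IsConnected B) (hAc : IsClosed A)
    (hBc : IsClosed B) (hAB : Disjoint A B) : components (A ∪ B) = {A, B} := by
  ext C
  constructor
  · rintro ⟨x, hx | hx, rfl⟩
    · exact Or.inl (connectedComponentIn_union_eq hA hAc hBc hAB hx)
    · rw [union_comm]
      exact Or.inr (connectedComponentIn_union_eq hB hBc hAc hAB.symm hx)
  · rintro (rfl | rfl)
    · obtain ⟨x, hx⟩ := hA.nonempty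
      exact ⟨x, Or.inl hx, (connectedComponentIn_union_eq hA hAc hBc hAB hx).symm⟩
    · obtain ⟨x, hx⟩ := hB.nonempty
      refine ⟨x, Or.inr hx, ?_⟩
      rw [union_comm]
      exact (connectedComponentIn_union_eq hB hBc hAc hAB.symm hx).symm

lemma isConnected_ring {r R : ℝ} (hr : 0 < r) (hrR : r < R) :
    IsConnected {w : ℂ | r < ‖w‖ ∧ ‖w‖ < R} := by
  have hR := hr.trans hrR
  have himg : {w : ℂ | r < ‖w‖ ∧ ‖w‖ < R} =
      Complex.exp '' {L | Real.log r < L.re ∧ L.re < Real.log R} := by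
    ext w
    constructor
    · rintro ⟨h1, h2⟩
      have hw : 0 < ‖w‖ := hr.trans h1
      exact ⟨Complex.log w, by
        rw [mem_ofPred_eq, Complex.log_re]
        exact ⟨Real.log_lt_log hr h1, Real.log_lt_log hw h2⟩, Complex.exp_log (norm_pos_iff.1 hw)⟩
    · rintro ⟨L, ⟨h1, h2⟩, rfl⟩
      rw [mem_ofPred_eq, Complex.norm_exp]
      exact ⟨(Real.log_lt_iff_lt_exp hr).1 h1, (Real.lt_log_iff_exp_lt hR).1 h2⟩
  rw [himg]
  refine IsConnected.image ⟨?_, ?_⟩ _ Complex.continuous_exp.continuousOn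
  · obtain ⟨x, hx1, hx2⟩ := exists_between (Real.log_lt_log hr hrR)
    exact ⟨x, by simpa using hx1, by simpa using hx2⟩
  · exact ((convex_halfSpace_re_gt _).inter (convex_halfSpace_re_lt _)).isPreconnected

lemma isConnected_exterior : IsConnected {w : ℂ | 1 ≤ ‖w‖} := by
  have himg : {w : ℂ | 1 ≤ ‖w‖} = Complex.exp '' {L | 0 ≤ L.re} := by
    ext w
    constructor
    · intro h
      have h : 1 ≤ ‖w‖ := h
      exact ⟨Complex.log w, by
        rw [mem_ofPred_eq, Complex.log_re]; exact Real.log_nonneg h,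
        Complex.exp_log (norm_pos_iff.1 (by linarith))⟩
    · rintro ⟨L, h, rfl⟩
      rw [mem_ofPred_eq, Complex.norm_exp]
      exact Real.one_le_exp h
  rw [himg]
  exact IsConnected.image ⟨⟨0, by simp⟩, (convex_halfSpace_re_ge 0).isPreconnected⟩ _
    Complex.continuous_exp.continuousOn

/-- The hull at the time `b = e^{t/4}`: the origin and the points of the disc which are swallowed
up to this time. -/
def hull (κ : ℝ → ℂ) (b : ℝ) : Set ℂ := Metric.closedBall 0 1 \ aliveDomain κ b

lemma mem_disc_iff {z : ℂ} : z ∈ disc ↔ ‖z‖ < 1 := mem_ball_zero_iff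

lemma isOpen_disc : IsOpen disc := Metric.isOpen_ball

lemma frontier_disc : frontier disc = Metric.sphere 0 1 := frontier_ball _ one_ne_zero

lemma isCompact_hull (hκ : IsDriving κ) (hb0 : 0 ≤ b) (hb : b < 1) : IsCompact (hull κ b) :=
  (isCompact_closedBall 0 1).diff (isOpen_aliveDomain hκ hb0 hb)

lemma hull_subset_disc (hκ : IsDriving κ) (hb0 : 0 ≤ b) (hb : b < 1) : hull κ b ⊆ disc := by
  intro z hz
  have h1 : ‖z‖ ≤ 1 := mem_closedBall_zero_iff.1 hz.1
  exact mem_disc_iff.2 (h1.lt_of_ne fun h => hz.2 (sphere_subset_aliveDomain hκ hb0 hb h))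

lemma zero_mem_hull : (0 : ℂ) ∈ hull κ b :=
  ⟨by simp, fun h => ne_zero_of_mem_aliveDomain h rfl⟩

lemma mem_disc_diff_hull_iff {z : ℂ} : z ∈ disc \ hull κ b ↔ ‖z‖ < 1 ∧ z ∈ aliveDomain κ b := by
  rw [Set.mem_sdiff, mem_disc_iff]
  constructor
  · rintro ⟨h1, h2⟩
    refine ⟨h1, ?_⟩
    by_contra h3
    exact h2 ⟨mem_closedBall_zero_iff.2 h1.le, h3⟩
  · exact fun ⟨h1, h2⟩ => ⟨h1, fun h3 => h3.2 h2⟩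

lemma disc_diff_hull : disc \ hull κ b = disc ∩ aliveDomain κ b := by
  ext z; rw [mem_disc_diff_hull_iff, mem_inter_iff, mem_disc_iff]

lemma isOpen_disc_diff_hull (hκ : IsDriving κ) (hb0 : 0 ≤ b) (hb : b < 1) :
    IsOpen (disc \ hull κ b) := by
  rw [disc_diff_hull]; exact isOpen_disc.inter (isOpen_aliveDomain hκ hb0 hb)

lemma mem_doubleAnnulus_of_le_one (hb0 : 0 < b) (hb : b < 1) {w : ℂ} (h1 : b ^ 4 < ‖w‖)
    (h2 : ‖w‖ ≤ 1) : w ∈ doubleAnnulus b := by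
  have : b ^ 4 < 1 := pow_lt_one₀ hb0.le hb (by norm_num)
  exact ⟨h1, by nlinarith [pow_pos hb0 4]⟩

lemma discInv_image_ring (hκ : IsDriving κ) (hb0 : 0 < b) (hb : b < 1) :
    discInv κ b '' {w | b ^ 4 < ‖w‖ ∧ ‖w‖ < 1} = disc \ hull κ b := by
  ext z
  rw [mem_disc_diff_hull_iff]
  constructor
  · rintro ⟨w, ⟨h1, h2⟩, rfl⟩
    have hw := mem_doubleAnnulus_of_le_one hb0 hb h1 h2.le
    have hz := discInv_mem hκ hb0 hb hw
    refine ⟨?_, hz⟩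
    rw [← norm_discMap_lt_one_iff hκ hb0 hb hz, discMap_discInv hκ hb0 hb hw]
    exact h2
  · rintro ⟨h1, h2⟩
    exact ⟨discMap κ b z, ⟨(discMap_mem hκ hb0 hb h2).1,
      (norm_discMap_lt_one_iff hκ hb0 hb h2).2 h1⟩, discInv_discMap hκ hb0 hb h2⟩

lemma discMap_image (hκ : IsDriving κ) (hb0 : 0 < b) (hb : b < 1) :
    discMap κ b '' (disc \ hull κ b) = {w | b ^ 4 < ‖w‖ ∧ ‖w‖ < 1} := by
  rw [← discInv_image_ring hκ hb0 hb, image_image]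
  refine (image_congr fun w hw => ?_).trans (image_id _)
  exact discMap_discInv hκ hb0 hb (mem_doubleAnnulus_of_le_one hb0 hb hw.1 hw.2.le)

lemma continuousOn_discInv (hκ : IsDriving κ) (hb0 : 0 < b) (hb : b < 1) :
    ContinuousOn (discInv κ b) (doubleAnnulus b) :=
  (differentiableOn_discInv hκ hb0 hb).continuousOn

lemma isConnected_disc_diff_hull (hκ : IsDriving κ) (hb0 : 0 < b) (hb : b < 1) :
    IsConnected (disc \ hull κ b) := by
  rw [← discInv_image_ring hκ hb0 hb]
  refine (isConnected_ring (pow_pos hb0 4) (pow_lt_one₀ hb0.le hb (by norm_num))).image _ ?_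
  exact (continuousOn_discInv hκ hb0 hb).mono fun w hw =>
    mem_doubleAnnulus_of_le_one hb0 hb hw.1 hw.2.le

/-- The frontier of the hull is the cluster set of the inverse map at the inner circle. -/
lemma frontier_hull_eq (hκ : IsDriving κ) (hb0 : 0 < b) (hb : b < 1) :
    frontier (hull κ b) = ⋂ r : Ioo (b ^ 4) 1,
      closure (discInv κ b '' {w | b ^ 4 < ‖w‖ ∧ ‖w‖ < r}) := by
  have hclosed := (isCompact_hull (κ := κ) hκ hb0.le hb).isClosed
  have hopen := isOpen_aliveDomain (κ := κ) hκ hb0.le hb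
  have hne : b ^ 4 < 1 := pow_lt_one₀ hb0.le hb (by norm_num)
  have hsub : ∀ r : Ioo (b ^ 4) 1, discInv κ b '' {w | b ^ 4 < ‖w‖ ∧ ‖w‖ < r} ⊆
      disc \ hull κ b := by
    intro r
    rw [← discInv_image_ring hκ hb0 hb]
    exact image_mono fun w hw => ⟨hw.1, hw.2.trans r.2.2⟩
  apply Subset.antisymm
  · intro x hx
    rw [mem_iInter]
    intro r
    have hxh := hclosed.frontier_subset hx
    have hxc : x ∈ closure (hull κ b)ᶜ := by
      rw [frontier_eq_closure_inter_closure] at hx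
      exact hx.2
    set Q : Set ℂ := {w | (r : ℝ) ≤ ‖w‖ ∧ ‖w‖ ≤ 1} with hQ
    have hQsub : Q ⊆ doubleAnnulus b := fun w hw =>
      mem_doubleAnnulus_of_le_one hb0 hb (r.2.1.trans_le hw.1) hw.2
    have hQc : IsCompact Q := by
      refine (isCompact_closedBall (0 : ℂ) 1).of_isClosed_subset ?_ fun w hw =>
        mem_closedBall_zero_iff.2 hw.2
      exact (isClosed_le continuous_const continuous_norm).inter
        (isClosed_le continuous_norm continuous_const)
    have hKc : IsClosed (discInv κ b '' Q) :=
      (hQc.image_of_continuousOn ((continuousOn_discInv hκ hb0 hb).mono hQsub)).isClosed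
    have hxK : x ∉ discInv κ b '' Q := by
      rintro ⟨w, hw, rfl⟩
      exact hxh.2 (discInv_mem hκ hb0 hb (hQsub hw))
    rw [mem_closure_iff] at hxc ⊢
    intro o ho hxo
    obtain ⟨z, ⟨⟨hzo, hzd⟩, hzK⟩, hzh⟩ := hxc (o ∩ disc ∩ (discInv κ b '' Q)ᶜ)
      ((ho.inter isOpen_disc).inter hKc.isOpen_compl)
      ⟨⟨hxo, hull_subset_disc hκ hb0.le hb hxh⟩, hxK⟩
    obtain ⟨hz1, hza⟩ := mem_disc_diff_hull_iff.1 ⟨hzd, hzh⟩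
    refine ⟨z, hzo, discMap κ b z, ⟨(discMap_mem hκ hb0 hb hza).1, ?_⟩,
      discInv_discMap hκ hb0 hb hza⟩
    by_contra hr
    exact hzK ⟨discMap κ b z, ⟨not_lt.1 hr, ((norm_discMap_lt_one_iff hκ hb0 hb hza).2 hz1).le⟩,
      discInv_discMap hκ hb0 hb hza⟩
  · intro x hx
    rw [mem_iInter] at hx
    obtain ⟨r₀, hr₀⟩ := exists_between hne
    have hxD : x ∈ closure (disc \ hull κ b) := closure_mono (hsub _) (hx ⟨r₀, hr₀⟩)
    have hxball : x ∈ Metric.closedBall (0 : ℂ) 1 :=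
      Metric.isClosed_closedBall.closure_subset_iff.2
        (fun z hz => Metric.ball_subset_closedBall hz.1) hxD
    rw [frontier_eq_closure_inter_closure]
    refine ⟨subset_closure ⟨hxball, fun hxa => ?_⟩, closure_mono (fun z hz => hz.2) hxD⟩
    have hm := discMap_mem hκ hb0 hb hxa
    obtain ⟨r, hr1, hr2⟩ := exists_between (lt_min hm.1 hne)
    have hN : ∀ᶠ z in 𝓝 x, z ∈ aliveDomain κ b ∧ r < ‖discMap κ b z‖ := by
      have hc : ContinuousAt (discMap κ b) x :=
        (differentiableOn_discMap hκ hb0 hb).continuousOn.continuousAt (hopen.mem_nhds hxa)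
      filter_upwards [hopen.mem_nhds hxa,
        hc.norm.eventually (lt_mem_nhds (hr2.trans_le (min_le_left _ _)))] with z h1 h2
      exact ⟨h1, h2⟩
    obtain ⟨z, ⟨hza, hzr⟩, w, hw, rfl⟩ :=
      mem_closure_iff_nhds.1 (hx ⟨r, hr1, hr2.trans_le (min_le_right _ _)⟩) _ hN
    rw [discMap_discInv hκ hb0 hb (mem_doubleAnnulus_of_le_one hb0 hb hw.1
      (hw.2.trans (hr2.trans_le (min_le_right _ _))).le)] at hzr
    exact hzr.not_gt hw.2

lemma isConnected_frontier_hull (hκ : IsDriving κ) (hb0 : 0 < b) (hb : b < 1) :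
    IsConnected (frontier (hull κ b)) := by
  have hne : b ^ 4 < 1 := pow_lt_one₀ hb0.le hb (by norm_num)
  have hsub : ∀ r : Ioo (b ^ 4) 1, discInv κ b '' {w | b ^ 4 < ‖w‖ ∧ ‖w‖ < r} ⊆ disc := by
    intro r
    refine (Subset.trans ?_ (discInv_image_ring (κ := κ) hκ hb0 hb).subset).trans sdiff_subset
    exact image_mono fun w hw => ⟨hw.1, hw.2.trans r.2.2⟩
  have : Nonempty (Ioo (b ^ 4) 1) := (nonempty_Ioo.2 hne).to_subtype
  rw [frontier_hull_eq hκ hb0 hb]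
  refine isConnected_iInter_of_directed ?_ ?_ ?_
  · intro r r'
    refine ⟨min r r', ?_, ?_⟩
    · exact closure_mono (image_mono fun w hw => ⟨hw.1,
        hw.2.trans_le (by exact_mod_cast min_le_left r r')⟩)
    · exact closure_mono (image_mono fun w hw => ⟨hw.1,
        hw.2.trans_le (by exact_mod_cast min_le_right r r')⟩)
  · exact fun r => (Metric.isBounded_ball.subset (hsub r)).isCompact_closure
  · intro r
    refine (IsConnected.image (isConnected_ring (pow_pos hb0 4) r.2.1) _ ?_).closure
    exact (continuousOn_discInv hκ hb0 hb).mono fun w hw =>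
      mem_doubleAnnulus_of_le_one hb0 hb hw.1 (hw.2.trans r.2.2).le

lemma isConnected_hull (hκ : IsDriving κ) (hb0 : 0 < b) (hb : b < 1) : IsConnected (hull κ b) :=
  isConnected_of_frontier (isCompact_hull hκ hb0.le hb) (isConnected_frontier_hull hκ hb0 hb)

lemma isDoublyConnected_disc_diff_hull (hκ : IsDriving κ) (hb0 : 0 < b) (hb : b < 1) :
    IsDoublyConnected (disc \ hull κ b) (frontier (hull κ b)) (frontier disc) := by
  have hcl := (isCompact_hull (κ := κ) hκ hb0.le hb).isClosed
  have hhd := hull_subset_disc (κ := κ) hκ hb0.le hb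
  have hcompl : (disc \ hull κ b)ᶜ = hull κ b ∪ {w | 1 ≤ ‖w‖} := by
    ext z
    simp only [mem_compl_iff, Set.mem_sdiff, mem_disc_iff, mem_union, mem_ofPred_eq, not_and,
      not_not]
    rw [← not_lt]
    tauto
  have hextc : IsClosed {w : ℂ | 1 ≤ ‖w‖} := isClosed_le continuous_const continuous_norm
  have hdisj : Disjoint (hull κ b) {w | 1 ≤ ‖w‖} := by
    rw [disjoint_left]
    intro z hz hz1
    exact (mem_disc_iff.1 (hhd hz)).not_ge hz1
  have hdisj' : Disjoint (frontier (hull κ b)) (frontier disc) := by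
    rw [frontier_disc, disjoint_left]
    intro z hz hz1
    exact (mem_disc_iff.1 (hhd (hcl.frontier_subset hz))).ne (mem_sphere_zero_iff_norm.1 hz1)
  have hsphere : IsConnected (frontier disc) := by
    rw [frontier_disc]
    exact isConnected_sphere (by simp [Complex.rank_real_complex]) _ zero_le_one
  have hfr : frontier (disc \ hull κ b) = frontier (hull κ b) ∪ frontier disc := by
    rw [(isOpen_disc_diff_hull hκ hb0.le hb).frontier_eq]
    ext x
    constructor
    · rintro ⟨h1, h2⟩
      have h3 : ‖x‖ ≤ 1 := mem_closedBall_zero_iff.1 (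
        Metric.isClosed_closedBall.closure_subset_iff.2
        (fun z hz => Metric.ball_subset_closedBall hz.1) h1)
      rcases h3.lt_or_eq with h4 | h4
      · left
        rw [frontier_eq_closure_inter_closure]
        have h5 : x ∈ hull κ b := by
          by_contra h5
          exact h2 ⟨mem_disc_iff.2 h4, h5⟩
        exact ⟨subset_closure h5, closure_mono (fun z hz => hz.2) h1⟩
      · right
        rw [frontier_disc, mem_sphere_zero_iff_norm]
        exact h4
    · rintro (h | h)
      · have hxh := hcl.frontier_subset h
        refine ⟨?_, fun h2 => h2.2 hxh⟩
        rw [Set.sdiff_eq]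
        rw [frontier_eq_closure_inter_closure] at h
        exact isOpen_disc.inter_closure ⟨hhd hxh, h.2⟩
      · have hx1 : ‖x‖ = 1 := by rwa [frontier_disc, mem_sphere_zero_iff_norm] at h
        refine ⟨?_, fun h2 => (mem_disc_iff.1 h2.1).ne hx1⟩
        rw [disc_diff_hull, inter_comm]
        exact (isOpen_aliveDomain hκ hb0.le hb).inter_closure
          ⟨sphere_subset_aliveDomain hκ hb0.le hb hx1, frontier_subset_closure h⟩
  refine ⟨isOpen_disc_diff_hull hκ hb0.le hb, isConnected_disc_diff_hull hκ hb0 hb,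
    Metric.isBounded_ball.subset sdiff_subset, ?_, ?_, ?_⟩
  · rw [hcompl, components_union (isConnected_hull hκ hb0 hb) isConnected_exterior hcl hextc hdisj,
      ncard_pair]
    intro h
    exact (isConnected_hull hκ hb0 hb).nonempty.ne_empty
      (disjoint_self.1 (by rw [← h] at hdisj; exact hdisj))
  · intro h
    exact hsphere.nonempty.ne_empty (disjoint_self.1 (by rw [h] at hdisj'; exact hdisj'))
  · rw [hfr, components_union (isConnected_frontier_hull hκ hb0 hb) hsphere isClosed_frontier
      isClosed_frontier hdisj']

lemma hull_ssubset (hκ : IsDriving κ) {s t : ℝ} (hs : 0 < s) (hst : s < t) (ht : t < 1) :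
    hull κ s ⊂ hull κ t := by
  refine ⟨sdiff_subset_sdiff_right (aliveDomain_anti hst.le), fun hsub => ?_⟩
  obtain ⟨ζ, hζ, h1, h2⟩ := exists_alive_not_alive hκ hs hst ht
  have : Complex.exp ζ ∈ hull κ t := by
    refine ⟨?_, fun h => h2 (exp_mem_aliveDomain_iff.1 h)⟩
    rw [mem_closedBall_zero_iff, Complex.norm_exp]
    exact Real.exp_le_one_iff.2 hζ.le
  exact (hsub this).2 (exp_mem_aliveDomain_iff.2 h1)

lemma isHullAt_hull (hκ : IsDriving κ) (hb0 : 0 < b) (hb : b < 1) :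
    IsHullAt disc 0 (hull κ b) := by
  refine ⟨isCompact_hull hκ hb0.le hb, hull_subset_disc hκ hb0.le hb, ?_,
    isConnected_hull hκ hb0 hb, isConnected_disc_diff_hull hκ hb0 hb⟩
  have h := hull_ssubset (κ := κ) hκ (half_pos hb0) (half_lt_self hb0) hb
  exact (singleton_subset_iff.2 zero_mem_hull).trans_ssubset h

/-! ### Extremal length of conformal images of rectangles -/

/-- The change of variables formula for the area under an injective holomorphic map. -/
lemma lintegral_image_eq_lintegral_norm_deriv_sq_mul {U : Set ℂ} {f : ℂ → ℂ} (hU : IsOpen U)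
    (hf : DifferentiableOn ℂ f U) (hinj : InjOn f U) (g : ℂ → ℝ≥0∞) :
    ∫⁻ w in f '' U, g w = ∫⁻ z in U, ‖deriv f z‖ₑ ^ 2 * g (f z) := by
  have hd : ∀ z ∈ U, HasFDerivWithinAt f
      ((ContinuousLinearMap.toSpanSingleton ℂ (deriv f z)).restrictScalars ℝ) U z := fun z hz =>
    ((hf.differentiableAt (hU.mem_nhds hz)).hasDerivAt.hasFDerivAt.restrictScalars
      ℝ).hasFDerivWithinAt
  rw [lintegral_image_eq_lintegral_abs_det_fderiv_mul volume hU.measurableSet hd hinj]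
  refine setLIntegral_congr_fun hU.measurableSet fun z _ => ?_
  have hdet : ((ContinuousLinearMap.toSpanSingleton ℂ (deriv f z)).restrictScalars ℝ).det =
      ‖deriv f z‖ ^ 2 := by
    have h1 : ((ContinuousLinearMap.toSpanSingleton ℂ (deriv f z)).restrictScalars ℝ).det =
      LinearMap.det (((ContinuousLinearMap.toSpanSingleton ℂ (deriv f z) : ℂ →L[ℂ] ℂ) :
        ℂ →ₗ[ℂ] ℂ).restrictScalars ℝ) := rfl
    rw [h1, LinearMap.det_restrictScalars]
    rw [Algebra.norm_complex_eq]
    rw [LinearMap.det_ring]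
    simp [Complex.normSq_eq_norm_sq]
  simp only [hdet, abs_of_nonneg (sq_nonneg ‖deriv f z‖)]
  rw [← ofReal_norm, ENNReal.ofReal_pow (norm_nonneg _)]

/-- The Cauchy–Schwarz inequality on an interval. -/
lemma sq_setLIntegral_le {c d : ℝ} {h : ℝ → ℝ≥0∞} (hh : Measurable h) :
    (∫⁻ y in Ioo c d, h y) ^ 2 ≤ ENNReal.ofReal (d - c) * ∫⁻ y in Ioo c d, h y ^ 2 := by
  have h2 : (2 : ℝ).HolderConjugate 2 := Real.HolderConjugate.two_two
  have := ENNReal.lintegral_mul_le_Lp_mul_Lq (volume.restrict (Ioo c d)) h2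
    (f := fun _ => 1) (g := h) aemeasurable_const hh.aemeasurable
  simp only [Pi.mul_apply, one_mul, ENNReal.one_rpow, lintegral_one, Measure.restrict_apply_univ,
    Real.volume_Ioo] at this
  calc (∫⁻ y in Ioo c d, h y) ^ 2 ≤ (ENNReal.ofReal (d - c) ^ (1 / 2 : ℝ) *
      (∫⁻ y in Ioo c d, h y ^ (2 : ℝ)) ^ (1 / 2 : ℝ)) ^ 2 := by gcongr
    _ = _ := by
      rw [mul_pow, ← ENNReal.rpow_natCast, ← ENNReal.rpow_natCast, ← ENNReal.rpow_mul,
        ← ENNReal.rpow_mul]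
      norm_num

/-- A family of curves which contains the images of the vertical segments of the rectangle
`(a, b) × (-π/2, π/2)` under an injective holomorphic map has extremal length at most
`π / (b - a)`. -/
lemma extremalLength_le_of_rectangle {a b : ℝ} (hab : a < b) {U : Set ℂ} {Ψ : ℂ → ℂ}
    {Γ : Set (ℝ → ℂ)}
    (hUdef : U = {z | z.re ∈ Ioo a b ∧ z.im ∈ Ioo (-(Real.pi / 2)) (Real.pi / 2)})
    (hΨ : DifferentiableOn ℂ Ψ U) (hinj : InjOn Ψ U)
    (hΓ : ∀ x ∈ Ioo a b, (fun u : ℝ => Ψ (x + Real.arctan u * Complex.I)) ∈ Γ) :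
    extremalLength Γ ≤ ENNReal.ofReal (Real.pi / (b - a)) := by
  have hU : IsOpen U := by
    rw [hUdef]
    exact (isOpen_Ioo.preimage Complex.continuous_re).inter
      (isOpen_Ioo.preimage Complex.continuous_im)
  have hmem : ∀ {x y : ℝ}, (x + y * Complex.I ∈ U ↔
      x ∈ Ioo a b ∧ y ∈ Ioo (-(Real.pi / 2)) (Real.pi / 2)) := by
    intro x y; rw [hUdef, mem_ofPred_eq]; simp
  refine iSup_le fun ρ => iSup_le fun hρ => iSup_le fun h0 => iSup_le fun htop => ?_
  rw [ENNReal.div_le_iff h0 htop]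
  set ℓ := ⨅ γ ∈ Γ, curveLength ρ γ with hℓ
  classical
  set h : ℂ → ℝ≥0∞ := U.indicator fun z => ρ (U.piecewise Ψ 0 z) * ‖deriv Ψ z‖ₑ with hh
  have hmeas : Measurable h := by
    refine Measurable.indicator (Measurable.mul (hρ.comp ?_) (measurable_deriv Ψ).enorm)
      hU.measurableSet
    exact hΨ.continuousOn.measurable_piecewise continuousOn_const hU.measurableSet
  have hval : ∀ z ∈ U, h z = ρ (Ψ z) * ‖deriv Ψ z‖ₑ := fun z hz => by
    rw [hh, indicator_of_mem hz, piecewise_eq_of_mem _ _ _ hz]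
  -- the length of the image of a vertical segment
  have hlen : ∀ x ∈ Ioo a b, ℓ ≤ ∫⁻ y in Ioo (-(Real.pi / 2)) (Real.pi / 2),
      h (x + y * Complex.I) := by
    intro x hx
    refine (iInf₂_le _ (hΓ x hx)).trans (le_of_eq ?_)
    rw [← Real.range_arctan, ← image_univ, lintegral_image_eq_lintegral_abs_deriv_mul
      MeasurableSet.univ (fun u _ => (Real.hasDerivAt_arctan u).hasDerivWithinAt)
      Real.arctan_injective.injOn, Measure.restrict_univ]
    refine lintegral_congr fun u => ?_
    have hz : (x + Real.arctan u * Complex.I : ℂ) ∈ U := hmem.2 ⟨hx, Real.arctan_mem_Ioo u⟩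
    have hd : HasDerivAt (fun u : ℝ => Ψ (x + Real.arctan u * Complex.I))
        (deriv Ψ (x + Real.arctan u * Complex.I) * (((1 / (1 + u ^ 2) : ℝ) : ℂ) * Complex.I)) u :=
      HasDerivAt.comp u (hΨ.differentiableAt (hU.mem_nhds hz)).hasDerivAt
        (((Real.hasDerivAt_arctan u).ofReal_comp.mul_const Complex.I).const_add _)
    rw [hval _ hz, hd.deriv, enorm_mul, enorm_mul]
    have h1 : ‖Complex.I‖ₑ = 1 := by rw [← ofReal_norm]; simp
    have h2 : ‖((1 / (1 + u ^ 2) : ℝ) : ℂ)‖ₑ = ENNReal.ofReal |1 / (1 + u ^ 2)| := by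
      rw [← ofReal_norm, Complex.norm_real, Real.norm_eq_abs]
    rw [h1, h2, mul_one]
    ring
  have hsq : ∀ x ∈ Ioo a b, ℓ ^ 2 ≤
      ENNReal.ofReal Real.pi * ∫⁻ y : ℝ, h (x + y * Complex.I) ^ 2 := by
    intro x hx
    have hm : Measurable fun y : ℝ => h (x + y * Complex.I) := hmeas.comp (by fun_prop)
    calc ℓ ^ 2 ≤ _ := pow_le_pow_left' (hlen x hx) 2
      _ ≤ _ := sq_setLIntegral_le hm
      _ ≤ _ := by
        rw [show Real.pi / 2 - -(Real.pi / 2) = Real.pi by ring]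
        gcongr
        exact Measure.restrict_le_self
  have harea : ENNReal.ofReal (b - a) * ℓ ^ 2 ≤ ENNReal.ofReal Real.pi * ∫⁻ z, ρ z ^ 2 := by
    calc ENNReal.ofReal (b - a) * ℓ ^ 2 = ∫⁻ x in Ioo a b, ℓ ^ 2 := by
          rw [setLIntegral_const, Real.volume_Ioo, mul_comm]
      _ ≤ ∫⁻ x in Ioo a b, ENNReal.ofReal Real.pi * ∫⁻ y : ℝ, h (x + y * Complex.I) ^ 2 :=
          setLIntegral_mono' measurableSet_Ioo hsq
      _ ≤ ∫⁻ x : ℝ, ENNReal.ofReal Real.pi * ∫⁻ y : ℝ, h (x + y * Complex.I) ^ 2 :=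
          setLIntegral_le_lintegral _ _
      _ = ENNReal.ofReal Real.pi * ∫⁻ x : ℝ, ∫⁻ y : ℝ, h (x + y * Complex.I) ^ 2 :=
          lintegral_const_mul' _ _ ENNReal.ofReal_ne_top
      _ = ENNReal.ofReal Real.pi * ∫⁻ z, h z ^ 2 := by
          congr 1
          have hm : Measurable fun q : ℝ × ℝ => h (q.1 + q.2 * Complex.I) ^ 2 :=
            (hmeas.comp (by fun_prop)).pow_const 2
          rw [← lintegral_prod (fun q : ℝ × ℝ => h (q.1 + q.2 * Complex.I) ^ 2) hm.aemeasurable,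
            ← Measure.volume_eq_prod, ← Complex.volume_preserving_equiv_real_prod.lintegral_comp hm]
          refine lintegral_congr fun z => ?_
          simp [Complex.measurableEquivRealProd, Complex.re_add_im]
      _ = ENNReal.ofReal Real.pi * ∫⁻ w in Ψ '' U, ρ w ^ 2 := by
          rw [lintegral_image_eq_lintegral_norm_deriv_sq_mul hU hΨ hinj,
            ← lintegral_indicator hU.measurableSet]
          congr 1
          refine lintegral_congr fun z => ?_
          by_cases hz : z ∈ U
          · rw [hval z hz, indicator_of_mem hz]; ring
          · rw [hh, indicator_of_notMem hz, indicator_of_notMem hz]; simp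
      _ ≤ _ := by gcongr; exact Measure.restrict_le_self
  have hpos : 0 < b - a := sub_pos.2 hab
  rw [ENNReal.ofReal_div_of_pos hpos, ← ENNReal.mul_div_right_comm]
  rw [ENNReal.le_div_iff_mul_le (Or.inl (ENNReal.ofReal_pos.2 hpos).ne')
    (Or.inl ENNReal.ofReal_ne_top), mul_comm (ℓ ^ 2)]
  exact harea

/-! ### The crosscuts around the driving point -/

/-- The ratio `g_t(z) / χ_t`, as a function of `z`, at the time `t` with `s = e^{t/4}`: points
which are swallowed soon after this time have a ratio close to `1`. -/
noncomputable def drivingRatio (κ : ℝ → ℂ) (s : ℝ) (z : ℂ) : ℂ :=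
  (s : ℂ) ^ 4 * (discMap κ s z * κ s)⁻¹

lemma IsDriving.ne_zero (hκ : IsDriving κ) {s : ℝ} (hs : s ∈ Ioo 0 1) : κ s ≠ 0 := by
  intro h
  have := hκ.norm_eq s hs
  rw [h, norm_zero] at this
  exact zero_ne_one this

lemma norm_drivingRatio (hκ : IsDriving κ) {s : ℝ} (hs : s ∈ Ioo 0 1) (z : ℂ) :
    ‖drivingRatio κ s z‖ = s ^ 4 / ‖discMap κ s z‖ := by
  rw [drivingRatio, norm_mul, norm_inv, norm_mul, hκ.norm_eq s hs, mul_one, norm_pow,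
    Complex.norm_real, Real.norm_of_nonneg hs.1.le, div_eq_mul_inv]

lemma continuousOn_drivingRatio (hκ : IsDriving κ) {s : ℝ} (hs : s ∈ Ioo 0 1) :
    ContinuousOn (drivingRatio κ s) (aliveDomain κ s) := by
  refine continuousOn_const.mul (ContinuousOn.inv₀
    ((differentiableOn_discMap hκ hs.1 hs.2).continuousOn.mul continuousOn_const) fun z hz => ?_)
  exact mul_ne_zero (discMap_ne_zero κ s z) (hκ.ne_zero hs)

/-- The map `g_t⁻¹` in the coordinate `η = log log (χ_t / g_t(z))`, at the time `t` with
`s = e^{t/4}`. The half disc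
`{Re ξ > 0, |ξ| < R}` is a neighbourhood of the driving point in the coordinate `ξ = e^η`, and the
vertical segments of the `η`-plane become crosscuts which enclose this point. -/
noncomputable def crosscutMap (κ : ℝ → ℂ) (s : ℝ) (η : ℂ) : ℂ :=
  discInv κ s ((s : ℂ) ^ 4 * (κ s)⁻¹ * Complex.exp (Complex.exp η))

/-- The rectangle in which `crosscutMap` is injective. -/
def crosscutRect (r R : ℝ) : Set ℂ :=
  {η | η.re ∈ Ioo (Real.log r) (Real.log R) ∧ η.im ∈ Ioo (-(Real.pi / 2)) (Real.pi / 2)}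

section Crosscut

variable {s s' r R : ℝ} {η : ℂ}

lemma norm_exp_mem (hr : 0 < r) (hrR : r < R) (hη : η ∈ crosscutRect r R) :
    r < ‖Complex.exp η‖ ∧ ‖Complex.exp η‖ < R ∧ 0 < (Complex.exp η).re := by
  rw [Complex.norm_exp, Complex.exp_re]
  exact ⟨(Real.log_lt_iff_lt_exp hr).1 hη.1.1, (Real.lt_log_iff_exp_lt (hr.trans hrR)).1 hη.1.2,
    mul_pos (Real.exp_pos _) (Real.cos_pos_of_mem_Ioo hη.2)⟩

lemma abs_im_lt_of_norm_lt (hR : R ≤ Real.pi) {ξ : ℂ} (hξ : ‖ξ‖ < R) :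
    -Real.pi < ξ.im ∧ ξ.im < Real.pi :=
  abs_lt.1 ((Complex.abs_im_le_norm ξ).trans_lt (hξ.trans_le hR))

lemma crosscut_arg_mem (hκ : IsDriving κ) (hs : s ∈ Ioo 0 1) (hr : 0 < r) (hrR : r < R)
    (hRs : R ≤ -(4 * Real.log s)) (hη : η ∈ crosscutRect r R) :
    s ^ 4 < ‖(s : ℂ) ^ 4 * (κ s)⁻¹ * Complex.exp (Complex.exp η)‖ ∧
      ‖(s : ℂ) ^ 4 * (κ s)⁻¹ * Complex.exp (Complex.exp η)‖ < 1 := by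
  obtain ⟨h1, h2, h3⟩ := norm_exp_mem hr hrR hη
  have hs4 : 0 < s ^ 4 := pow_pos hs.1 4
  have hn : ‖(s : ℂ) ^ 4 * (κ s)⁻¹ * Complex.exp (Complex.exp η)‖ =
      s ^ 4 * Real.exp (Complex.exp η).re := by
    rw [norm_mul, norm_mul, norm_inv, hκ.norm_eq s hs, norm_pow, Complex.norm_real,
      Real.norm_of_nonneg hs.1.le, inv_one, mul_one, Complex.norm_exp]
  rw [hn]
  constructor
  · exact lt_mul_of_one_lt_right hs4 (Real.one_lt_exp_iff.2 h3)
  · have : s ^ 4 = Real.exp (4 * Real.log s) := by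
      rw [mul_comm, Real.exp_mul, Real.exp_log hs.1]; norm_cast
    rw [this, ← Real.exp_add, Real.exp_lt_one_iff]
    linarith [Complex.re_le_norm (Complex.exp η)]

lemma crosscutMap_mem (hκ : IsDriving κ) (hs : s ∈ Ioo 0 1) (hr : 0 < r) (hrR : r < R)
    (hRs : R ≤ -(4 * Real.log s)) (hη : η ∈ crosscutRect r R) :
    crosscutMap κ s η ∈ aliveDomain κ s ∧ ‖crosscutMap κ s η‖ < 1 ∧
      drivingRatio κ s (crosscutMap κ s η) = Complex.exp (-Complex.exp η) := by
  obtain ⟨h1, h2⟩ := crosscut_arg_mem hκ hs hr hrR hRs hη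
  have hw := mem_doubleAnnulus_of_le_one hs.1 hs.2 h1 h2.le
  have hm := discInv_mem hκ hs.1 hs.2 hw
  refine ⟨hm, ?_, ?_⟩
  · rw [crosscutMap, ← norm_discMap_lt_one_iff hκ hs.1 hs.2 hm, discMap_discInv hκ hs.1 hs.2 hw]
    exact h2
  · rw [drivingRatio, crosscutMap, discMap_discInv hκ hs.1 hs.2 hw, Complex.exp_neg]
    have := hκ.ne_zero hs
    have hs0 : (s : ℂ) ≠ 0 := Complex.ofReal_ne_zero.2 hs.1.ne'
    have := Complex.exp_ne_zero (Complex.exp η)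
    field_simp

lemma isOpen_crosscutRect : IsOpen (crosscutRect r R) :=
  (isOpen_Ioo.preimage Complex.continuous_re).inter (isOpen_Ioo.preimage Complex.continuous_im)

lemma differentiableOn_crosscutMap (hκ : IsDriving κ) (hs : s ∈ Ioo 0 1) (hr : 0 < r) (hrR : r < R)
    (hRs : R ≤ -(4 * Real.log s)) :
    DifferentiableOn ℂ (crosscutMap κ s) (crosscutRect r R) := by
  refine (differentiableOn_discInv hκ hs.1 hs.2).comp (Differentiable.differentiableOn ?_)
    fun η hη => ?_
  · fun_prop
  · obtain ⟨h1, h2⟩ := crosscut_arg_mem hκ hs hr hrR hRs hη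
    exact mem_doubleAnnulus_of_le_one hs.1 hs.2 h1 h2.le

lemma injOn_crosscutMap (hκ : IsDriving κ) (hs : s ∈ Ioo 0 1) (hr : 0 < r) (hrR : r < R)
    (hRs : R ≤ -(4 * Real.log s)) (hRpi : R ≤ Real.pi) :
    InjOn (crosscutMap κ s) (crosscutRect r R) := by
  intro η hη η' hη' h
  have h1 := (crosscutMap_mem hκ hs hr hrR hRs hη).2.2
  rw [h, (crosscutMap_mem hκ hs hr hrR hRs hη').2.2] at h1
  have aux : ∀ η ∈ crosscutRect r R, -Real.pi < (-Complex.exp η).im ∧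
      (-Complex.exp η).im ≤ Real.pi := fun η hη => by
    have := abs_im_lt_of_norm_lt (ξ := -Complex.exp η) hRpi
      (by rw [norm_neg]; exact (norm_exp_mem hr hrR hη).2.1)
    exact ⟨this.1, this.2.le⟩
  have h2 := Complex.exp_inj_of_neg_pi_lt_of_le_pi (aux η' hη').1 (aux η' hη').2 (aux η hη).1
    (aux η hη).2 h1
  have h3 : Complex.exp η' = Complex.exp η := neg_injective h2
  have hpi := Real.pi_pos
  exact (Complex.exp_inj_of_neg_pi_lt_of_le_pi (by linarith [hη'.2.1]) (by linarith [hη'.2.2])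
    (by linarith [hη.2.1]) (by linarith [hη.2.2]) h3).symm

lemma arctan_mem_crosscutRect {x : ℝ} (hx : x ∈ Ioo (Real.log r) (Real.log R)) (u : ℝ) :
    (x + Real.arctan u * Complex.I : ℂ) ∈ crosscutRect r R := by
  have h1 : (x + Real.arctan u * Complex.I : ℂ).re = x := by
    simp [-Complex.ofReal_arctan]
  have h2 : (x + Real.arctan u * Complex.I : ℂ).im = Real.arctan u := by
    simp [-Complex.ofReal_arctan]
  refine ⟨?_, ?_⟩
  · rw [h1]; exact hx
  · rw [h2]; exact Real.arctan_mem_Ioo u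

lemma locallyLipschitz_crosscut (hκ : IsDriving κ) (hs : s ∈ Ioo 0 1) (hr : 0 < r) (hrR : r < R)
    (hRs : R ≤ -(4 * Real.log s)) {x : ℝ} (hx : x ∈ Ioo (Real.log r) (Real.log R)) :
    LocallyLipschitz fun u : ℝ => crosscutMap κ s (x + Real.arctan u * Complex.I) := by
  refine ContDiff.locallyLipschitz (𝕂 := ℝ) ?_
  have h1 : ContDiffOn ℝ 1 (crosscutMap κ s) (crosscutRect r R) :=
    ((differentiableOn_crosscutMap hκ hs hr hrR hRs).contDiffOn
      isOpen_crosscutRect).restrict_scalars ℝ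
  have h2 : ContDiff ℝ 1 fun u : ℝ => (x + Real.arctan u * Complex.I : ℂ) :=
    contDiff_const.add ((Complex.ofRealCLM.contDiff.comp Real.contDiff_arctan).mul contDiff_const)
  exact h1.comp_contDiff h2 (arctan_mem_crosscutRect hx)

lemma norm_log_lt_of_norm_one_sub_lt (hr1 : r ≤ 3 / 4) {y : ℂ} (hy : ‖1 - y‖ < 2 / 3 * r) :
    y ∈ Complex.slitPlane ∧ ‖Complex.log y‖ < r := by
  have hy' : ‖y - 1‖ < 2 / 3 * r := by rwa [norm_sub_rev]
  have h := Complex.norm_log_one_add_half_le_self (z := y - 1) (by linarith)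
  have h2 := Complex.mem_slitPlane_of_norm_lt_one (z := y - 1) (by linarith)
  rw [add_sub_cancel] at h h2
  exact ⟨h2, by linarith⟩

/-- A connected subset of the domain at time `s` which contains a point that is swallowed soon
afterwards and a point of the unit circle meets the crosscut. -/
lemma crosscut_separates (hκ : IsDriving κ) (hs : s ∈ Ioo 0 1) (hr : 0 < r) (hrR : r < R)
    (hRs : R ≤ -(4 * Real.log s)) (hr1 : r ≤ 3 / 4) (hRpi : R ≤ Real.pi) {x : ℝ}
    (hx : x ∈ Ioo (Real.log r) (Real.log R)) {C : Set ℂ} (hC : IsPreconnected C)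
    (hCsub : C ⊆ aliveDomain κ s)
    (hCγ : ∀ z ∈ C, ∀ u : ℝ, crosscutMap κ s (x + Real.arctan u * Complex.I) ≠ z)
    {z₁ z₂ : ℂ} (h₁ : z₁ ∈ C) (h₁r : ‖1 - drivingRatio κ s z₁‖ < 2 / 3 * r) (h₂ : z₂ ∈ C)
    (hz₂ : ‖z₂‖ = 1) : False := by
  set ρ := Real.exp x with hρ
  have hR := hr.trans hrR
  have hrρ : r < ρ := (Real.log_lt_iff_lt_exp hr).1 hx.1
  have hρR : ρ < R := (Real.lt_log_iff_exp_lt hR).1 hx.2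
  have hs4 : 0 < s ^ 4 := pow_pos hs.1 4
  have hpre := hC.image _ ((continuousOn_drivingRatio hκ hs).mono hCsub)
  set V₁ : Set ℂ := {y | y ∈ Complex.slitPlane ∧ ‖Complex.log y‖ < ρ} with hV₁
  set V₂ : Set ℂ := (Complex.exp '' Metric.closedBall 0 ρ)ᶜ with hV₂
  have hV₁o : IsOpen V₁ := by
    have hc : ContinuousOn (fun y => ‖Complex.log y‖) Complex.slitPlane :=
      (ContinuousOn.clog continuousOn_id fun y hy => hy).norm
    exact hc.isOpen_inter_preimage Complex.isOpen_slitPlane isOpen_Iio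
  have hV₂o : IsOpen V₂ :=
    ((isCompact_closedBall 0 ρ).image Complex.continuous_exp).isClosed.isOpen_compl
  have hcover : drivingRatio κ s '' C ⊆ V₁ ∪ V₂ := by
    rintro _ ⟨z, hz, rfl⟩
    by_cases hy : drivingRatio κ s z ∈ V₂
    · exact Or.inr hy
    obtain ⟨ξ, hξ, hξy⟩ := not_not.1 hy
    rw [mem_closedBall_zero_iff] at hξ
    have him := abs_im_lt_of_norm_lt hRpi (hξ.trans_lt hρR)
    have hlog : Complex.log (Complex.exp ξ) = ξ := Complex.log_exp him.1 him.2.le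
    rcases hξ.lt_or_eq with hlt | heq
    · left
      rw [← hξy, hV₁, mem_ofPred_eq, hlog, Complex.mem_slitPlane_iff_arg, ← Complex.log_im, hlog]
      exact ⟨⟨him.2.ne, Complex.exp_ne_zero _⟩, hlt⟩
    -- on the boundary circle of the neighbourhood, the point lies on the crosscut
    exfalso
    have hza := hCsub hz
    have hm := discMap_mem hκ hs.1 hs.2 hza
    have hre : 0 < (-ξ).re := by
      have h1 : ‖drivingRatio κ s z‖ < 1 := by
        rw [norm_drivingRatio hκ hs, div_lt_one (hs4.trans hm.1)]
        exact hm.1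
      rw [← hξy, Complex.norm_exp, Real.exp_lt_one_iff] at h1
      simpa using h1
    have hne : -ξ ≠ 0 := fun h => by simp [h] at hre
    have harg := Complex.abs_arg_lt_pi_div_two_iff.2 (Or.inl hre)
    rw [abs_lt] at harg
    have hη : (x + Real.arctan (Real.tan (-ξ).arg) * Complex.I : ℂ) = Complex.log (-ξ) := by
      rw [Real.arctan_tan harg.1 harg.2, Complex.log, norm_neg, heq, hρ, Real.log_exp]
    refine hCγ z hz (Real.tan (-ξ).arg) ?_
    rw [hη, crosscutMap, Complex.exp_log hne, Complex.exp_neg, hξy]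
    convert discInv_discMap hκ hs.1 hs.2 hza using 2
    rw [drivingRatio]
    have := hκ.ne_zero hs
    have hs0 : (s : ℂ) ≠ 0 := Complex.ofReal_ne_zero.2 hs.1.ne'
    field_simp
  obtain ⟨y, -, hy₁, hy₂⟩ := hpre V₁ V₂ hV₁o hV₂o hcover ⟨_, mem_image_of_mem _ h₁, by
      obtain ⟨h3, h4⟩ := norm_log_lt_of_norm_one_sub_lt hr1 h₁r
      exact ⟨h3, h4.trans hrρ⟩⟩ ⟨_, mem_image_of_mem _ h₂, by
      rintro ⟨ξ, hξ, hξy⟩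
      rw [mem_closedBall_zero_iff] at hξ
      have h1 := norm_drivingRatio hκ hs z₂
      rw [(norm_discMap_eq_one_iff hκ hs.1 hs.2 (hCsub h₂)).2 hz₂, div_one, ← hξy,
        Complex.norm_exp] at h1
      have h2 : ξ.re = 4 * Real.log s := by
        rw [← Real.log_exp ξ.re, h1, Real.log_pow]; norm_num
      linarith [(abs_le.1 (Complex.abs_re_le_norm ξ)).1]⟩
  exact hy₂ ⟨Complex.log y, mem_closedBall_zero_iff.2 hy₁.2.le,
    Complex.exp_log (Complex.slitPlane_ne_zero hy₁.1)⟩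

lemma crosscut_mem_disconnectingCurves (hκ : IsDriving κ) {s₀ : ℝ} (hs : s ∈ Ioo 0 1)
    (h0 : s₀ ≤ s) (hr : 0 < r) (hrR : r < R)
    (hRs : R ≤ -(4 * Real.log s)) (hr1 : r ≤ 3 / 4) (hRpi : R ≤ Real.pi)
    (hsurv : ∀ z ∈ aliveDomain κ s, ‖z‖ ≤ 1 → 2 / 3 * r ≤ ‖1 - drivingRatio κ s z‖ →
      z ∈ aliveDomain κ s') {x : ℝ} (hx : x ∈ Ioo (Real.log r) (Real.log R)) :
    (fun u : ℝ => crosscutMap κ s (x + Real.arctan u * Complex.I)) ∈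
      disconnectingCurves (disc \ hull κ s₀) (frontier disc) (hull κ s \ hull κ s₀)
        (hull κ s' \ hull κ s₀) := by
  refine ⟨locallyLipschitz_crosscut hκ hs hr hrR hRs hx, ?_, ?_⟩
  · rintro _ ⟨u, rfl⟩
    have hη := arctan_mem_crosscutRect hx u
    set η : ℂ := x + Real.arctan u * Complex.I with hηdef
    obtain ⟨h1, h2, h3⟩ := crosscutMap_mem hκ hs hr hrR hRs hη
    have h4 : crosscutMap κ s η ∈ aliveDomain κ s' := by
      refine hsurv _ h1 h2.le ?_
      by_contra! hlt
      obtain ⟨-, h5⟩ := norm_log_lt_of_norm_one_sub_lt hr1 hlt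
      obtain ⟨h6, h7, -⟩ := norm_exp_mem hr hrR hη
      have him := abs_im_lt_of_norm_lt (ξ := -Complex.exp η) hRpi (by rwa [norm_neg])
      rw [h3, Complex.log_exp him.1 him.2.le, norm_neg] at h5
      exact h5.not_gt h6
    exact ⟨⟨mem_disc_iff.2 h2, fun h => h.2 (aliveDomain_anti h0 h1)⟩, fun h => h.1.2 h4⟩
  · rintro C hC hsub ⟨z₁, h₁, hz₁⟩ ⟨z₂, h₂, hz₂⟩
    rw [frontier_disc] at hsub hz₂
    have hCd : ∀ z ∈ C, z ∈ aliveDomain κ s ∧ ‖z‖ ≤ 1 := by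
      intro z hz
      rcases (hsub hz).1 with h | h
      · have : z ∈ disc \ hull κ s := ⟨h.1.1, fun h3 => h.2 ⟨h3, h.1.2⟩⟩
        obtain ⟨h3, h4⟩ := mem_disc_diff_hull_iff.1 this
        exact ⟨h4, h3.le⟩
      · have h3 := mem_sphere_zero_iff_norm.1 h
        exact ⟨sphere_subset_aliveDomain hκ hs.1.le hs.2 h3, h3.le⟩
    refine crosscut_separates hκ hs hr hrR hRs hr1 hRpi hx hC (fun z hz => (hCd z hz).1)
      (fun z hz u hu => (hsub hz).2 ⟨u, hu⟩) h₁ ?_ h₂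
      (mem_sphere_zero_iff_norm.1 hz₂)
    by_contra! hge
    exact hz₁.1.1.2 (hsurv z₁ (hCd z₁ h₁).1 (hCd z₁ h₁).2 hge)

lemma extremalLength_le (hκ : IsDriving κ) {s₀ : ℝ} (hs : s ∈ Ioo 0 1)
    (h0 : s₀ ≤ s) (hr : 0 < r) (hrR : r < R)
    (hRs : R ≤ -(4 * Real.log s)) (hr1 : r ≤ 3 / 4) (hRpi : R ≤ Real.pi)
    (hsurv : ∀ z ∈ aliveDomain κ s, ‖z‖ ≤ 1 → 2 / 3 * r ≤ ‖1 - drivingRatio κ s z‖ →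
      z ∈ aliveDomain κ s') :
    extremalLength (disconnectingCurves (disc \ hull κ s₀) (frontier disc)
      (hull κ s \ hull κ s₀) (hull κ s' \ hull κ s₀)) ≤
        ENNReal.ofReal (Real.pi / (Real.log R - Real.log r)) :=
  extremalLength_le_of_rectangle (Real.log_lt_log hr hrR) rfl
    (differentiableOn_crosscutMap hκ hs hr hrR hRs) (injOn_crosscutMap hκ hs hr hrR hRs hRpi)
    fun _ hx => crosscut_mem_disconnectingCurves hκ hs h0 hr hrR hRs hr1 hRpi hsurv hx

end Crosscut

/-- Up to a time `b < 1`, the extremal length in question is uniformly small. -/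
lemma exists_extremalLength_lt (hκ : IsDriving κ) {a : ℝ} (ha : 0 < a) (hb : b < 1) (hε : 0 < ε) :
    ∃ δ > 0, ∀ s ∈ Icc a b, ∀ s' ∈ Icc s b, s' - s ≤ δ → ∀ s₀ ≤ s,
      extremalLength (disconnectingCurves (disc \ hull κ s₀) (frontier disc)
        (hull κ s \ hull κ s₀) (hull κ s' \ hull κ s₀)) < ENNReal.ofReal ε := by
  rcases lt_or_ge b a with hba | hab
  · exact ⟨1, one_pos, fun s hs => absurd (hs.1.trans hs.2) hba.not_ge⟩
  have hb0 : 0 < b := ha.trans_le hab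
  have hlog : 0 < -(4 * Real.log b) := by linarith [Real.log_neg hb0 hb]
  set R := min (3 / 4) (-(4 * Real.log b)) with hR
  have hR0 : 0 < R := lt_min (by norm_num) hlog
  set r := R * Real.exp (-(2 * Real.pi / ε)) with hr
  have hq : 0 < 2 * Real.pi / ε := by positivity
  have hr0 : 0 < r := by positivity
  have hrR : r < R := mul_lt_of_lt_one_right hR0 (Real.exp_lt_one_iff.2 (by linarith))
  have hmod : Real.log R - Real.log r = 2 * Real.pi / ε := by
    rw [hr, Real.log_mul hR0.ne' (Real.exp_pos _).ne', Real.log_exp]; ring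
  have hR34 : R ≤ 3 / 4 := min_le_left _ _
  obtain ⟨δ, hδ, h⟩ := exists_forward_survival hκ ha hb (r := 2 / 3 * r) (by positivity)
  refine ⟨δ, hδ, fun s hs s' hs' hd s₀ h0 => ?_⟩
  have hs0 : 0 < s := ha.trans_le hs.1
  have hss : s ∈ Ioo 0 1 := ⟨hs0, hs.2.trans_lt hb⟩
  refine (extremalLength_le hκ hss h0 hr0 hrR ?_ (hrR.le.trans hR34)
    (hR34.trans (by linarith [Real.pi_gt_three])) ?_).trans_lt ?_
  · have := Real.log_le_log hs0 hs.2
    linarith [min_le_right (3 / 4) (-(4 * Real.log b))]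
  · rintro _ ⟨ζ, hζ, rfl⟩ h1 h2
    refine mem_image_of_mem _ (h s hs s' hs' hd ζ hζ ?_ ?_)
    · rwa [Complex.norm_exp, Real.exp_le_one_iff] at h1
    · rwa [drivingRatio, discMap_exp hκ hs0.le hss.2 hζ] at h2
  · rw [hmod]
    refine (ENNReal.ofReal_lt_ofReal_iff hε).2 ?_
    have hpi := Real.pi_pos
    field_simp
    linarith

/-! ### Lifting solutions to logarithmic coordinates -/

lemma field_congr {L L' : ℂ} (h : Complex.exp L = Complex.exp L') : field κ σ L = field κ σ L' := by
  rw [field, field, h]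

/-- A continuous path `G` that solves the exponentiated equation, also at time `0`, lifts to a
trajectory, so that its starting point survives and `G` is the orbit of this point. -/
lemma mem_aliveDomain_of_solution (hκ : IsDriving κ) (hb0 : 0 < b) (hb : b < 1) {G : ℝ → ℂ}
    (hc : ContinuousOn G (Icc 0 b))
    (hd : ∀ σ ∈ Ioc 0 b, HasDerivWithinAt G (G σ * field κ σ (Complex.log (G σ))) (Ioc 0 b) σ)
    (hlow : ∀ σ ∈ Icc 0 b, σ ^ 4 < ‖G σ‖) (hup : ∀ σ ∈ Icc 0 b, ‖G σ‖ ≤ 1) :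
    G 0 ∈ aliveDomain κ b ∧ discMap κ b (G 0) = G b := by
  have hGpos : ∀ σ ∈ Icc 0 b, 0 < ‖G σ‖ := fun σ hσ => by
    have := hlow σ hσ
    have := hσ.1
    have : 0 ≤ σ ^ 4 := by positivity
    linarith
  have hGne : ∀ σ ∈ Icc 0 b, G σ ≠ 0 := fun σ hσ => norm_pos_iff.1 (hGpos σ hσ)
  -- compactness keeps the path uniformly away from the inner circles
  obtain ⟨ε, hε, hεG⟩ : ∃ ε > 0, ∀ σ ∈ Icc 0 b, ε ≤ ‖G σ‖ - σ ^ 4 := by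
    obtain ⟨σ₀, h0, hmin⟩ := isCompact_Icc.exists_isMinOn (nonempty_Icc.2 hb0.le)
      (hc.norm.sub ((continuous_pow 4).continuousOn (s := Icc 0 b)))
    exact ⟨‖G σ₀‖ - σ₀ ^ 4, sub_pos.2 (hlow σ₀ h0), fun σ hσ => hmin hσ⟩
  have hreg : ∀ σ ∈ Icc 0 b, ∀ L, Complex.exp L = G σ → L ∈ clipRegion ε σ := by
    intro σ hσ L hL
    have hn : Real.exp L.re = ‖G σ‖ := by rw [← hL, Complex.norm_exp]
    have hre : L.re ≤ 0 := Real.exp_le_one_iff.1 (hn ▸ hup σ hσ)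
    rw [clipRegion, mem_ofPred_eq, abs_of_nonpos hre, Real.exp_neg, hn, ← div_eq_mul_inv,
      div_le_one (hGpos σ hσ)]
    have h1 : ε * σ ^ 2 ≤ ε * 1 :=
      mul_le_mul_of_nonneg_left (pow_le_one₀ hσ.1 (hσ.2.trans hb.le)) hε.le
    linarith [hεG σ hσ]
  have hexp : ∀ σ ∈ Icc 0 b, Complex.exp (Complex.log (G σ)) = G σ := fun σ hσ =>
    Complex.exp_log (hGne σ hσ)
  have hN : ContinuousOn (fun σ => field κ σ (Complex.log (G σ))) (Icc 0 b) :=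
    continuousOn_field hκ hε hb
      ((hc.mono Ioc_subset_Icc_self).congr fun σ hσ => hexp σ (Ioc_subset_Icc_self hσ))
      fun σ hσ => hreg σ (Ioc_subset_Icc_self hσ) _ (hexp σ (Ioc_subset_Icc_self hσ))
  set N := IccExtend hb0.le (domRestrict (Icc 0 b) fun σ => field κ σ (Complex.log (G σ)))
    with hNdef
  have hNc : Continuous N := hN.domRestrict.Icc_extend'
  have hNeq : ∀ σ ∈ Icc 0 b, N σ = field κ σ (Complex.log (G σ)) := fun σ hσ =>
    IccExtend_of_mem hb0.le _ hσ
  set L : ℝ → ℂ := fun σ => Complex.log (G 0) + ∫ x in (0 : ℝ)..σ, N x with hL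
  have hLd : ∀ σ, HasDerivAt L (N σ) σ := fun σ =>
    (hNc.integral_hasStrictDerivAt 0 σ).hasDerivAt.const_add _
  have hL0 : L 0 = Complex.log (G 0) := by simp [hL]
  have h0b : (0 : ℝ) ∈ Icc 0 b := ⟨le_rfl, hb0.le⟩
  have hbb : b ∈ Icc 0 b := ⟨hb0.le, le_rfl⟩
  -- the quotient of `G` and `exp L` is constant
  set Q : ℝ → ℂ := fun σ => G σ * Complex.exp (-L σ) with hQ
  have hLc : Continuous L := continuous_iff_continuousAt.2 fun σ => (hLd σ).continuousAt
  have hQc : ContinuousOn Q (Icc 0 b) := hc.mul hLc.neg.cexp.continuousOn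
  have hQb : ∀ σ ∈ Ioc 0 b, Q b = Q σ := by
    intro σ hσ
    refine constant_of_has_deriv_right_zero (hQc.mono (Icc_subset_Icc_left hσ.1.le)) ?_ b
      ⟨hσ.2, le_rfl⟩
    intro x hx
    have hx0 : 0 < x := hσ.1.trans_le hx.1
    have hd1 : HasDerivAt G (G x * N x) x := by
      rw [hNeq x ⟨hx0.le, hx.2.le⟩]
      exact (hd x ⟨hx0, hx.2.le⟩).hasDerivAt (Ioc_mem_nhds hx0 hx.2)
    have hd2 := hd1.mul (hLd x).neg.cexp
    refine HasDerivAt.hasDerivWithinAt (hd2.congr_deriv ?_)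
    simp only [Pi.neg_apply]
    ring
  have hQ0 : Q b = Q 0 := by
    have h1 : Tendsto Q (𝓝[Ioc 0 b] 0) (𝓝 (Q 0)) :=
      (hQc 0 h0b).mono_left (nhdsWithin_mono _ Ioc_subset_Icc_self)
    have h2 : Tendsto Q (𝓝[Ioc 0 b] 0) (𝓝 (Q b)) :=
      tendsto_const_nhds.congr' (by filter_upwards [self_mem_nhdsWithin] with σ hσ using hQb σ hσ)
    have : (𝓝[Ioc 0 b] (0 : ℝ)).NeBot := by
      rw [nhdsWithin_Ioc_eq_nhdsGT hb0]; infer_instance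
    exact tendsto_nhds_unique h2 h1
  have hQ1 : Q 0 = 1 := by
    rw [hQ]
    simp only [hL0, Complex.exp_neg, hexp 0 h0b]
    exact mul_inv_cancel₀ (hGne 0 h0b)
  have hLG : ∀ σ ∈ Icc 0 b, Complex.exp (L σ) = G σ := by
    intro σ hσ
    have h1 : Q σ = 1 := by
      rcases hσ.1.eq_or_lt with rfl | h
      · exact hQ1
      · rw [← hQb σ ⟨h, hσ.2⟩, hQ0, hQ1]
    rw [hQ] at h1
    simp only [Complex.exp_neg] at h1
    exact ((mul_inv_eq_one₀ (Complex.exp_ne_zero _)).1 h1).symm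
  have htraj : IsTraj κ ε b L := by
    refine ⟨fun σ hσ => ?_, fun σ hσ => hreg σ hσ _ (hLG σ hσ)⟩
    rw [field_congr ((hLG σ hσ).trans (hexp σ hσ).symm), ← hNeq σ hσ]
    exact (hLd σ).hasDerivWithinAt
  have halive := htraj.mem_aliveSet hε le_rfl
  refine ⟨⟨L 0, halive, hLG 0 h0b⟩, ?_⟩
  rw [← hLG 0 h0b, discMap_exp hκ hb0.le hb halive, htraj.flow_eq hκ hε hb hbb, hLG b hbb]

/-! ### The standard disc Loewner hulls and maps -/

/-- The driving function in the time variable `σ = e^{t/4}`. -/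
noncomputable def driving (χ : ℝ → ℂ) (σ : ℝ) : ℂ := χ (4 * Real.log σ)

/-- The standard disc Loewner hulls. -/
def discHull (χ : ℝ → ℂ) (t : ℝ) : Set ℂ := hull (driving χ) (Real.exp (t / 4))

/-- The standard disc Loewner maps. -/
noncomputable def loewnerMap (χ : ℝ → ℂ) (t : ℝ) (z : ℂ) : ℂ :=
  (Real.exp t : ℂ) / discMap (driving χ) (Real.exp (t / 4)) z

lemma exp_div_four_pow (t : ℝ) : Real.exp (t / 4) ^ 4 = Real.exp t := by
  rw [← Real.exp_nat_mul]; congr 1; push_cast; ring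

lemma exp_div_four_mem {t : ℝ} (ht : t < 0) : Real.exp (t / 4) ∈ Ioo 0 1 :=
  ⟨Real.exp_pos _, Real.exp_lt_one_iff.2 (by linarith)⟩

lemma driving_exp (χ : ℝ → ℂ) (t : ℝ) : driving χ (Real.exp (t / 4)) = χ t := by
  rw [driving, Real.log_exp]; congr 1; ring

lemma exp_four_mul_log (hσ : 0 < σ) : Real.exp (4 * Real.log σ) = σ ^ 4 := by
  rw [mul_comm, Real.exp_mul, Real.exp_log hσ]; norm_cast

lemma exp_four_mul_log_div (hσ : 0 < σ) : Real.exp (4 * Real.log σ / 4) = σ := by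
  rw [mul_div_cancel_left₀ _ (by norm_num), Real.exp_log hσ]

section Chain

variable {χ : ℝ → ℂ} {s t : ℝ} {z : ℂ}

lemma isDriving_driving (hχ : ContinuousOn χ (Iio 0)) (hχ_mem : ∀ t < 0, χ t ∈ circ 0) :
    IsDriving (driving χ) := by
  have hneg : ∀ σ ∈ Ioo (0 : ℝ) 1, 4 * Real.log σ < 0 := fun σ hσ => by
    linarith [Real.log_neg hσ.1 hσ.2]
  refine ⟨hχ.comp ?_ hneg, fun σ hσ => ?_⟩
  · exact continuousOn_const.mul (Real.continuousOn_log.mono fun σ hσ => hσ.1.ne')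
  · have := hχ_mem _ (hneg σ hσ)
    rw [circ, mem_sphere_zero_iff_norm, neg_zero, Real.exp_zero] at this
    exact this

lemma annulus_abs (ht : t < 0) : annulus |t| = {w | Real.exp t < ‖w‖ ∧ ‖w‖ < 1} := by
  rw [annulus, abs_of_neg ht, neg_neg]

lemma norm_loewnerMap (z : ℂ) :
    ‖loewnerMap χ t z‖ = Real.exp t / ‖discMap (driving χ) (Real.exp (t / 4)) z‖ := by
  rw [loewnerMap, norm_div, Complex.norm_real, Real.norm_of_nonneg (Real.exp_pos t).le]

lemma exp_div_loewnerMap (z : ℂ) :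
    (Real.exp t : ℂ) / loewnerMap χ t z = discMap (driving χ) (Real.exp (t / 4)) z := by
  rw [loewnerMap, div_div_cancel₀]
  exact Complex.ofReal_ne_zero.2 (Real.exp_pos t).ne'

lemma differentiableOn_loewnerMap (hκ : IsDriving (driving χ)) (ht : t < 0) :
    DifferentiableOn ℂ (loewnerMap χ t) (aliveDomain (driving χ) (Real.exp (t / 4))) := by
  obtain ⟨h0, h1⟩ := exp_div_four_mem ht
  exact (differentiableOn_const _).div (differentiableOn_discMap hκ h0 h1)
    fun z _ => discMap_ne_zero _ _ _

lemma isConformalOnto_loewnerMap (hκ : IsDriving (driving χ)) (ht : t < 0) :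
    IsConformalOnto (loewnerMap χ t) (disc \ discHull χ t) (annulus |t|) := by
  obtain ⟨h0, h1⟩ := exp_div_four_mem ht
  have hsub : disc \ discHull χ t ⊆ aliveDomain (driving χ) (Real.exp (t / 4)) := fun z hz =>
    (mem_disc_diff_hull_iff.1 hz).2
  have hE := Real.exp_pos t
  refine ⟨(differentiableOn_loewnerMap hκ ht).mono hsub, fun z hz z' hz' h => ?_, ?_⟩
  · refine injOn_discMap hκ h0 h1 (hsub hz) (hsub hz') ?_
    rw [← exp_div_loewnerMap, h, exp_div_loewnerMap]
  · rw [annulus_abs ht]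
    have himg := discMap_image hκ h0 h1
    rw [exp_div_four_pow] at himg
    -- the inversion `w ↦ e^t / w` preserves the annulus
    have hinv : ∀ w : ℂ, Real.exp t < ‖w‖ → ‖w‖ < 1 →
        Real.exp t < ‖(Real.exp t : ℂ) / w‖ ∧ ‖(Real.exp t : ℂ) / w‖ < 1 := by
      intro w hw1 hw2
      have hw : 0 < ‖w‖ := hE.trans hw1
      rw [norm_div, Complex.norm_real, Real.norm_of_nonneg hE.le, lt_div_iff₀ hw, div_lt_one hw]
      exact ⟨mul_lt_of_lt_one_right hE hw2, hw1⟩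
    ext w
    constructor
    · rintro ⟨z, hz, rfl⟩
      have : discMap (driving χ) (Real.exp (t / 4)) z ∈ {w : ℂ | Real.exp t < ‖w‖ ∧ ‖w‖ < 1} :=
        himg ▸ mem_image_of_mem _ hz
      exact hinv _ this.1 this.2
    · rintro ⟨hw1, hw2⟩
      have h2 : (Real.exp t : ℂ) / w ∈ {w : ℂ | Real.exp t < ‖w‖ ∧ ‖w‖ < 1} := hinv w hw1 hw2
      rw [← himg] at h2
      obtain ⟨z, hz, hzw⟩ := h2
      refine ⟨z, hz, ?_⟩
      rw [loewnerMap, hzw, div_div_cancel₀]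
      exact Complex.ofReal_ne_zero.2 hE.ne'

lemma mem_circ_zero : z ∈ circ 0 ↔ ‖z‖ = 1 := by
  rw [circ, mem_sphere_zero_iff_norm, neg_zero, Real.exp_zero]

lemma mapsBoundaryOnto_loewnerMap (hκ : IsDriving (driving χ)) (ht : t < 0) :
    MapsBoundaryOnto (loewnerMap χ t) (disc \ discHull χ t) (circ 0) (circ |t|) := by
  obtain ⟨h0, h1⟩ := exp_div_four_mem ht
  have hE := Real.exp_pos t
  have hcirc : ∀ z ∈ circ 0, z ∈ aliveDomain (driving χ) (Real.exp (t / 4)) := fun z hz =>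
    sphere_subset_aliveDomain hκ h0.le h1 (mem_circ_zero.1 hz)
  refine ⟨loewnerMap χ t, (differentiableOn_loewnerMap hκ ht).continuousOn.mono ?_,
    fun _ _ => rfl, ?_⟩
  · rintro z (hz | hz)
    · exact (mem_disc_diff_hull_iff.1 hz).2
    · exact hcirc z hz
  · ext w
    rw [circ.eq_def |t|, mem_sphere_zero_iff_norm, abs_of_neg ht, neg_neg]
    constructor
    · rintro ⟨z, hz, rfl⟩
      rw [norm_loewnerMap, (norm_discMap_eq_one_iff hκ h0 h1 (hcirc z hz)).2 (mem_circ_zero.1 hz),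
        div_one]
    · intro hw
      have hn : ‖(Real.exp t : ℂ) / w‖ = 1 := by
        rw [norm_div, Complex.norm_real, Real.norm_of_nonneg hE.le, hw, div_self hE.ne']
      have hm : (Real.exp t : ℂ) / w ∈ doubleAnnulus (Real.exp (t / 4)) :=
        mem_doubleAnnulus_of_le_one h0 h1
          (by rw [exp_div_four_pow, hn]; exact Real.exp_lt_one_iff.2 ht) hn.le
      refine ⟨discInv (driving χ) (Real.exp (t / 4)) ((Real.exp t : ℂ) / w), ?_, ?_⟩
      · rw [mem_circ_zero, ← norm_discMap_eq_one_iff hκ h0 h1 (discInv_mem hκ h0 h1 hm),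
          discMap_discInv hκ h0 h1 hm, hn]
      · rw [loewnerMap, discMap_discInv hκ h0 h1 hm, div_div_cancel₀]
        exact Complex.ofReal_ne_zero.2 hE.ne'

/-- The field in terms of the Schwarz function at a point `w` of the annulus. -/
lemma field_eq_schwarzS (ht : t < 0) {w L : ℂ} (hw0 : Real.exp t < ‖w‖) (hw1 : ‖w‖ < 1)
    (hw : (Real.exp t : ℂ) * (Complex.exp L * χ t)⁻¹ = w) :
    field (driving χ) (Real.exp (t / 4)) L =
      4 / (Real.exp (t / 4) : ℂ) * (1 - schwarzS |t| w) := by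
  have hq : (Real.exp (t / 4) ^ 4) ^ 2 = Real.exp (-2 * |t|) := by
    rw [exp_div_four_pow, ← Real.exp_nat_mul, abs_of_neg ht]; congr 1; push_cast; ring
  have hE : ((Real.exp (t / 4) : ℝ) : ℂ) ^ 4 = (Real.exp t : ℂ) := by
    rw [← exp_div_four_pow t]; push_cast; rfl
  have hq' : (((Real.exp (t / 4) ^ 4 : ℝ) : ℂ)) ^ 2 = ((Real.exp (-2 * |t|) : ℝ) : ℂ) := by
    rw [← hq]; push_cast; rfl
  have hqlt : Real.exp (-2 * |t|) < ‖w‖ := by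
    refine lt_trans (Real.exp_lt_exp.2 ?_) hw0
    rw [abs_of_neg ht]; linarith
  rw [field_eq (Real.exp_pos _).ne', schwarzS_eq (abs_pos.2 ht.ne) hqlt hw1, driving_exp, hE, hw,
    hq, hq']

lemma hasDerivWithinAt_loewnerMap (hκ : IsDriving (driving χ)) (ht : t < 0)
    (hχ1 : ‖χ t‖ = 1) (hz : z ∈ disc \ discHull χ t) :
    HasDerivWithinAt (fun s => loewnerMap χ s z)
      (loewnerMap χ t z * schwarzS |t| (loewnerMap χ t z / χ t))
      {s | s < 0 ∧ z ∈ disc \ discHull χ s} t := by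
  obtain ⟨h0, h1⟩ := exp_div_four_mem ht
  have hring : loewnerMap χ t z ∈ annulus |t| :=
    (isConformalOnto_loewnerMap hκ ht).image_eq ▸ mem_image_of_mem _ hz
  rw [annulus_abs ht] at hring
  obtain ⟨-, ζ, ⟨ε, hε, γ₀, hγ₀, hγ₀0⟩, rfl⟩ := mem_disc_diff_hull_iff.1 hz
  -- the trajectory continues beyond the time `t`
  obtain ⟨b', hb', ε', hε', γ, hγ, hγ0⟩ := hγ₀.exists_extension hκ hε h0.le h1
  rw [hγ₀0] at hγ0
  have hval : ∀ s, Real.exp (s / 4) ∈ Icc 0 b' → loewnerMap χ s (Complex.exp ζ) =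
      (Real.exp s : ℂ) * Complex.exp (-γ (Real.exp (s / 4))) := by
    intro s hs
    rw [loewnerMap, discMap_exp hκ hs.1 (hs.2.trans_lt hb'.2)
      (hγ0 ▸ hγ.mem_aliveSet hε' hs.2), ← hγ0, hγ.flow_eq hκ hε' hb'.2 hs, Complex.exp_neg,
      div_eq_mul_inv]
  have htb : Real.exp (t / 4) ∈ Icc 0 b' := ⟨h0.le, hb'.1.le⟩
  set b := Real.exp (t / 4) with hb
  have hdγ : HasDerivAt γ (field (driving χ) b (γ b)) b :=
    (hγ.hasDeriv b htb).hasDerivAt (Icc_mem_nhds h0 hb'.1)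
  have hdexp : HasDerivAt (fun s : ℝ => Real.exp (s / 4)) (b * (1 / 4)) t :=
    ((hasDerivAt_id t).div_const 4).exp
  have hd1 : HasDerivAt (fun s : ℝ => (Real.exp s : ℂ)) (Real.exp t : ℂ) t :=
    (Real.hasDerivAt_exp t).ofReal_comp
  have hd2 : HasDerivAt (fun s : ℝ => γ (Real.exp (s / 4)))
      ((b * (1 / 4)) • field (driving χ) b (γ b)) t := HasDerivAt.scomp t hdγ hdexp
  have hd3 := hd1.mul hd2.neg.cexp
  have hnear : ∀ᶠ s in 𝓝 t, Real.exp (s / 4) ∈ Icc 0 b' := by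
    have hc : ContinuousAt (fun s : ℝ => Real.exp (s / 4)) t := by fun_prop
    filter_upwards [hc.eventually (gt_mem_nhds hb'.1)] with s hs
    exact ⟨(Real.exp_pos _).le, hs.le⟩
  have hd4 : HasDerivAt (fun s => loewnerMap χ s (Complex.exp ζ)) _ t :=
    hd3.congr_of_eventuallyEq (hnear.mono fun s hs => hval s hs)
  refine HasDerivAt.hasDerivWithinAt (hd4.congr_deriv ?_)
  have hχ0 : χ t ≠ 0 := fun h => by simp [h] at hχ1
  have hw : (Real.exp t : ℂ) * (Complex.exp (γ b) * χ t)⁻¹ =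
      loewnerMap χ t (Complex.exp ζ) / χ t := by
    rw [hval t htb, Complex.exp_neg, mul_inv, div_eq_mul_inv, mul_assoc]
  have hwn : ‖loewnerMap χ t (Complex.exp ζ) / χ t‖ = ‖loewnerMap χ t (Complex.exp ζ)‖ := by
    rw [norm_div, hχ1, div_one]
  rw [field_eq_schwarzS ht (hwn ▸ hring.1) (hwn ▸ hring.2) hw, hval t htb]
  have hbne : (b : ℂ) ≠ 0 := Complex.ofReal_ne_zero.2 h0.ne'
  simp only [Pi.neg_apply, ← hb, Complex.real_smul]
  generalize schwarzS |t| _ = S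
  rw [Complex.ofReal_mul]
  push_cast
  field_simp
  ring

lemma tendsto_exp_div_four : Tendsto (fun t : ℝ => Real.exp (t / 4)) atBot (𝓝[>] 0) := by
  rw [tendsto_nhdsWithin_iff]
  refine ⟨Real.tendsto_exp_atBot.comp (tendsto_id.atBot_div_const (by norm_num)),
    Eventually.of_forall fun t => Real.exp_pos _⟩

lemma tendsto_loewnerMap (hκ : IsDriving (driving χ)) (hz : z ≠ 0) :
    (∀ᶠ t in atBot, z ∉ discHull χ t) ∧
      Tendsto (fun t : ℝ => (Real.exp t : ℂ) / loewnerMap χ t z) atBot (𝓝 z) := by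
  obtain ⟨b, hb, ε, hε, γ, hγ, hγ0⟩ := exists_isTraj hκ (Complex.log z)
  have hexp : Complex.exp (γ 0) = z := by rw [hγ0, Complex.exp_log hz]
  have hev : ∀ᶠ t in atBot, Real.exp (t / 4) ∈ Ioc 0 b :=
    tendsto_exp_div_four.eventually (Ioc_mem_nhdsGT hb.1)
  have halive : ∀ σ ∈ Ioc 0 b, γ 0 ∈ aliveSet (driving χ) σ := fun σ hσ =>
    hγ.mem_aliveSet hε hσ.2
  constructor
  · filter_upwards [hev] with t ht hzt
    exact hzt.2 ⟨γ 0, halive _ ht, hexp⟩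
  · have hc : Tendsto (fun σ => Complex.exp (γ σ)) (𝓝[>] 0) (𝓝 z) := by
      rw [← hexp]
      refine (Complex.continuous_exp.tendsto _).comp ?_
      rw [← nhdsWithin_Ioc_eq_nhdsGT hb.1]
      exact (hγ.continuousOn 0 ⟨le_rfl, hb.1.le⟩).mono_left
        (nhdsWithin_mono _ Ioc_subset_Icc_self)
    refine (hc.comp tendsto_exp_div_four).congr' ?_
    filter_upwards [hev] with t ht
    rw [exp_div_loewnerMap, ← hexp, discMap_exp hκ ht.1.le (ht.2.trans_lt hb.2) (halive _ ht),
      hγ.flow_eq hκ hε hb.2 ⟨ht.1.le, ht.2⟩]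
    rfl

lemma discHull_ssubset (hκ : IsDriving (driving χ)) (hst : s < t) (ht : t < 0) :
    discHull χ s ⊂ discHull χ t :=
  hull_ssubset hκ (Real.exp_pos _) (Real.exp_lt_exp.2 (by linarith)) (exp_div_four_mem ht).2

lemma discHull_subset (hκ : IsDriving (driving χ)) (hst : s ≤ t) (ht : t < 0) :
    discHull χ s ⊆ discHull χ t := by
  rcases hst.eq_or_lt with rfl | h
  · exact Subset.rfl
  · exact (discHull_ssubset hκ h ht).subset

lemma isLoewnerChainOn_discHull (hκ : IsDriving (driving χ)) {t₀ : ℝ} (ht₀ : t₀ < 0) :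
    IsLoewnerChainOn (disc \ discHull χ t₀) (frontier (discHull χ t₀)) (frontier disc)
      (fun t => discHull χ t \ discHull χ t₀) t₀ 0 := by
  obtain ⟨h0, h1⟩ := exp_div_four_mem ht₀
  refine ⟨isDoublyConnected_disc_diff_hull hκ h0 h1, fun s hs => ⟨?_, ?_⟩, ?_, ?_⟩
  · exact sdiff_subset_sdiff_left
      (hull_subset_disc hκ (exp_div_four_mem hs.2).1.le (exp_div_four_mem hs.2).2)
  · refine ⟨frontier (discHull χ s), ?_⟩
    have : (disc \ discHull χ t₀) \ (discHull χ s \ discHull χ t₀) = disc \ discHull χ s := by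
      have hsub := discHull_subset hκ hs.1 hs.2
      ext z
      constructor
      · exact fun h => ⟨h.1.1, fun h' => h.2 ⟨h', h.1.2⟩⟩
      · exact fun h => ⟨⟨h.1, fun h' => h.2 (hsub h')⟩, fun h' => h.2 h'.1⟩
    rw [this]
    exact isDoublyConnected_disc_diff_hull hκ (exp_div_four_mem hs.2).1 (exp_div_four_mem hs.2).2
  · intro s₁ s₂ hs₁ hs hs₂
    have hsub := discHull_subset hκ hs₁ (hs.trans hs₂)
    obtain ⟨h2, h3⟩ := discHull_ssubset hκ hs hs₂
    refine ⟨sdiff_subset_sdiff_left h2, fun h => h3 fun z hz => ?_⟩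
    by_cases hz0 : z ∈ discHull χ t₀
    · exact hsub hz0
    · exact (h ⟨hz, hz0⟩).1
  · intro c hc ε hε
    obtain ⟨δ, hδ, h⟩ := exists_extremalLength_lt hκ h0
      (exp_div_four_mem (t := c / 2) (by linarith [hc.2])).2 hε
    refine ⟨min δ (-(c / 2)), lt_min hδ (by linarith [hc.2]), fun u hu s hs _ => ?_⟩
    have hu1 := hu.2.trans_le (min_le_left _ _)
    have hu2 := hu.2.trans_le (min_le_right _ _)
    have hs1 := hs.1
    have hs2 := hs.2
    have hu0 := hu.1
    have hc0 := hc.2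
    refine h _ ⟨Real.exp_le_exp.2 (by linarith), Real.exp_le_exp.2 (by linarith)⟩ _
      ⟨Real.exp_le_exp.2 (by linarith), Real.exp_le_exp.2 (by linarith)⟩ ?_ _
      (Real.exp_le_exp.2 (by linarith))
    -- the exponential function is a contraction on the negative half-line
    have e1 : Real.exp ((s + u) / 4) ≤ 1 := Real.exp_le_one_iff.2 (by linarith)
    have e2 := Real.add_one_le_exp (s / 4 - (s + u) / 4)
    have e3 : Real.exp (s / 4) =
        Real.exp ((s + u) / 4) * Real.exp (s / 4 - (s + u) / 4) := by
      rw [← Real.exp_add]; congr 1; ring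
    have e4 := mul_le_mul_of_nonneg_left e2 (Real.exp_pos ((s + u) / 4)).le
    have e5 := mul_le_mul_of_nonneg_right e1 hu0.le
    nlinarith

lemma isStandardDiscLE_loewnerMap (hχ : ContinuousOn χ (Iio 0)) (hχ_mem : ∀ t < 0, χ t ∈ circ 0) :
    IsStandardDiscLE χ (discHull χ) (loewnerMap χ) := by
  have hκ := isDriving_driving hχ hχ_mem
  refine ⟨⟨fun t ht => isHullAt_hull hκ (exp_div_four_mem ht).1 (exp_div_four_mem ht).2,
      fun s t hst ht => discHull_ssubset hκ hst ht, fun t₀ ht₀ => isLoewnerChainOn_discHull hκ ht₀⟩,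
    fun t ht => isConformalOnto_loewnerMap hκ ht, fun t ht => mapsBoundaryOnto_loewnerMap hκ ht,
    fun t ht z hz => hasDerivWithinAt_loewnerMap hκ ht (mem_circ_zero.1 (hχ_mem t ht)) hz,
    fun z hz => tendsto_loewnerMap hκ hz.2⟩

/-! ### Uniqueness -/

/-- Every solution agrees with the standard one on its own domain: in the time variable `σ`, the
path `e^t / g_t(z)` extends continuously by `z` to `σ = 0` and lifts to a trajectory. -/
lemma IsStandardDiscLE.agree {F : ℝ → Set ℂ} {g : ℝ → ℂ → ℂ} (h : IsStandardDiscLE χ F g)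
    (hκ : IsDriving (driving χ)) (hχ_mem : ∀ t < 0, χ t ∈ circ 0) (ht : t < 0)
    (hz : z ∈ disc \ F t) : z ∈ disc \ discHull χ t ∧ g t z = loewnerMap χ t z := by
  obtain ⟨h0, h1⟩ := exp_div_four_mem ht
  set b := Real.exp (t / 4) with hb
  have hz0 : z ≠ 0 := by
    rintro rfl
    exact hz.2 ((h.isLoewnerChainAt.isHullAt t ht).ssubset.subset rfl)
  have hmem : ∀ s ≤ t, z ∈ disc \ F s := fun s hs => by
    rcases hs.eq_or_lt with rfl | hs
    · exact hz
    · exact ⟨hz.1, fun hzs => hz.2 ((h.isLoewnerChainAt.ssubset s t hs ht).subset hzs)⟩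
  have hann : ∀ s ≤ t, Real.exp s < ‖g s z‖ ∧ ‖g s z‖ < 1 := fun s hs => by
    have hs0 := hs.trans_lt ht
    have : g s z ∈ annulus |s| :=
      (h.isConformalOnto s hs0).image_eq ▸ mem_image_of_mem _ (hmem s hs)
    rwa [annulus_abs hs0] at this
  have htime : ∀ σ ∈ Ioc 0 b, 4 * Real.log σ ≤ t := fun σ hσ => by
    have := Real.log_le_log hσ.1 hσ.2
    rw [hb, Real.log_exp] at this
    linarith
  set G : ℝ → ℂ := Function.update (fun σ => (σ : ℂ) ^ 4 / g (4 * Real.log σ) z) 0 z with hG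
  have hGpos : ∀ σ, 0 < σ → G σ = (σ : ℂ) ^ 4 / g (4 * Real.log σ) z := fun σ hσ =>
    Function.update_of_ne hσ.ne' _ _
  have hG0 : G 0 = z := Function.update_self _ _ _
  have hgne : ∀ s ≤ t, g s z ≠ 0 := fun s hs =>
    norm_pos_iff.1 ((Real.exp_pos s).trans (hann s hs).1)
  have hGnorm : ∀ σ ∈ Ioc 0 b, ‖G σ‖ = σ ^ 4 / ‖g (4 * Real.log σ) z‖ := fun σ hσ => by
    rw [hGpos σ hσ.1, norm_div, norm_pow, Complex.norm_real, Real.norm_of_nonneg hσ.1.le]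
  have hd : ∀ σ ∈ Ioc 0 b,
      HasDerivWithinAt G (G σ * field (driving χ) σ (Complex.log (G σ))) (Ioc 0 b) σ := by
    intro σ hσ
    have hs := htime σ hσ
    set s := 4 * Real.log σ with hsdef
    have hs0 : s < 0 := hs.trans_lt ht
    have hσne : (σ : ℂ) ≠ 0 := Complex.ofReal_ne_zero.2 hσ.1.ne'
    have hlog : HasDerivWithinAt (fun σ : ℝ => 4 * Real.log σ) (4 * σ⁻¹) (Ioc 0 b) σ :=
      ((Real.hasDerivAt_log hσ.1.ne').const_mul 4).hasDerivWithinAt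
    have hg := HasDerivWithinAt.scomp (h := fun σ : ℝ => 4 * Real.log σ) σ
      (h.hasDeriv s hs0 z (hmem s hs)) hlog
      fun σ' hσ' => ⟨(htime σ' hσ').trans_lt ht, hmem _ (htime σ' hσ')⟩
    have hpow : HasDerivWithinAt (fun σ : ℝ => (σ : ℂ) ^ 4) (4 * (σ : ℂ) ^ 3) (Ioc 0 b) σ := by
      have := ((hasDerivAt_pow 4 (σ : ℂ)).comp_ofReal).hasDerivWithinAt (s := Ioc 0 b)
      simpa using this
    have hq := hpow.div hg (hgne s hs)
    have hGσ : G σ = (σ : ℂ) ^ 4 / g s z := hGpos σ hσ.1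
    have hGne : G σ ≠ 0 := by
      rw [hGσ]; exact div_ne_zero (pow_ne_zero 4 hσne) (hgne s hs)
    have hχ1 := mem_circ_zero.1 (hχ_mem s hs0)
    have hχ0 : χ s ≠ 0 := fun h => by simp [h] at hχ1
    have hwn : ‖g s z / χ s‖ = ‖g s z‖ := by rw [norm_div, hχ1, div_one]
    have hE : (Real.exp s : ℂ) = (σ : ℂ) ^ 4 := by
      rw [hsdef, exp_four_mul_log hσ.1]; push_cast; rfl
    have hfield := field_eq_schwarzS (χ := χ) (L := Complex.log (G σ)) (w := g s z / χ s) hs0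
      (hwn ▸ (hann s hs).1) (hwn ▸ (hann s hs).2) (by
        rw [Complex.exp_log hGne, hGσ, hE]
        have := hgne s hs
        field_simp)
    rw [hsdef, exp_four_mul_log_div hσ.1, ← hsdef] at hfield
    rw [hfield]
    refine (hq.congr_deriv ?_).congr (fun σ' hσ' => hGpos σ' hσ'.1) hGσ
    rw [hGσ]
    have := hgne s hs
    simp only [Function.comp_apply, ← hsdef]
    rw [Complex.real_smul]
    push_cast
    field_simp
  have hlow : ∀ σ ∈ Icc 0 b, σ ^ 4 < ‖G σ‖ := by
    intro σ hσ
    rcases hσ.1.eq_or_lt with rfl | hσ0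
    · rw [hG0]; simpa using hz0
    · have hs := hann _ (htime σ ⟨hσ0, hσ.2⟩)
      have : 0 < ‖g (4 * Real.log σ) z‖ := (Real.exp_pos _).trans hs.1
      rw [hGnorm σ ⟨hσ0, hσ.2⟩, lt_div_iff₀ this]
      exact mul_lt_of_lt_one_right (by positivity) hs.2
  have hup : ∀ σ ∈ Icc 0 b, ‖G σ‖ ≤ 1 := by
    intro σ hσ
    rcases hσ.1.eq_or_lt with rfl | hσ0
    · rw [hG0]; exact (mem_disc_iff.1 hz.1).le
    · have hs := hann _ (htime σ ⟨hσ0, hσ.2⟩)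
      rw [hGnorm σ ⟨hσ0, hσ.2⟩, div_le_one ((Real.exp_pos _).trans hs.1),
        ← exp_four_mul_log hσ0]
      exact hs.1.le
  have hc : ContinuousOn G (Icc 0 b) := by
    intro σ hσ
    rcases hσ.1.eq_or_lt with rfl | hσ0
    · have h4log : Tendsto (fun σ : ℝ => 4 * Real.log σ) (𝓝[>] 0) atBot :=
        Real.tendsto_log_nhdsGT_zero.const_mul_atBot (by norm_num)
      have hlim := (h.tendsto z ⟨hz.1, hz0⟩).2.comp h4log
      have hlim' : Tendsto G (𝓝[>] 0) (𝓝 (G 0)) := by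
        rw [hG0]
        refine hlim.congr' ?_
        filter_upwards [self_mem_nhdsWithin] with σ hσ
        rw [hGpos σ hσ, Function.comp_apply, exp_four_mul_log hσ]
        push_cast
        rfl
      have : ContinuousWithinAt G (Ioi 0) 0 := hlim'
      exact (continuousWithinAt_Ioi_iff_Ici.1 this).mono Icc_subset_Ici_self
    · refine (hd σ ⟨hσ0, hσ.2⟩).continuousWithinAt.mono_of_mem_nhdsWithin ?_
      rw [mem_nhdsWithin]
      exact ⟨Ioi 0, isOpen_Ioi, hσ0, fun σ' hσ' => ⟨hσ'.1, hσ'.2.2⟩⟩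
  obtain ⟨ha, hm⟩ := mem_aliveDomain_of_solution hκ h0 h1 hc hd hlow hup
  rw [hG0] at ha hm
  refine ⟨mem_disc_diff_hull_iff.2 ⟨mem_disc_iff.1 hz.1, ha⟩, ?_⟩
  have hbt : 4 * Real.log b = t := by rw [hb, Real.log_exp]; ring
  have hE : (b : ℂ) ^ 4 = (Real.exp t : ℂ) := by
    rw [← exp_div_four_pow t, Complex.ofReal_pow]
  rw [loewnerMap, ← hb, hm, hGpos b h0, hbt, hE, div_div_cancel₀]
  exact Complex.ofReal_ne_zero.2 (Real.exp_pos t).ne'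

end Chain

end DiscLoewner

theorem proposition4p1 (χ : ℝ → ℂ) (hχ : ContinuousOn χ (Set.Iio 0))
    (hχ_mem : ∀ t < 0, χ t ∈ DiscLoewner.circ 0) :
    ∃ (F : ℝ → Set ℂ) (g : ℝ → ℂ → ℂ), DiscLoewner.IsStandardDiscLE χ F g ∧
      ∀ (F' : ℝ → Set ℂ) (g' : ℝ → ℂ → ℂ), DiscLoewner.IsStandardDiscLE χ F' g' →
        ∀ t < 0, F' t = F t ∧ Set.EqOn (g' t) (g t) (DiscLoewner.disc \ F t) := by
  have hκ := DiscLoewner.isDriving_driving hχ hχ_mem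
  have hstd := DiscLoewner.isStandardDiscLE_loewnerMap hχ hχ_mem
  refine ⟨_, _, hstd, fun F' g' h' t ht => ?_⟩
  -- both maps have the same image, so the domain of the other one cannot be smaller
  have hsub : ∀ z ∈ DiscLoewner.disc \ DiscLoewner.discHull χ t, z ∈ DiscLoewner.disc \ F' t := by
    intro z hz
    have hgz : DiscLoewner.loewnerMap χ t z ∈ g' t '' (DiscLoewner.disc \ F' t) := by
      rw [(h'.isConformalOnto t ht).image_eq, ← (hstd.isConformalOnto t ht).image_eq]
      exact Set.mem_image_of_mem _ hz
    obtain ⟨z', hz', hzz'⟩ := hgz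
    obtain ⟨h1, h2⟩ := h'.agree hκ hχ_mem ht hz'
    rwa [(hstd.isConformalOnto t ht).injOn hz h1 (hzz'.symm.trans h2)]
  have hF' := (h'.isLoewnerChainAt.isHullAt t ht).subset
  have hF := (hstd.isLoewnerChainAt.isHullAt t ht).subset
  refine ⟨Set.Subset.antisymm (fun z hz => ?_) (fun z hz => ?_), fun z hz =>
    (h'.agree hκ hχ_mem ht (hsub z hz)).2⟩
  · by_contra hn
    exact (hsub z ⟨hF' hz, hn⟩).2 hz
  · by_contra hn
    exact (h'.agree hκ hχ_mem ht ⟨hF hz, hn⟩).1.2 hz
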